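/- **Setting.** Fix $T,s$, integers $M_l\ge 1$, $N_l\ge 0$ ($l=1,\dots,s$), and put $S=\bigcup_l\{-(M_l+N_l),\dots,-M_l\}$, $S^+=-S$, $Z^S=\{1,2,\dots\}\setminus S^+$, $\mathcal U=S\cup\{0,1,2,\dots\}$. Let $\vec a(j)\in\mathbb C^T$ with $\sum_{j\in Z^S}\sum_k|a_k(j)|<\infty$ and $A(e^{i\lambda})=\sum_{j\in Z^S}\vec a(j)e^{-ij\lambda}$. A spectral density is an integrable function on $[-\pi,\pi]$ with values in the positive semidefinite Hermitian $T\times T$ matrices. For spectral densities $F,G$ let $L_2(F+G)$ be the space of vector functions $h$ with $\int h^\top(F+G)\overline h\,d\lambda<\infty$ and $L_2^s(F+G)$ its closed subspace generated by $e^{in\lambda}\delta_k$, $n\in\mathbb Z_-\setminus S$, $1\le k\le T$. The linear estimate of $A\vec\xi=\sum_{j\in Z^S}\vec a(j)^\top\vec\xi(-j)$ from the observations $\vec\xi(j)+\vec\eta(j)$, $j\in\mathbb Z_-\setminus S$ ($\vec\xi,\vec\eta$ uncorrelated stationary sequences with densities $F,G$) with spectral characteristic $h\in L_2^s(F+G)$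 has mean-square error $$\Delta(h;F,G)=\frac1{2\pi}\int_{-\pi}^{\pi}(A-h)^\top F\,\overline{(A-h)}\,d\lambda+\frac1{2\pi}\int_{-\pi}^{\pi}h^\top G\,\overline h\,d\lambda ,$$ and $\Delta(F,G)=\min_{h\in L_2^s(F+G)}\Delta(h;F,G)$. A pair $(F^0,G^0)\in D_F\times D_G$ is *least favorable* in $D=D_F\times D_G$ if $\Delta(F,G)\le\Delta(F^0,G^0)$ for all $(F,G)\in D$. With $H_D=\bigcap_{(F,G)\in D}L_2^s(F+G)$, a function $h^0\in H_D$ is *minimax-robust* if $\max_D\Delta(h^0;F,G)=\min_{h\in H_D}\sup_D\Delta(h;F,G)$. The pair $(F,G)$ satisfies the *minimality condition* if $F+G$ is invertible almost everywhere and $(F+G)^{-1}$ is integrable. Then put $$B(k,j)=\frac1{2\pi}\int (F+G)^{-1}e^{-i(k-j)\lambda}d\lambda,\quad R(k,j)=\frac1{2\pi}\int F(F+G)^{-1}e^{-i(k+j)\lambda}d\lambda,\quad Q(k,j)=\frac1{2\pi}\int F(F+G)^{-1}G\,e^{-i(k-j)\lambda}d\lambda ,$$ $(\mathbf Bc)(k)=\sum_{j\in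 \mathcal U}\vec c(j)^\top B(k,j)$, $(\mathbf Ra)(k)=\sum_{j\in Z^S}\vec a(j)^\top R(k,j)$ for $k\in \mathcal U$, and $\langle\mathbf Qa,a\rangle=\sum_{k,j\in Z^S}\vec a(k)^\top Q(k,j)\overline{\vec a(j)}$. The inverse $\mathbf B^{-1}$ is taken in the completion of the finitely supported sequences on $\mathcal U$ for the energy norm $\langle\mathbf Bx,x\rangle^{1/2}$ (it is the usual inverse if $\mathbf B$ is bounded and boundedly invertible on $\ell_2$). Let $C(e^{i\lambda})=\sum_{k\in \mathcal U}(\mathbf B^{-1}\mathbf Ra)(k)e^{ik\lambda}$ (the integrable function with these Fourier coefficients). **Classes.** Let $F_1,V,U$ be given spectral densities with entries $f^1_{ij},v_{ij},u_{ij}$; let $\delta,q,\delta_k,q_k,\delta_{ij}$ be given numbers and $B_1,B_2,Q$ positive definite Hermitian matrices; $\langle B,F\rangle=\sum_{k,l}b_{kl}f_{kl}$. All $F$ and $G$ below are spectral densities. 1. $D_{1\delta}^1$: $\frac1{2\pi}\int|\mathrm{Tr}(F-F_1)|\,d\lambda\le\delta$. ${D_V^U}^1$: $\mathrm{Tr}V\le\mathrm{Tr}G\le\mathrm{Tr}U$,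 $\frac1{2\pi}\int\mathrm{Tr}G\,d\lambda=q$. 2. $D_{1\delta}^2$: $\frac1{2\pi}\int|f_{kk}-f^1_{kk}|\,d\lambda\le\delta_k$ for all $k$. ${D_V^U}^2$: $v_{kk}\le g_{kk}\le u_{kk}$, $\frac1{2\pi}\int g_{kk}\,d\lambda=q_k$ for all $k$. 3. $D_{1\delta}^3$: $\frac1{2\pi}\int|\langle B_1,F-F_1\rangle|\,d\lambda\le\delta$. ${D_V^U}^3$: $\langle B_2,V\rangle\le\langle B_2,G\rangle\le\langle B_2,U\rangle$, $\frac1{2\pi}\int\langle B_2,G\rangle\,d\lambda=q$. 4. $D_{1\delta}^4$: $\frac1{2\pi}\int|f_{ij}-f^1_{ij}|\,d\lambda\le\delta_{ij}$ for all $i,j$. ${D_V^U}^4$: $V\le G\le U$ in the Loewner order, $\frac1{2\pi}\int G\,d\lambda=Q$. **Relations.** For $F^0,G^0$ and the corresponding $C$ put $M=F^0+G^0$, and consider the rows $\rho_G=A^\top G^0+C^\top$ and $\rho_F=A^\top F^0-C^\top$. For a row $\rho$, $\rho^*\rho$ is the matrix with entries $\overline{\rho_k}\rho_l$. The relations for the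 $k$-th pair require that multipliers exist such that, for almost every $\lambda$: 1. $\rho_G^*\rho_G=\alpha^2\gamma M^2$, $\ \frac1{2\pi}\int|\mathrm{Tr}(F^0-F_1)|d\lambda=\delta$, $\ \rho_F^*\rho_F=(\beta^2+\gamma_1+\gamma_2)M^2$, with $\alpha,\beta\in\mathbb R$, $|\gamma|\le1$, $\gamma=\mathrm{sign}\,\mathrm{Tr}(F^0-F_1)$ where this trace is nonzero, $\gamma_1\le0$ with $\gamma_1=0$ where $\mathrm{Tr}G^0>\mathrm{Tr}V$, and $\gamma_2\ge0$ with $\gamma_2=0$ where $\mathrm{Tr}G^0<\mathrm{Tr}U$. 2. $\rho_G^*\rho_G=M\,\mathrm{diag}(\alpha_k^2\gamma_k)M$, $\ \frac1{2\pi}\int|f^0_{kk}-f^1_{kk}|d\lambda=\delta_k$, $\ \rho_F^*\rho_F=M\,\mathrm{diag}(\beta_k^2+\gamma_{1k}+\gamma_{2k})M$, with, for each $k$, the conditions of item 1 on $\alpha_k,\beta_k,\gamma_k,\gamma_{1k},\gamma_{2k}$, the traces being replaced by the $k$-th diagonal entries. 3. $\rho_G^*\rho_G=\alpha^2\gamma'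 MB_1^\top M$, $\ \frac1{2\pi}\int|\langle B_1,F^0-F_1\rangle|d\lambda=\delta$, $\ \rho_F^*\rho_F=(\beta^2+\gamma_1'+\gamma_2')MB_2^\top M$, with the conditions of item 1 on $\alpha,\beta,\gamma',\gamma_1',\gamma_2'$, the traces being replaced by $\langle B_1,\cdot\rangle$ for $F^0-F_1$ and by $\langle B_2,\cdot\rangle$ for $G^0,V,U$. 4. $\rho_G^*\rho_G=M\{\alpha_{ij}\gamma_{ij}\}_{i,j}M$, $\ \frac1{2\pi}\int|f^0_{ij}-f^1_{ij}|d\lambda=\delta_{ij}$, $\ \rho_F^*\rho_F=M(\vec\beta\vec\beta^*+\Gamma_1+\Gamma_2)M$, with constants $\alpha_{ij}\ge0$, $\vec\beta\in\mathbb C^T$, $|\gamma_{ij}|\le1$, $\gamma_{ij}=(f^0_{ij}-f^1_{ij})/|f^0_{ij}-f^1_{ij}|$ where $f^0_{ij}\ne f^1_{ij}$, $\Gamma_1\le0$ with $\Gamma_1=0$ where $G^0>V$, and $\Gamma_2\ge0$ with $\Gamma_2=0$ where $G^0<U$ (Loewner order; $X>Y$ means $X\ge Y$ and $X\neq Y$).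 **Theorem.** Let $k\in\{1,2,3,4\}$, $D=D_{1\delta}^k\times {D_V^U}^k$, and let $(F^0,G^0)\in D$ satisfy the minimality condition. Then $\mathbf B^{-1}\mathbf Ra$ and $C$ exist for $(F^0,G^0)$, and: (a) if $(F^0,G^0)$ satisfies the relations for the $k$-th pair, then it solves the extremal problem $$\langle\mathbf R a,\mathbf B^{-1}\mathbf R a\rangle+\langle\mathbf Qa,a\rangle\to\max$$ over all $(F,G)\in D$ that satisfy the minimality condition; (b) $(F^0,G^0)$ solves this extremal problem if and only if it is least favorable in $D$ (in particular, it is least favorable if it satisfies the relations); (c) if $(F^0,G^0)$ is least favorable in $D$, then a function $h$ is minimax-robust if and only if, almost everywhere, $$h^\top=A^\top F^0(F^0+G^0)^{-1}-C^\top(F^0+G^0)^{-1}.$$ -/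

import Mathlib

open MeasureTheory Filter Topology Matrix
open scoped MatrixOrder ComplexOrder

namespace MinimaxFiltering

noncomputable section

/-- Matrix-valued functions of the frequency `t`, considered on `(-π, π]`. -/
abbrev MatFn (T : ℕ) := ℝ → Matrix (Fin T) (Fin T) ℂ

/-- Vector-valued functions of the frequency `t`, considered on `(-π, π]`. -/
abbrev VecFn (T : ℕ) := ℝ → Fin T → ℂ

/-- Lebesgue measure on the frequency interval. -/
def freq : Measure ℝ := volume.restrict (Set.Ioc (-Real.pi) Real.pi)

/-- `(1 / 2π) ∫_{-π}^{π} f(t) dt`. -/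
def mean {E : Type*} [NormedAddCommGroup E] [NormedSpace ℝ E] (f : ℝ → E) : E :=
  (1 / (2 * Real.pi)) • ∫ t, f t ∂freq

/-- The character `e^{int}`. -/
def expi (n : ℤ) (t : ℝ) : ℂ := Complex.exp (Complex.I * n * t)

/-- Spectral densities: integrable, with positive semidefinite Hermitian values. -/
structure IsSpectralDensity {T : ℕ} (F : MatFn T) : Prop where
  integrable : ∀ i j, Integrable (fun t => F t i j) freq
  posSemidef : ∀ᵐ t ∂freq, (F t).PosSemidef

/-- The minimality condition `∫ (F + G)⁻¹ < ∞`. -/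
def Minimality {T : ℕ} (F G : MatFn T) : Prop :=
  (∀ᵐ t ∂freq, IsUnit (F t + G t).det) ∧
    ∀ i j, Integrable (fun t => (F t + G t)⁻¹ i j) freq

/-! ### Index sets -/

/-- The missing times `S = ⋃ₗ {-(Mₗ + Nₗ), …, -Mₗ}`. -/
def missing {s : ℕ} (M N : Fin s → ℕ) : Set ℤ :=
  ⋃ l, Set.Icc (-((M l : ℤ) + N l)) (-(M l : ℤ))

/-- The observation times `ℤ₋ \ S`. -/
def observed (S : Set ℤ) : Set ℤ := {n | n < 0 ∧ n ∉ S}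

/-- `U = S ∪ {0, 1, 2, …}`. -/
def unobserved (S : Set ℤ) : Set ℤ := S ∪ {n | 0 ≤ n}

/-- `Z^S = {1, 2, …} \ S⁺` with `S⁺ = -S`. -/
def weightIndex (S : Set ℤ) : Set ℤ := {j | 1 ≤ j ∧ -j ∉ S}

/-! ### Spectral characteristics and mean-square errors -/

/-- The function `A(e^{it}) = ∑_{j ∈ Z^S} a(j) e^{-ijt}` of the functional. -/
def symbolA {T : ℕ} (S : Set ℤ) (a : ℤ → Fin T → ℂ) : VecFn T :=
  fun t => ∑' j : weightIndex S, expi (-(j : ℤ)) t • a j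

/-- `vᵀ K v̄`, a real number for Hermitian `K`. -/
def quad {T : ℕ} (K : Matrix (Fin T) (Fin T) ℂ) (v : Fin T → ℂ) : ℝ :=
  (v ⬝ᵥ (K *ᵥ star v)).re

/-- Membership in the weighted space `L₂(K)`. -/
def MemL2 {T : ℕ} (K : MatFn T) (h : VecFn T) : Prop :=
  AEStronglyMeasurable h freq ∧ Integrable (fun t => quad (K t) (h t)) freq

/-- The trigonometric polynomial `∑ₙ x(n) e^{int}`. -/
def trigPoly {T : ℕ} (x : ℤ →₀ (Fin T → ℂ)) : VecFn T :=
  fun t => x.sum fun n v => expi n t • v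

/-- Membership in `L₂ˢ(K)`, the closed subspace of `L₂(K)` generated by the functions
`e^{int} δₖ`, `n ∈ ℤ₋ \ S`. -/
def MemL2s {T : ℕ} (S : Set ℤ) (K : MatFn T) (h : VecFn T) : Prop :=
  MemL2 K h ∧ ∀ ε > 0, ∃ x : ℤ →₀ (Fin T → ℂ), (x.support : Set ℤ) ⊆ observed S ∧
    ∫ t, quad (K t) (h t - trigPoly x t) ∂freq < ε

/-- The mean-square error `Δ(h; F, G)` of the estimate with spectral characteristic `h`. -/
def mse {T : ℕ} (S : Set ℤ) (a : ℤ → Fin T → ℂ) (h : VecFn T) (F G : MatFn T) : ℝ :=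
  mean (fun t => quad (F t) (symbolA S a t - h t)) + mean (fun t => quad (G t) (h t))

/-- The mean-square error `Δ(F, G)` of the optimal linear estimate. -/
def optimalError {T : ℕ} (S : Set ℤ) (a : ℤ → Fin T → ℂ) (F G : MatFn T) : ℝ :=
  sInf {e | ∃ h, MemL2s S (F + G) h ∧ e = mse S a h F G}

/-- `(F₀, G₀)` is least favorable in `DF × DG`. -/
def IsLeastFavorable {T : ℕ} (S : Set ℤ) (a : ℤ → Fin T → ℂ) (DF DG : Set (MatFn T))
    (F₀ G₀ : MatFn T) : Prop :=
  F₀ ∈ DF ∧ G₀ ∈ DG ∧ ∀ F ∈ DF, ∀ G ∈ DG, optimalError S a F G ≤ optimalError S a F₀ G₀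

/-- Membership in `H_D`, the intersection of all `L₂ˢ(F + G)` with `(F, G) ∈ DF × DG`. -/
def MemHD {T : ℕ} (S : Set ℤ) (DF DG : Set (MatFn T)) (h : VecFn T) : Prop :=
  ∀ F ∈ DF, ∀ G ∈ DG, MemL2s S (F + G) h

/-- `h₀ ∈ H_D`, the maximum of `Δ(h₀; F, G)` over `DF × DG` is attained, and it does not exceed
the supremum (possibly infinite) of `Δ(h; F, G)` for any `h ∈ H_D`. -/
def IsMinimaxRobust {T : ℕ} (S : Set ℤ) (a : ℤ → Fin T → ℂ) (DF DG : Set (MatFn T))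
    (h₀ : VecFn T) : Prop :=
  MemHD S DF DG h₀ ∧
  (∃ F' ∈ DF, ∃ G' ∈ DG, ∀ F ∈ DF, ∀ G ∈ DG, mse S a h₀ F G ≤ mse S a h₀ F' G') ∧
  ∀ h, MemHD S DF DG h → ∀ b : ℝ, (∀ F ∈ DF, ∀ G ∈ DG, mse S a h F G ≤ b) →
    ∀ F ∈ DF, ∀ G ∈ DG, mse S a h₀ F G ≤ b

/-! ### The operators `B`, `R`, `Q`

Coefficient sequences are rows, so a block acts on a vector from the right. -/

/-- The matrix Fourier coefficient `(1 / 2π) ∫ K(t) e^{-int} dt`. -/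
def fourierMat {T : ℕ} (K : MatFn T) (n : ℤ) : Matrix (Fin T) (Fin T) ℂ :=
  Matrix.of fun i j => mean fun t => K t i j * expi (-n) t

/-- The blocks `B(k, j)`. -/
def blockB {T : ℕ} (F G : MatFn T) (k j : ℤ) : Matrix (Fin T) (Fin T) ℂ :=
  fourierMat (fun t => (F t + G t)⁻¹) (k - j)

/-- The blocks `R(k, j)`. -/
def blockR {T : ℕ} (F G : MatFn T) (k j : ℤ) : Matrix (Fin T) (Fin T) ℂ :=
  fourierMat (fun t => F t * (F t + G t)⁻¹) (k + j)

/-- The blocks `Q(k, j)`. -/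
def blockQ {T : ℕ} (F G : MatFn T) (k j : ℤ) : Matrix (Fin T) (Fin T) ℂ :=
  fourierMat (fun t => F t * (F t + G t)⁻¹ * G t) (k - j)

/-- `(B x)(k) = ∑ⱼ x(j)ᵀ B(k, j)` for finitely supported `x`. -/
def applyB {T : ℕ} (F G : MatFn T) (x : ℤ →₀ (Fin T → ℂ)) (k : ℤ) : Fin T → ℂ :=
  x.sum fun j v => v ᵥ* blockB F G k j

/-- `(R a)(k) = ∑_{j ∈ Z^S} a(j)ᵀ R(k, j)`. -/
def applyR {T : ℕ} (S : Set ℤ) (a : ℤ → Fin T → ℂ) (F G : MatFn T) (k : ℤ) : Fin T → ℂ :=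
  ∑' j : weightIndex S, a j ᵥ* blockR F G k j

/-- `⟨Q a, a⟩ = ∑_{k, j ∈ Z^S} a(k)ᵀ Q(k, j) conj(a(j))`. -/
def formQ {T : ℕ} (S : Set ℤ) (a : ℤ → Fin T → ℂ) (F G : MatFn T) : ℝ :=
  (∑' k : weightIndex S, ∑' j : weightIndex S, a k ⬝ᵥ (blockQ F G k j *ᵥ star (a j))).re

/-- `⟨y, x⟩ = ∑ₖ y(k)ᵀ conj(x(k))` for finitely supported `x`. -/
def pairing {T : ℕ} (y : ℤ → Fin T → ℂ) (x : ℤ →₀ (Fin T → ℂ)) : ℂ :=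
  x.sum fun k v => y k ⬝ᵥ star v

/-- `c = B⁻¹ y` on `U`, and `⟨y, B⁻¹ y⟩ = v`. Under the minimality condition the positive
operator `B` need not be bounded, nor bounded from below, so that `B c = y` is meant in the
completion of the finitely supported sequences on `U` for the energy norm `⟨B x, x⟩^{1/2}`: `c` is
the coordinatewise limit of a sequence of finitely supported sequences `x n` that is Cauchy for this
norm and satisfies `B (x n) → y` coordinatewise. If `B` is bounded and boundedly invertible on
`ℓ₂(U)` and `y ∈ ℓ₂(U)`, this is the ordinary `B⁻¹ y`. -/
def IsInverseImage {T : ℕ} (S : Set ℤ) (F G : MatFn T) (y c : ℤ → Fin T → ℂ) (v : ℂ) : Prop :=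
  (∀ k, k ∉ unobserved S → c k = 0) ∧
  ∃ x : ℕ → (ℤ →₀ (Fin T → ℂ)),
    (∀ n, ((x n).support : Set ℤ) ⊆ unobserved S) ∧
    Tendsto (fun p : ℕ × ℕ =>
      pairing (applyB F G (x p.1 - x p.2)) (x p.1 - x p.2)) atTop (𝓝 0) ∧
    (∀ k ∈ unobserved S, Tendsto (fun n => x n k) atTop (𝓝 (c k))) ∧
    (∀ k ∈ unobserved S, Tendsto (fun n => applyB F G (x n) k) atTop (𝓝 (y k))) ∧
    Tendsto (fun n => pairing y (x n)) atTop (𝓝 v)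

/-- `c = B⁻¹ R a`. -/
def IsCoefficient {T : ℕ} (S : Set ℤ) (a : ℤ → Fin T → ℂ) (F G : MatFn T)
    (c : ℤ → Fin T → ℂ) : Prop :=
  ∃ v, IsInverseImage S F G (applyR S a F G) c v

/-- `e = ⟨R a, B⁻¹ R a⟩ + ⟨Q a, a⟩`. -/
def IsErrorValue {T : ℕ} (S : Set ℤ) (a : ℤ → Fin T → ℂ) (F G : MatFn T) (e : ℝ) : Prop :=
  ∃ c v, IsInverseImage S F G (applyR S a F G) c v ∧ e = v.re + formQ S a F G

/-- `(F₀, G₀)` solves the extremal problem of maximizing `⟨R a, B⁻¹ R a⟩ + ⟨Q a, a⟩` over the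
pairs in `DF × DG` for which the operators are defined. -/
def IsExtremal {T : ℕ} (S : Set ℤ) (a : ℤ → Fin T → ℂ) (DF DG : Set (MatFn T))
    (F₀ G₀ : MatFn T) : Prop :=
  ∃ e₀, IsErrorValue S a F₀ G₀ e₀ ∧
    ∀ F ∈ DF, ∀ G ∈ DG, Minimality F G → ∀ e, IsErrorValue S a F G e → e ≤ e₀

/-- `C(t) = ∑ₖ c(k) e^{ikt}`: `C` is the integrable function with Fourier coefficients `c`. -/
def IsFourierSum {T : ℕ} (c : ℤ → Fin T → ℂ) (C : VecFn T) : Prop :=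
  (∀ i, Integrable (fun t => C t i) freq) ∧
    ∀ (k : ℤ) (i : Fin T), mean (fun t => C t i * expi (-k) t) = c k i

/-- The formula `hᵀ = Aᵀ F (F + G)⁻¹ - Cᵀ (F + G)⁻¹`. -/
def IsGivenByFormula {T : ℕ} (S : Set ℤ) (a : ℤ → Fin T → ℂ) (F G : MatFn T) (C h : VecFn T) :
    Prop :=
  ∀ᵐ t ∂freq, h t = symbolA S a t ᵥ* (F t * (F t + G t)⁻¹) - C t ᵥ* (F t + G t)⁻¹

/-- The row `Aᵀ G + Cᵀ`, that is `(A - h)ᵀ (F + G)`. -/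
def rowG {T : ℕ} (S : Set ℤ) (a : ℤ → Fin T → ℂ) (G : MatFn T) (C : VecFn T) : VecFn T :=
  fun t => symbolA S a t ᵥ* G t + C t

/-- The row `Aᵀ F - Cᵀ`, that is `hᵀ (F + G)`. -/
def rowF {T : ℕ} (S : Set ℤ) (a : ℤ → Fin T → ℂ) (F : MatFn T) (C : VecFn T) : VecFn T :=
  fun t => symbolA S a t ᵥ* F t - C t

/-- For a row `r`, the matrix `r* r`, with entries `conj(rₖ) rₗ`. -/
def rowGram {T : ℕ} (r : Fin T → ℂ) : Matrix (Fin T) (Fin T) ℂ := vecMulVec (star r) r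

/-! ### The admissible classes and the relations -/

/-- `⟨B, F⟩ = ∑ₖₗ bₖₗ fₖₗ`, a real number for Hermitian matrices. -/
def matPair {T : ℕ} (B F : Matrix (Fin T) (Fin T) ℂ) : ℝ := (∑ k, ∑ l, B k l * F k l).re

/-- The parameters of the four pairs of classes. -/
inductive ClassPair (T : ℕ) : Type
  | first (δ q : ℝ) : ClassPair T
  | second (δ q : Fin T → ℝ) : ClassPair T
  | third (B₁ B₂ : Matrix (Fin T) (Fin T) ℂ) (hB₁ : B₁.PosDef) (hB₂ : B₂.PosDef) (δ q : ℝ) :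
      ClassPair T
  | fourth (δ : Fin T → Fin T → ℝ) (Q : Matrix (Fin T) (Fin T) ℂ) (hQ : Q.PosDef) : ClassPair T

/-- The classes `D_{1δ}`. -/
def ClassPair.classF {T : ℕ} (P : ClassPair T) (F₁ : MatFn T) : Set (MatFn T) :=
  {F | IsSpectralDensity F ∧
    match P with
    | .first δ _ => mean (fun t => ‖(F t - F₁ t).trace‖) ≤ δ
    | .second δ _ => ∀ k, mean (fun t => ‖F t k k - F₁ t k k‖) ≤ δ k
    | .third B₁ _ _ _ δ _ => mean (fun t => |matPair B₁ (F t - F₁ t)|) ≤ δ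
    | .fourth δ _ _ => ∀ i j, mean (fun t => ‖F t i j - F₁ t i j‖) ≤ δ i j}

/-- The classes `D_V^U`; in the fourth one `≤` is the Loewner order. -/
def ClassPair.classG {T : ℕ} (P : ClassPair T) (V U : MatFn T) : Set (MatFn T) :=
  {G | IsSpectralDensity G ∧
    match P with
    | .first _ q =>
        (∀ᵐ t ∂freq, (V t).trace.re ≤ (G t).trace.re ∧ (G t).trace.re ≤ (U t).trace.re) ∧
          mean (fun t => (G t).trace.re) = q
    | .second _ q => ∀ k,
        (∀ᵐ t ∂freq, (V t k k).re ≤ (G t k k).re ∧ (G t k k).re ≤ (U t k k).re) ∧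
          mean (fun t => (G t k k).re) = q k
    | .third _ B₂ _ _ _ q =>
        (∀ᵐ t ∂freq, matPair B₂ (V t) ≤ matPair B₂ (G t) ∧
          matPair B₂ (G t) ≤ matPair B₂ (U t)) ∧
          mean (fun t => matPair B₂ (G t)) = q
    | .fourth _ Q _ =>
        (∀ᵐ t ∂freq, V t ≤ G t ∧ G t ≤ U t) ∧ ∀ i j, mean (fun t => G t i j) = Q i j}

/-- The relations between `F₀`, `G₀` and the multipliers, where `C(t) = ∑ₖ (B⁻¹ R a)(k) e^{ikt}`
for the operators of `F₀`, `G₀`. -/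
def ClassPair.Relations {T : ℕ} (P : ClassPair T) (S : Set ℤ) (a : ℤ → Fin T → ℂ)
    (F₁ V U F₀ G₀ : MatFn T) (C : VecFn T) : Prop :=
  match P with
  | .first δ _ =>
      ∃ (α β : ℝ) (γ γ₁ γ₂ : ℝ → ℝ),
        mean (fun t => ‖(F₀ t - F₁ t).trace‖) = δ ∧
        ∀ᵐ t ∂freq,
          rowGram (rowG S a G₀ C t) = ((α ^ 2 * γ t : ℝ) : ℂ) • (F₀ t + G₀ t) ^ 2 ∧
          rowGram (rowF S a F₀ C t) = ((β ^ 2 + γ₁ t + γ₂ t : ℝ) : ℂ) • (F₀ t + G₀ t) ^ 2 ∧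
          |γ t| ≤ 1 ∧
          ((F₀ t - F₁ t).trace.re ≠ 0 → γ t = Real.sign (F₀ t - F₁ t).trace.re) ∧
          γ₁ t ≤ 0 ∧ ((V t).trace.re < (G₀ t).trace.re → γ₁ t = 0) ∧
          0 ≤ γ₂ t ∧ ((G₀ t).trace.re < (U t).trace.re → γ₂ t = 0)
  | .second δ _ =>
      ∃ (α β : Fin T → ℝ) (γ γ₁ γ₂ : Fin T → ℝ → ℝ),
        (∀ k, mean (fun t => ‖F₀ t k k - F₁ t k k‖) = δ k) ∧
        ∀ᵐ t ∂freq,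
          rowGram (rowG S a G₀ C t) =
            (F₀ t + G₀ t) * Matrix.diagonal (fun k => ((α k ^ 2 * γ k t : ℝ) : ℂ)) *
              (F₀ t + G₀ t) ∧
          rowGram (rowF S a F₀ C t) =
            (F₀ t + G₀ t) * Matrix.diagonal (fun k => ((β k ^ 2 + γ₁ k t + γ₂ k t : ℝ) : ℂ)) *
              (F₀ t + G₀ t) ∧
          ∀ k, |γ k t| ≤ 1 ∧
            ((F₀ t k k - F₁ t k k).re ≠ 0 → γ k t = Real.sign (F₀ t k k - F₁ t k k).re) ∧
            γ₁ k t ≤ 0 ∧ ((V t k k).re < (G₀ t k k).re → γ₁ k t = 0) ∧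
            0 ≤ γ₂ k t ∧ ((G₀ t k k).re < (U t k k).re → γ₂ k t = 0)
  | .third B₁ B₂ _ _ δ _ =>
      ∃ (α β : ℝ) (γ γ₁ γ₂ : ℝ → ℝ),
        mean (fun t => |matPair B₁ (F₀ t - F₁ t)|) = δ ∧
        ∀ᵐ t ∂freq,
          rowGram (rowG S a G₀ C t) =
            ((α ^ 2 * γ t : ℝ) : ℂ) • ((F₀ t + G₀ t) * B₁ᵀ * (F₀ t + G₀ t)) ∧
          rowGram (rowF S a F₀ C t) =
            ((β ^ 2 + γ₁ t + γ₂ t : ℝ) : ℂ) • ((F₀ t + G₀ t) * B₂ᵀ * (F₀ t + G₀ t)) ∧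
          |γ t| ≤ 1 ∧
          (matPair B₁ (F₀ t - F₁ t) ≠ 0 → γ t = Real.sign (matPair B₁ (F₀ t - F₁ t))) ∧
          γ₁ t ≤ 0 ∧ (matPair B₂ (V t) < matPair B₂ (G₀ t) → γ₁ t = 0) ∧
          0 ≤ γ₂ t ∧ (matPair B₂ (G₀ t) < matPair B₂ (U t) → γ₂ t = 0)
  | .fourth δ _ _ =>
      ∃ (α : Fin T → Fin T → ℝ) (β : Fin T → ℂ) (γ : Fin T → Fin T → ℝ → ℂ) (Γ₁ Γ₂ : MatFn T),
        (∀ i j, 0 ≤ α i j) ∧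
        (∀ i j, mean (fun t => ‖F₀ t i j - F₁ t i j‖) = δ i j) ∧
        ∀ᵐ t ∂freq,
          rowGram (rowG S a G₀ C t) =
            (F₀ t + G₀ t) * Matrix.of (fun i j => (α i j : ℂ) * γ i j t) * (F₀ t + G₀ t) ∧
          rowGram (rowF S a F₀ C t) =
            (F₀ t + G₀ t) * (vecMulVec β (star β) + Γ₁ t + Γ₂ t) * (F₀ t + G₀ t) ∧
          (∀ i j, ‖γ i j t‖ ≤ 1 ∧
            (F₀ t i j - F₁ t i j ≠ 0 →
              γ i j t = (F₀ t i j - F₁ t i j) / (‖F₀ t i j - F₁ t i j‖ : ℂ))) ∧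
          Γ₁ t ≤ 0 ∧ (V t < G₀ t → Γ₁ t = 0) ∧
          0 ≤ Γ₂ t ∧ (G₀ t < U t → Γ₂ t = 0)

end

end MinimaxFiltering

open MinimaxFiltering

namespace MinimaxFiltering

/-! ### Fourier coefficients and Fejér means -/

/-! Put `K = F + G` and `L = K⁻¹`. Under minimality both are integrable weights, and `f ↦ fᵀ K` is
an isometry of `L₂(K)` onto `L₂(L)`; this pair is the structure `DualWeights`. Cauchy–Schwarz for
the two weights embeds `L₂(K)` into `L₁`, so Fourier coefficients are defined and continuous there,
and `L₂(K)` is complete.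

Completing the square (`mse_eq`) gives `Δ(h; F, G) = ⟨Q a, a⟩ + (2π)⁻¹ ‖f₀ - h‖²` in `L₂(K)`, with
`f₀ᵀ = Aᵀ F K⁻¹`. The optimal `h` is therefore the projection of `f₀` onto the span of the observed
characters, and the row `C = (f₀ - h)ᵀ K` of `L₂(L)` has no observed frequency. On polynomials with
unobserved frequencies the energy form of `B` is `(2π)⁻¹ ‖·‖²` in `L₂(L)`. Since `h = f₀ - C L` has
no unobserved frequency, `C` solves `B C = R a`, provided that `C` is a limit of polynomials with
unobserved frequencies.

This density, `DualWeights.mem_closure_of_vcoef`, is the analytic core. The difference `D` between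
`C` and its projection has no observed frequency, while `g = D L` has no unobserved one. Removing
the finitely many frequencies of `S` from `D` leaves a function with frequencies `≥ 0`; the
conjugate of `g` has frequencies `> 0`. Both are only integrable, but so is their product, and a
Smirnov type theorem (`integral_dotProduct_eq_zero`) makes the integral of the product vanish,
whence `‖D‖ = 0`. That theorem is proved with bounded analytic multipliers `(1 + ε H)⁻¹`, where `Re
H` is the root of a majorant. It follows that the value in the extremal problem is exactly `Δ(F,
G)`.

The equivalence in (b) uses that mixing any pair with `(F₀, G₀)` preserves minimality, and that `Δ`
is concave, being an infimum of functions affine in the pair.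

For (c), `IsOptimal.saddle` perturbs `(F₀, G₀)` towards `(F, G)`. Near-optimal estimates for small
mixtures have errors close to at most `Δ(F₀, G₀)` for both pairs. The sets of such estimates, in the
space with weight `F₀ + G₀ + F + G`, are nested, bounded, closed and midpoint convex, so they have a
common point; by uniqueness of the optimal estimate this point is `h`. Hence `h` is admissible for
`(F, G)`, with no larger error there.

For (a), the factors `F₀ + G₀` cancel from the relations, which become formulas for the Gram
matrices of `A - h` and `h`. The first bounds `A - h`, so `h` is bounded and admissible for every
pair. Subgradient inequalities for the deviation from `F₁` and complementary slackness for the band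
`[V, U]` then show that `Δ(h; ·, ·)` is largest at `(F₀, G₀)`. -/

instance : IsFiniteMeasure freq := by
  unfold freq; infer_instance

lemma continuous_expi (n : ℤ) : Continuous (expi n) := by
  unfold expi; fun_prop

lemma expi_add (m n : ℤ) (t : ℝ) : expi (m + n) t = expi m t * expi n t := by
  simp only [expi, ← Complex.exp_add]; congr 1; push_cast; ring

@[simp] lemma expi_zero (t : ℝ) : expi 0 t = 1 := by simp [expi]

lemma star_expi (n : ℤ) (t : ℝ) : star (expi n t) = expi (-n) t := by
  simp only [expi, Complex.star_def, ← Complex.exp_conj]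
  congr 1; simp

@[simp] lemma norm_expi (n : ℤ) (t : ℝ) : ‖expi n t‖ = 1 := by
  rw [expi, show Complex.I * n * t = ((n * t : ℝ) : ℂ) * Complex.I by push_cast; ring,
    Complex.norm_exp_ofReal_mul_I]

lemma expi_natCast (n : ℕ) (t : ℝ) : expi n t = expi 1 t ^ n := by
  rw [expi, expi, ← Complex.exp_nat_mul]; congr 1; push_cast; ring

lemma integral_freq {E : Type*} [NormedAddCommGroup E] [NormedSpace ℝ E] (f : ℝ → E) :
    ∫ t, f t ∂freq = ∫ t in (-Real.pi)..Real.pi, f t := by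
  rw [intervalIntegral.integral_of_le (by linarith [Real.pi_pos])]; rfl

lemma integral_expi (n : ℤ) : ∫ t, expi n t ∂freq = if n = 0 then (2 * Real.pi : ℂ) else 0 := by
  rw [integral_freq]
  split_ifs with h
  · subst h; simp; ring
  · have hc : Complex.I * n ≠ 0 := by simp [h]
    have := integral_exp_mul_complex (a := -Real.pi) (b := Real.pi) hc
    simp only [expi]
    rw [this]
    have : Complex.exp (Complex.I * n * (Real.pi : ℝ)) =
        Complex.exp (Complex.I * n * ((-Real.pi : ℝ) : ℂ)) := by
      rw [Complex.exp_eq_exp_iff_exists_int]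
      exact ⟨n, by push_cast; ring⟩
    rw [this, sub_self, zero_div]

lemma mean_expi (n : ℤ) : mean (expi n) = if n = 0 then (1 : ℂ) else 0 := by
  rw [mean, integral_expi]
  split_ifs
  · rw [Complex.real_smul]; push_cast
    have : (Real.pi : ℂ) ≠ 0 := by exact_mod_cast Real.pi_ne_zero
    field_simp
  · simp

/-- The Fourier coefficients of a scalar function. -/
noncomputable def coef (f : ℝ → ℂ) (n : ℤ) : ℂ := mean fun t => f t * expi (-n) t

/-! ### Linearity, monotonicity and limits of the normalized integral -/

section mean

variable {E : Type*} [NormedAddCommGroup E] [NormedSpace ℝ E] {f g : ℝ → E}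

lemma mean_congr_ae (h : f =ᵐ[freq] g) : mean f = mean g := by
  simp only [mean, integral_congr_ae h]

lemma mean_add (hf : Integrable f freq) (hg : Integrable g freq) :
    mean (fun t => f t + g t) = mean f + mean g := by
  simp only [mean, integral_add hf hg, smul_add]

lemma mean_sub (hf : Integrable f freq) (hg : Integrable g freq) :
    mean (fun t => f t - g t) = mean f - mean g := by
  simp only [mean, integral_sub hf hg, smul_sub]

lemma mean_finset_sum {ι : Type*} (s : Finset ι) {f : ι → ℝ → E}
    (hf : ∀ i ∈ s, Integrable (f i) freq) :
    mean (fun t => ∑ i ∈ s, f i t) = ∑ i ∈ s, mean (f i) := by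
  simp only [mean, integral_finsetSum s hf, Finset.smul_sum]

lemma mean_const_mul (c : ℂ) (f : ℝ → ℂ) : mean (fun t => c * f t) = c * mean f := by
  simp only [mean, integral_const_mul, mul_smul_comm]

lemma mean_const_mul_real (c : ℝ) (f : ℝ → ℝ) : mean (fun t => c * f t) = c * mean f := by
  simp only [mean, integral_const_mul, mul_smul_comm]

lemma mean_star (f : ℝ → ℂ) : mean (fun t => star (f t)) = star (mean f) := by
  simp only [mean, Complex.star_def, integral_conj, Complex.real_smul, map_mul, Complex.conj_ofReal]

lemma mean_re {f : ℝ → ℂ} (hf : Integrable f freq) : mean (fun t => (f t).re) = (mean f).re := by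
  have := integral_re hf
  simp only [mean, Complex.real_smul, Complex.re_ofReal_mul, smul_eq_mul]
  congr 1

lemma mean_mono {f g : ℝ → ℝ} (hf : Integrable f freq) (hg : Integrable g freq)
    (h : ∀ᵐ t ∂freq, f t ≤ g t) : mean f ≤ mean g := by
  simp only [mean, smul_eq_mul]
  have := integral_mono_ae hf hg h
  have hp := Real.pi_pos
  gcongr

lemma mean_nonneg {f : ℝ → ℝ} (h : ∀ᵐ t ∂freq, 0 ≤ f t) : 0 ≤ mean f := by
  simp only [mean, smul_eq_mul]
  have := integral_nonneg_of_ae h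
  have hp := Real.pi_pos
  positivity

lemma mean_eq_zero_iff : mean f = 0 ↔ ∫ t, f t ∂freq = 0 := by
  simp [mean, Real.pi_ne_zero]

lemma tendsto_mean_of_dominated {F : ℕ → ℝ → E} (bound : ℝ → ℝ)
    (hF : ∀ n, AEStronglyMeasurable (F n) freq) (hb : Integrable bound freq)
    (hFb : ∀ n, ∀ᵐ t ∂freq, ‖F n t‖ ≤ bound t)
    (hlim : ∀ᵐ t ∂freq, Tendsto (fun n => F n t) atTop (𝓝 (f t))) :
    Tendsto (fun n => mean (F n)) atTop (𝓝 (mean f)) :=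
  (tendsto_integral_of_dominated_convergence bound hF hb hFb hlim).const_smul _

end mean

lemma integrable_mul_expi {f : ℝ → ℂ} (hf : Integrable f freq) (n : ℤ) :
    Integrable (fun t => f t * expi n t) freq :=
  hf.mul_bdd (c := 1) (continuous_expi n).aestronglyMeasurable
    (Eventually.of_forall fun t => by simp)

lemma coef_expi (m n : ℤ) : coef (expi m) n = if m = n then 1 else 0 := by
  simp only [coef, ← expi_add]
  rw [show (fun t => expi (m + -n) t) = expi (m + -n) from rfl, mean_expi]
  simp [← sub_eq_add_neg, sub_eq_zero]

lemma coef_congr_ae {f g : ℝ → ℂ} (h : f =ᵐ[freq] g) (n : ℤ) : coef f n = coef g n :=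
  mean_congr_ae (h.mono fun t ht => by simp [ht])

lemma coef_add {f g : ℝ → ℂ} (hf : Integrable f freq) (hg : Integrable g freq) (n : ℤ) :
    coef (fun t => f t + g t) n = coef f n + coef g n := by
  simp only [coef, add_mul]
  exact mean_add (integrable_mul_expi hf _) (integrable_mul_expi hg _)

lemma coef_sub {f g : ℝ → ℂ} (hf : Integrable f freq) (hg : Integrable g freq) (n : ℤ) :
    coef (fun t => f t - g t) n = coef f n - coef g n := by
  simp only [coef, sub_mul]
  exact mean_sub (integrable_mul_expi hf _) (integrable_mul_expi hg _)

lemma coef_finset_sum {ι : Type*} (s : Finset ι) {f : ι → ℝ → ℂ}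
    (hf : ∀ i ∈ s, Integrable (f i) freq) (n : ℤ) :
    coef (fun t => ∑ i ∈ s, f i t) n = ∑ i ∈ s, coef (f i) n := by
  simp only [coef, Finset.sum_mul]
  exact mean_finset_sum s fun i hi => integrable_mul_expi (hf i hi) _

lemma coef_const_mul (c : ℂ) (f : ℝ → ℂ) (n : ℤ) : coef (fun t => c * f t) n = c * coef f n := by
  simp only [coef, mul_assoc]
  exact mean_const_mul _ _

lemma coef_star (f : ℝ → ℂ) (n : ℤ) : coef (fun t => star (f t)) n = star (coef f (-n)) := by
  rw [coef, coef, ← mean_star]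
  congr 1; ext t
  rw [star_mul', star_expi, neg_neg]

lemma coef_expi_mul (f : ℝ → ℂ) (m n : ℤ) :
    coef (fun t => expi m t * f t) n = coef f (n - m) := by
  simp only [coef]
  congr 1; ext t
  rw [mul_comm (expi m t), mul_assoc, ← expi_add]
  congr 2; ring

lemma integrable_expi (n : ℤ) : Integrable (expi n) freq :=
  Integrable.of_bound (continuous_expi n).aestronglyMeasurable 1 (Eventually.of_forall (by simp))

lemma fourierCoeffOn_eq_coef (f : ℝ → ℂ) (n : ℤ) :
    fourierCoeffOn (by linarith [Real.pi_pos] : -Real.pi < Real.pi) f n = coef f n := by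
  rw [fourierCoeffOn_eq_integral, coef, mean, integral_freq]
  rw [show Real.pi - -Real.pi = 2 * Real.pi by ring]
  congr 2; ext t
  rw [fourier_coe_apply, smul_eq_mul, mul_comm, expi]
  congr 2
  have : (Real.pi : ℂ) ≠ 0 := by exact_mod_cast Real.pi_ne_zero
  push_cast
  field_simp

lemma ae_eq_zero_of_coef_of_memLp {f : ℝ → ℂ} (hf : MemLp f 2 freq) (h : ∀ n, coef f n = 0) :
    f =ᵐ[freq] 0 := by
  have h1 := hasSum_sq_fourierCoeffOn (by linarith [Real.pi_pos] : -Real.pi < Real.pi) hf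
  simp only [fourierCoeffOn_eq_coef, h, ← integral_freq] at h1
  simp only [norm_zero, ne_eq, OfNat.ofNat_ne_zero, not_false_eq_true, zero_pow] at h1
  have h2 := h1.unique hasSum_zero
  have h3 : ∫ t, ‖f t‖ ^ 2 ∂freq = 0 := by
    rw [smul_eq_mul, mul_eq_zero] at h2
    exact h2.resolve_left (inv_ne_zero (by linarith [Real.pi_pos]))
  have h4 := (integral_eq_zero_iff_of_nonneg (fun t => by positivity)
    (hf.integrable_norm_pow two_ne_zero)).1 h3
  filter_upwards [h4] with t ht
  simpa using ht

/-! ### The characters as a Hilbert basis of `L²` -/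

lemma memLp_expi (n : ℤ) : MemLp (expi n) 2 freq :=
  MemLp.of_bound (continuous_expi n).aestronglyMeasurable 1 (Eventually.of_forall (by simp))

/-- The normalized characters in `L²`. -/
noncomputable def charLp (n : ℤ) : Lp ℂ 2 freq :=
  ((Real.sqrt (2 * Real.pi))⁻¹ : ℂ) • (memLp_expi n).toLp

lemma inner_charLp (n : ℤ) (u : Lp ℂ 2 freq) :
    inner ℂ (charLp n) u = (Real.sqrt (2 * Real.pi) : ℂ) * coef u n := by
  have hs : (Real.sqrt (2 * Real.pi) : ℂ) ^ 2 = 2 * Real.pi := by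
    rw [← Complex.ofReal_pow, Real.sq_sqrt (by positivity)]; push_cast; ring
  have hne : (Real.sqrt (2 * Real.pi) : ℂ) ≠ 0 := by
    intro h; rw [h] at hs
    simp [Real.pi_ne_zero] at hs
  rw [charLp, inner_smul_left, L2.inner_def]
  have : ∫ t, inner ℂ (((memLp_expi n).toLp : ℝ → ℂ) t) (u t) ∂freq =
      ∫ t, u t * expi (-n) t ∂freq := by
    apply integral_congr_ae
    filter_upwards [(memLp_expi n).coeFn_toLp] with t ht
    rw [ht, RCLike.inner_apply, ← star_expi]; rfl
  rw [this, coef, mean, Complex.real_smul, map_inv₀, Complex.conj_ofReal]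
  have hp : (Real.pi : ℂ) ≠ 0 := by exact_mod_cast Real.pi_ne_zero
  push_cast
  field_simp
  rw [hs]; ring

lemma orthonormal_charLp : Orthonormal ℂ charLp := by
  rw [orthonormal_iff_ite]
  intro i j
  rw [inner_charLp]
  have : coef (charLp j) i = ((Real.sqrt (2 * Real.pi))⁻¹ : ℂ) * coef (expi j) i := by
    rw [← coef_const_mul]
    apply coef_congr_ae
    filter_upwards [Lp.coeFn_smul ((Real.sqrt (2 * Real.pi))⁻¹ : ℂ) ((memLp_expi j).toLp),
      (memLp_expi j).coeFn_toLp] with t h1 h2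
    rw [charLp, h1, Pi.smul_apply, h2, smul_eq_mul]
  have hne : (Real.sqrt (2 * Real.pi) : ℂ) ≠ 0 := by
    exact_mod_cast (Real.sqrt_pos.2 (by positivity)).ne'
  rw [this, coef_expi, ← mul_assoc, mul_inv_cancel₀ hne, one_mul]
  simp [eq_comm]

/-- The characters form a Hilbert basis of `L²`. -/
noncomputable def charBasis : HilbertBasis ℤ ℂ (Lp ℂ 2 freq) :=
  HilbertBasis.mkOfOrthogonalEqBot orthonormal_charLp <| by
    rw [Submodule.eq_bot_iff]
    intro u hu
    rw [Submodule.mem_orthogonal] at hu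
    have hne : (Real.sqrt (2 * Real.pi) : ℂ) ≠ 0 := by
      exact_mod_cast (Real.sqrt_pos.2 (by positivity)).ne'
    have h0 : ∀ n, coef u n = 0 := fun n => by
      have := hu _ (Submodule.subset_span ⟨n, rfl⟩)
      rw [inner_charLp] at this
      exact (mul_eq_zero.1 this).resolve_left hne
    exact Lp.ext ((ae_eq_zero_of_coef_of_memLp (Lp.memLp u) h0).trans
      (Lp.coeFn_zero ℂ 2 freq).symm)

lemma charBasis_apply (n : ℤ) : charBasis n = charLp n := by
  rw [charBasis, HilbertBasis.coe_mkOfOrthogonalEqBot]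

lemma charBasis_repr_smul (u : Lp ℂ 2 freq) (n : ℤ) :
    charBasis.repr u n • charBasis n = coef u n • (memLp_expi n).toLp := by
  have hne : (Real.sqrt (2 * Real.pi) : ℂ) ≠ 0 := by
    exact_mod_cast (Real.sqrt_pos.2 (by positivity)).ne'
  rw [HilbertBasis.repr_apply_apply, charBasis_apply, inner_charLp, charLp, smul_smul]
  congr 1
  field_simp

/-- A square integrable function with prescribed square summable Fourier coefficients. -/
lemma exists_coef_eq (c : ℤ → ℂ) (hc : Summable fun n => ‖c n‖ ^ 2) :
    ∃ f : ℝ → ℂ, MemLp f 2 freq ∧ ∀ n, coef f n = c n := by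
  have hne : (Real.sqrt (2 * Real.pi) : ℂ) ≠ 0 := by
    exact_mod_cast (Real.sqrt_pos.2 (by positivity)).ne'
  have hm : Memℓp (fun n => (Real.sqrt (2 * Real.pi) : ℂ) * c n) 2 := by
    apply memℓp_gen
    simp only [norm_mul, mul_pow, ENNReal.toReal_ofNat, Real.rpow_ofNat]
    exact hc.mul_left _
  let w : lp (fun _ : ℤ => ℂ) 2 := ⟨_, hm⟩
  refine ⟨charBasis.repr.symm w, Lp.memLp _, fun n => ?_⟩
  have h1 : charBasis.repr (charBasis.repr.symm w) n = w n := by simp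
  rw [HilbertBasis.repr_apply_apply, charBasis_apply, inner_charLp] at h1
  exact mul_left_cancel₀ hne h1

lemma summable_coef_sq {f : ℝ → ℂ} (hf : MemLp f 2 freq) : Summable fun n => ‖coef f n‖ ^ 2 := by
  have h1 := hasSum_sq_fourierCoeffOn (by linarith [Real.pi_pos] : -Real.pi < Real.pi) hf
  simp only [fourierCoeffOn_eq_coef] at h1
  exact h1.summable

/-- The Fejér means of the Fourier series. -/
noncomputable def fejer (f : ℝ → ℂ) (N : ℕ) (t : ℝ) : ℂ :=
  (N : ℂ)⁻¹ * ∑ j ∈ Finset.range N, ∑ l ∈ Finset.range N,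
    coef f ((j : ℤ) - l) * expi ((j : ℤ) - l) t

/-- Enlarging the square of pairs `(j, l)` by one row and one column adds one symmetric partial sum.
Hence the double sum defining the Fejér mean is a sum of symmetric partial sums, to which Cesàro's
theorem applies. -/
lemma sum_range_sub_eq {E : Type*} [AddCommGroup E] (g : ℤ → E) (N : ℕ) :
    ∑ j ∈ Finset.range N, ∑ l ∈ Finset.range N, g ((j : ℤ) - l) =
      ∑ k ∈ Finset.range N, (∑ i ∈ Finset.range (k + 1), (g i + g (-i)) - g 0) := by
  induction N with
  | zero => simp
  | succ N ih =>
    rw [Finset.sum_range_succ _ N,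
      Finset.sum_range_succ (fun k => (∑ i ∈ Finset.range (k + 1), (g ↑i + g (-↑i)) - g 0)) N, ← ih]
    simp only [Finset.sum_range_succ _ N, Finset.sum_add_distrib]
    have h1 : ∑ l ∈ Finset.range N, g ((N : ℤ) - l) = ∑ i ∈ Finset.range N, g (↑(i + 1)) := by
      rw [← Finset.sum_range_reflect]
      refine Finset.sum_congr rfl fun i hi => ?_
      have := Finset.mem_range.1 hi
      congr 1; omega
    have h2 : ∑ l ∈ Finset.range N, g ((l : ℤ) - N) = ∑ i ∈ Finset.range N, g (-↑(i + 1)) := by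
      rw [← Finset.sum_range_reflect]
      refine Finset.sum_congr rfl fun i hi => ?_
      have := Finset.mem_range.1 hi
      congr 1; omega
    rw [h1, h2]
    have h3 : ∑ x ∈ Finset.range N, g (-(x : ℤ)) + g (-(N : ℤ)) =
        ∑ i ∈ Finset.range N, g (-↑(i + 1)) + g 0 := by
      rw [← Finset.sum_range_succ (fun x : ℕ => g (-(x : ℤ))), Finset.sum_range_succ' _ N]
      simp
    rw [show g (-(N : ℤ)) = ∑ i ∈ Finset.range N, g (-↑(i + 1)) + g 0 -
      ∑ x ∈ Finset.range N, g (-(x : ℤ)) from eq_sub_of_add_eq' h3]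
    have h4 : ∑ x ∈ Finset.range N, g (x : ℤ) + g (N : ℤ) =
        ∑ i ∈ Finset.range N, g (↑(i + 1)) + g 0 := by
      rw [← Finset.sum_range_succ (fun x : ℕ => g (x : ℤ)), Finset.sum_range_succ' _ N]
      simp
    rw [show g (N : ℤ) = ∑ i ∈ Finset.range N, g (↑(i + 1)) + g 0 -
      ∑ x ∈ Finset.range N, g (x : ℤ) from eq_sub_of_add_eq' h4]
    simp only [sub_self]
    generalize ∑ i ∈ Finset.range N, g (↑(i + 1)) = X
    generalize ∑ i ∈ Finset.range N, g (-↑(i + 1)) = Y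
    abel

lemma coeFn_sum_expi {ι : Type*} (s : Finset ι) (c : ι → ℂ) (n : ι → ℤ) :
    ((∑ i ∈ s, c i • (memLp_expi (n i)).toLp : Lp ℂ 2 freq) : ℝ → ℂ) =ᵐ[freq]
      fun t => ∑ i ∈ s, c i * expi (n i) t := by
  classical
  induction s using Finset.induction_on with
  | empty =>
    simp only [Finset.sum_empty]
    exact Lp.coeFn_zero ℂ 2 freq
  | insert i s hi ih =>
    rw [Finset.sum_insert hi]
    filter_upwards [ih, Lp.coeFn_add (c i • (memLp_expi (n i)).toLp)
      (∑ i ∈ s, c i • (memLp_expi (n i)).toLp : Lp ℂ 2 freq),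
      Lp.coeFn_smul (c i) (memLp_expi (n i)).toLp, (memLp_expi (n i)).coeFn_toLp]
      with t h1 h2 h3 h4
    rw [h2, Pi.add_apply, h1, h3, Pi.smul_apply, h4, Finset.sum_insert hi, smul_eq_mul]

lemma continuous_fejer (f : ℝ → ℂ) (N : ℕ) : Continuous (fejer f N) := by
  unfold fejer
  have := continuous_expi
  fun_prop

/-- Fejér means converge in `L²`. -/
lemma tendsto_fejer_eLpNorm {f : ℝ → ℂ} (hf : MemLp f 2 freq) :
    Tendsto (fun N => eLpNorm (fun t => fejer f N t - f t) 2 freq) atTop (𝓝 0) := by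
  set u : Lp ℂ 2 freq := hf.toLp with hu
  have hcoef : ∀ n, coef u n = coef f n := fun n => coef_congr_ae hf.coeFn_toLp n
  set g : ℤ → Lp ℂ 2 freq := fun n => coef f n • (memLp_expi n).toLp with hg
  have hsum : HasSum g u := by
    have := charBasis.hasSum_repr u
    simpa only [charBasis_repr_smul, hcoef] using this
  -- The sums of `g i + g (-i)` count the index `0` twice, so one copy of `g 0` is subtracted.
  have h1 := (hsum.nat_add_neg.tendsto_sum_nat.comp (tendsto_add_atTop_nat 1)).sub_const (g 0)
  rw [add_sub_cancel_right] at h1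
  have h2 := h1.cesaro_smul
  have h3 : ∀ N : ℕ, (((N : ℝ)⁻¹ • ∑ k ∈ Finset.range N,
      (((fun n : ℕ => ∑ i ∈ Finset.range n, (g i + g (-i))) ∘ fun a => a + 1) k - g 0) :
        Lp ℂ 2 freq) : ℝ → ℂ) =ᵐ[freq] fejer f N := by
    intro N
    have e1 : ∑ k ∈ Finset.range N,
      (((fun n : ℕ => ∑ i ∈ Finset.range n, (g i + g (-i))) ∘ fun a => a + 1) k - g 0) =
        ∑ p ∈ Finset.range N ×ˢ Finset.range N, coef f ((p.1 : ℤ) - p.2) •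
          (memLp_expi ((p.1 : ℤ) - p.2)).toLp := by
      rw [Finset.sum_product, sum_range_sub_eq g N]
      rfl
    rw [e1]
    filter_upwards [Lp.coeFn_smul ((N : ℝ)⁻¹) (∑ p ∈ Finset.range N ×ˢ Finset.range N,
        coef f ((p.1 : ℤ) - p.2) • (memLp_expi ((p.1 : ℤ) - p.2)).toLp : Lp ℂ 2 freq),
      coeFn_sum_expi (Finset.range N ×ˢ Finset.range N)
        (fun p => coef f ((p.1 : ℤ) - p.2)) (fun p => (p.1 : ℤ) - p.2)] with t h4 h5
    rw [h4, Pi.smul_apply, h5, fejer, Finset.sum_product, Complex.real_smul]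
    push_cast; rfl
  rw [Lp.tendsto_Lp_iff_tendsto_eLpNorm'] at h2
  refine h2.congr fun N => eLpNorm_congr_ae ?_
  filter_upwards [h3 N, hf.coeFn_toLp] with t h4 h5
  rw [Pi.sub_apply, h4, hu, h5]

/-- The Fejér kernel. -/
noncomputable def fejerKernel (N : ℕ) (x : ℝ) : ℝ :=
  (N : ℝ)⁻¹ * ‖∑ j ∈ Finset.range N, expi j x‖ ^ 2

lemma fejerKernel_nonneg (N : ℕ) (x : ℝ) : 0 ≤ fejerKernel N x := by
  unfold fejerKernel; positivity

lemma expi_sub_apply (n : ℤ) (t s : ℝ) : expi n (t - s) = expi n t * expi (-n) s := by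
  simp only [expi, ← Complex.exp_add]; congr 1; push_cast; ring

lemma fejerKernel_eq (N : ℕ) (t s : ℝ) :
    (fejerKernel N (t - s) : ℂ) = (N : ℂ)⁻¹ * ∑ j ∈ Finset.range N, ∑ l ∈ Finset.range N,
      expi ((j : ℤ) - l) t * expi (-((j : ℤ) - l)) s := by
  have h : ∀ z : ℂ, ((‖z‖ ^ 2 : ℝ) : ℂ) = z * star z := fun z => by
    rw [Complex.star_def, Complex.mul_conj, Complex.normSq_eq_norm_sq]
  rw [fejerKernel, Complex.ofReal_mul, h, star_sum, Finset.sum_mul_sum]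
  simp only [star_expi, ← expi_sub_apply, ← expi_add, ← sub_eq_add_neg]
  push_cast; rfl

lemma integrable_mul_fejerKernel {f : ℝ → ℂ} (hf : Integrable f freq) (N : ℕ) (t : ℝ) :
    Integrable (fun s => f s * (fejerKernel N (t - s) : ℂ)) freq := by
  simp only [fejerKernel_eq, Finset.mul_sum]
  refine integrable_finsetSum _ fun j _ => integrable_finsetSum _ fun l _ => ?_
  have := (integrable_mul_expi hf (-((j : ℤ) - l))).const_mul ((N : ℂ)⁻¹ * expi ((j : ℤ) - l) t)
  refine this.congr (Eventually.of_forall fun s => ?_)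
  simp only; ring

lemma fejer_eq_mean {f : ℝ → ℂ} (hf : Integrable f freq) (N : ℕ) (t : ℝ) :
    fejer f N t = mean fun s => f s * (fejerKernel N (t - s) : ℂ) := by
  have : ∀ s, f s * (fejerKernel N (t - s) : ℂ) = ∑ p ∈ Finset.range N ×ˢ Finset.range N,
      ((N : ℂ)⁻¹ * expi ((p.1 : ℤ) - p.2) t) * (f s * expi (-((p.1 : ℤ) - p.2)) s) := fun s => by
    rw [fejerKernel_eq, ← Finset.sum_product', Finset.mul_sum, Finset.mul_sum]
    exact Finset.sum_congr rfl fun p _ => by ring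
  simp only [this]
  rw [mean_finset_sum _ fun p _ => (integrable_mul_expi hf _).const_mul _, fejer,
    ← Finset.sum_product', Finset.mul_sum]
  refine Finset.sum_congr rfl fun p _ => ?_
  rw [mean_const_mul, coef]; ring

lemma coef_one (n : ℤ) : coef (fun _ => 1) n = if n = 0 then 1 else 0 := by
  have := coef_expi 0 n
  simp only [eq_comm (a := (0 : ℤ))] at this
  rw [← this]
  congr 1; ext t; simp

lemma mean_fejerKernel {N : ℕ} (hN : N ≠ 0) (t : ℝ) :
    mean (fun s => fejerKernel N (t - s)) = 1 := by
  -- The mean of the kernel is the Fejér mean of the constant `1`, in which only the `N` diagonal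
  -- terms survive.
  have h1 : fejer (fun _ => 1) N t = 1 := by
    simp only [fejer, coef_one]
    have : ∀ j l : ℕ, ((if (j : ℤ) - l = 0 then 1 else 0 : ℂ) * expi ((j : ℤ) - l) t) =
        if j = l then 1 else 0 := fun j l => by
      by_cases h : j = l
      · simp [h]
      · rw [if_neg (by omega), if_neg h, zero_mul]
    simp only [this, Finset.sum_ite_eq, Finset.mem_range]
    rw [Finset.sum_congr rfl fun j hj => if_pos (Finset.mem_range.1 hj)]
    simp [hN]
  rw [fejer_eq_mean (integrable_const _)] at h1
  simp only [one_mul] at h1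
  have := mean_re (f := fun s => (fejerKernel N (t - s) : ℂ))
    (by simpa using integrable_mul_fejerKernel (integrable_const (1 : ℂ)) N t)
  rw [h1] at this
  simpa using this

/-- The Fejér kernel is nonnegative with mean one, so for `N ≠ 0` the Fejér mean is an average of
values of `f`; for `N = 0` it is zero. This bound provides the majorants for dominated convergence.
-/
lemma norm_fejer_le {f : ℝ → ℂ} (hf : AEStronglyMeasurable f freq) {B : ℝ} (hB : 0 ≤ B)
    (hfB : ∀ᵐ t ∂freq, ‖f t‖ ≤ B) (N : ℕ) (t : ℝ) : ‖fejer f N t‖ ≤ B := by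
  rcases eq_or_ne N 0 with rfl | hN
  · simpa [fejer] using hB
  have hi : Integrable f freq := Integrable.of_bound hf B hfB
  have hk : Integrable (fun s => fejerKernel N (t - s)) freq := by
    have := (integrable_mul_fejerKernel (integrable_const (1 : ℂ)) N t).re
    simpa using this
  rw [fejer_eq_mean hi]
  have h1 : ‖∫ s, f s * (fejerKernel N (t - s) : ℂ) ∂freq‖ ≤
      ∫ s, B * fejerKernel N (t - s) ∂freq := by
    refine norm_integral_le_of_norm_le (hk.const_mul B) ?_
    filter_upwards [hfB] with s hs
    rw [norm_mul, Complex.norm_real, Real.norm_of_nonneg (fejerKernel_nonneg _ _)]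
    exact mul_le_mul_of_nonneg_right hs (fejerKernel_nonneg _ _)
  have h2 := mean_fejerKernel hN t
  calc ‖mean fun s => f s * (fejerKernel N (t - s) : ℂ)‖
      = (1 / (2 * Real.pi)) * ‖∫ s, f s * (fejerKernel N (t - s) : ℂ) ∂freq‖ := by
        rw [mean, norm_smul, Real.norm_of_nonneg (by positivity)]
    _ ≤ (1 / (2 * Real.pi)) * ∫ s, B * fejerKernel N (t - s) ∂freq := by
        have := Real.pi_pos
        gcongr
    _ = mean fun s => B * fejerKernel N (t - s) := rfl
    _ = B := by rw [mean_const_mul_real, h2, mul_one]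

lemma re_fejer_nonneg {f : ℝ → ℂ} (hf : Integrable f freq) (h : ∀ᵐ t ∂freq, 0 ≤ (f t).re)
    (N : ℕ) (t : ℝ) : 0 ≤ (fejer f N t).re := by
  rw [fejer_eq_mean hf, ← mean_re (integrable_mul_fejerKernel hf N t)]
  apply mean_nonneg
  filter_upwards [h] with s hs
  rw [Complex.re_mul_ofReal]
  exact mul_nonneg hs (fejerKernel_nonneg _ _)

/-- A subsequence of the Fejér means of a square integrable vector function converges almost
everywhere. -/
lemma exists_subseq_fejer_ae {ι : Type*} [Fintype ι] {f : ℝ → ι → ℂ}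
    (hf : ∀ i, MemLp (fun t => f t i) 2 freq) :
    ∃ ns : ℕ → ℕ, StrictMono ns ∧
      ∀ᵐ t ∂freq, ∀ i, Tendsto (fun k => fejer (fun t => f t i) (ns k) t) atTop (𝓝 (f t i)) := by
  classical
  have hm : ∀ i N, AEStronglyMeasurable (fun t => fejer (fun t => f t i) N t - f t i) freq :=
    fun i N => (continuous_fejer _ _).aestronglyMeasurable.sub (hf i).1
  -- One subsequence has to serve all coordinates, so the errors are added before it is extracted.
  have h1 : Tendsto (fun N => eLpNorm (fun t => ∑ i, ‖fejer (fun t => f t i) N t - f t i‖) 2 freq)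
      atTop (𝓝 0) := by
    have h2 : Tendsto (fun N => ∑ i, eLpNorm (fun t => fejer (fun t => f t i) N t - f t i) 2 freq)
        atTop (𝓝 0) := by
      have := tendsto_finsetSum Finset.univ fun i _ => tendsto_fejer_eLpNorm (hf i)
      simpa using this
    refine tendsto_of_tendsto_of_tendsto_of_le_of_le tendsto_const_nhds h2
      (fun _ => zero_le) fun N => ?_
    have e : (fun t => ∑ i, ‖fejer (fun t => f t i) N t - f t i‖) =
        ∑ i, fun t => ‖fejer (fun t => f t i) N t - f t i‖ := by
      ext t; simp
    rw [e]
    refine (eLpNorm_sum_le (fun i _ => (hm i N).norm) (by norm_num)).trans ?_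
    simp only [eLpNorm_norm, le_refl]
  have h2 : TendstoInMeasure freq (fun N t => ∑ i, ‖fejer (fun t => f t i) N t - f t i‖) atTop
      (fun _ => (0 : ℝ)) := by
    refine tendstoInMeasure_of_tendsto_eLpNorm (p := 2) (by norm_num) (fun N => ?_)
      aestronglyMeasurable_const ?_
    · exact Finset.aestronglyMeasurable_fun_sum _ fun i _ => (hm i N).norm
    · refine h1.congr fun N => ?_
      congr 1; ext t; simp
  obtain ⟨ns, hns, hae⟩ := h2.exists_seq_tendsto_ae
  refine ⟨ns, hns, ?_⟩
  filter_upwards [hae] with t ht i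
  rw [tendsto_iff_norm_sub_tendsto_zero]
  refine squeeze_zero (fun _ => norm_nonneg _) (fun k => ?_) ht
  exact Finset.single_le_sum (f := fun i => ‖fejer (fun t => f t i) (ns k) t - f t i‖)
    (fun _ _ => norm_nonneg _) (Finset.mem_univ i)

lemma exists_subseq_fejer_ae_scalar {f : ℝ → ℂ} (hf : MemLp f 2 freq) :
    ∃ ns : ℕ → ℕ, StrictMono ns ∧
      ∀ᵐ t ∂freq, Tendsto (fun k => fejer f (ns k) t) atTop (𝓝 (f t)) := by
  obtain ⟨ns, h1, h2⟩ := exists_subseq_fejer_ae (ι := Unit) (f := fun t _ => f t) fun _ => hf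
  exact ⟨ns, h1, h2.mono fun t ht => ht ()⟩

lemma memLp_two_of_bound {f : ℝ → ℂ} (hf : AEStronglyMeasurable f freq) {B : ℝ}
    (hB : ∀ᵐ t ∂freq, ‖f t‖ ≤ B) : MemLp f 2 freq := MemLp.of_bound hf B hB

/-- The product of a bounded function and an integrable function whose Fourier coefficients vanish
suitably has vanishing Fourier coefficients. -/
lemma coef_mul_eq_zero {f g : ℝ → ℂ} (hf : AEStronglyMeasurable f freq) {B : ℝ}
    (hB : ∀ᵐ t ∂freq, ‖f t‖ ≤ B) (hg : Integrable g freq) (n : ℤ)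
    (h : ∀ m, coef f m = 0 ∨ coef g (n - m) = 0) : coef (fun t => f t * g t) n = 0 := by
  have hB' : ∀ᵐ t ∂freq, ‖f t‖ ≤ max B 0 := hB.mono fun t ht => ht.trans (le_max_left _ _)
  obtain ⟨ns, -, hns⟩ := exists_subseq_fejer_ae_scalar (memLp_two_of_bound hf hB)
  have hlim : Tendsto (fun k => coef (fun t => fejer f (ns k) t * g t) n) atTop
      (𝓝 (coef (fun t => f t * g t) n)) := by
    refine tendsto_mean_of_dominated (fun t => max B 0 * ‖g t‖) (fun k => ?_)
      (hg.norm.const_mul _) (fun k => ?_) ?_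
    · exact (((continuous_fejer f (ns k)).aestronglyMeasurable.mul hg.1).mul
        (continuous_expi _).aestronglyMeasurable)
    · refine Eventually.of_forall fun t => ?_
      rw [norm_mul, norm_mul, norm_expi, mul_one]
      exact mul_le_mul_of_nonneg_right (norm_fejer_le hf (le_max_right _ _) hB' _ _)
        (norm_nonneg _)
    · filter_upwards [hns] with t ht
      exact (ht.mul_const _).mul_const _
  refine tendsto_nhds_unique hlim ?_
  have : ∀ k, coef (fun t => fejer f (ns k) t * g t) n = 0 := fun k => by
    have e : (fun t => fejer f (ns k) t * g t) = fun t =>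
        ∑ p ∈ Finset.range (ns k) ×ˢ Finset.range (ns k),
          (((ns k : ℂ)⁻¹ * coef f ((p.1 : ℤ) - p.2)) * (expi ((p.1 : ℤ) - p.2) t * g t)) := by
      ext t
      rw [fejer, ← Finset.sum_product', Finset.mul_sum, Finset.sum_mul]
      exact Finset.sum_congr rfl fun p _ => by ring
    rw [e, coef_finset_sum]
    · refine Finset.sum_eq_zero fun p _ => ?_
      rw [coef_const_mul, coef_expi_mul]
      rcases h ((p.1 : ℤ) - p.2) with h | h <;> rw [h] <;> simp
    · intro p _
      have := (integrable_mul_expi hg ((p.1 : ℤ) - p.2)).const_mul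
        ((ns k : ℂ)⁻¹ * coef f ((p.1 : ℤ) - p.2))
      refine this.congr (Eventually.of_forall fun t => ?_)
      simp only; ring
  simp only [this]
  exact tendsto_const_nhds

/-- Integrable functions are determined by their Fourier coefficients. -/
lemma ae_eq_zero_of_coef {f : ℝ → ℂ} (hf : Integrable f freq) (h : ∀ n, coef f n = 0) :
    f =ᵐ[freq] 0 := by
  -- The conjugate phase of `f` is bounded and satisfies `s f = |f|`, also at the zeros of `f`,
  -- where the division yields `0`. The product lemma then gives `∫ |f| = 0`.
  set s : ℝ → ℂ := fun t => star (f t) / ‖f t‖ with hs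
  have hsm : AEStronglyMeasurable s freq := by
    have h1 : AEMeasurable f freq := hf.1.aemeasurable
    have h2 : AEMeasurable (fun t => (‖f t‖ : ℂ)) freq :=
      Complex.measurable_ofReal.comp_aemeasurable h1.norm
    exact ((Complex.continuous_conj.measurable.comp_aemeasurable h1).div h2).aestronglyMeasurable
  have hsb : ∀ᵐ t ∂freq, ‖s t‖ ≤ 1 := Eventually.of_forall fun t => by
    simp only [hs, norm_div, norm_star, Complex.norm_real, norm_norm]
    exact div_self_le_one _
  have h1 := coef_mul_eq_zero hsm hsb hf 0 fun m => Or.inr (h _)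
  have h2 : ∀ t, s t * f t = (‖f t‖ : ℂ) := fun t => by
    by_cases h0 : f t = 0
    · simp [h0]
    · have : (‖f t‖ : ℂ) ≠ 0 := by simpa using h0
      simp only [hs]
      rw [div_mul_eq_mul_div, mul_comm, Complex.star_def, Complex.mul_conj,
        Complex.normSq_eq_norm_sq, div_eq_iff this]
      push_cast; ring
  simp only [coef, h2, neg_zero, expi_zero, mul_one, mean_eq_zero_iff] at h1
  rw [integral_complex_ofReal] at h1
  have h3 := (integral_eq_zero_iff_of_nonneg (fun t => norm_nonneg (f t)) hf.norm).1
    (by exact_mod_cast h1)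
  filter_upwards [h3] with t ht
  simpa using ht

lemma ae_eq_of_coef_eq {f g : ℝ → ℂ} (hf : Integrable f freq) (hg : Integrable g freq)
    (h : ∀ n, coef f n = coef g n) : f =ᵐ[freq] g := by
  have := ae_eq_zero_of_coef (hf.sub hg) fun n => by
    have := coef_sub hf hg n
    rw [h, sub_self] at this
    exact this
  filter_upwards [this] with t ht
  exact sub_eq_zero.1 ht

/-! ### A Smirnov type theorem -/

/-- The maximum principle for `exp (-p)`, whose modulus is `exp (-Re p)`. -/
lemma re_nonneg_on_closedBall {p : ℂ → ℂ} (hp : Differentiable ℂ p)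
    (h : ∀ t, 0 ≤ (p (expi 1 t)).re) {z : ℂ} (hz : z ∈ Metric.closedBall (0 : ℂ) 1) :
    0 ≤ (p z).re := by
  have hd : DiffContOnCl ℂ (fun z => Complex.exp (-p z)) (Metric.ball 0 1) :=
    (hp.neg.cexp).diffContOnCl
  have h1 : ‖Complex.exp (-p z)‖ ≤ 1 := by
    refine Complex.norm_le_of_forall_mem_frontier_norm_le Metric.isBounded_ball hd ?_
      (by rwa [closure_ball (0 : ℂ) one_ne_zero])
    intro w hw
    rw [frontier_ball (0 : ℂ) one_ne_zero, mem_sphere_zero_iff_norm] at hw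
    have : w = expi 1 w.arg := by
      rw [expi]
      conv_lhs => rw [← Complex.norm_mul_exp_arg_mul_I w, hw]
      push_cast
      rw [one_mul]; congr 1; ring
    rw [Complex.norm_exp, this]
    simpa using h _
  rw [Complex.norm_exp, Real.exp_le_one_iff] at h1
  simpa using h1

/-- If `p` is entire with nonnegative real part on the unit circle, then `(1 + p)⁻¹` has no Fourier
coefficients of negative index there. -/
lemma coef_inv_one_add {p : ℂ → ℂ} (hp : Differentiable ℂ p) (h : ∀ t, 0 ≤ (p (expi 1 t)).re)
    {n : ℤ} (hn : n < 0) : coef (fun t => (1 + p (expi 1 t))⁻¹) n = 0 := by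
  obtain ⟨k, rfl⟩ : ∃ k : ℕ, n = -((k : ℤ) + 1) := ⟨(-n - 1).toNat, by omega⟩
  have hne : ∀ z ∈ Metric.closedBall (0 : ℂ) 1, 1 + p z ≠ 0 := fun z hz h0 => by
    have h1 := re_nonneg_on_closedBall hp h hz
    have h2 := congrArg Complex.re h0
    simp only [Complex.add_re, Complex.one_re, Complex.zero_re] at h2
    linarith
  -- With `n = -(k + 1)` and `dz = i z dt`, the coefficient of index `n` is, up to a constant, the
  -- contour integral of `z ^ k (1 + p z)⁻¹`, to which Cauchy's theorem applies.
  have hd : DifferentiableOn ℂ (fun z => z ^ k * (1 + p z)⁻¹) (Metric.closedBall 0 1) :=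
    fun z hz => by
      have := hp z
      exact ((differentiableAt_id.pow k).mul
        (((differentiableAt_const _).add this).inv (hne z hz))).differentiableWithinAt
  have h1 : (∮ z in C(0, 1), z ^ k * (1 + p z)⁻¹) = 0 :=
    Complex.circleIntegral_eq_zero_of_differentiable_on_off_countable zero_le_one
      Set.countable_empty hd.continuousOn fun z hz =>
        (hd z (Metric.ball_subset_closedBall hz.1)).differentiableAt
          (Metric.closedBall_mem_nhds_of_mem hz.1)
  have hcm : ∀ t : ℝ, circleMap 0 1 t = expi 1 t := fun t => by
    simp [circleMap, expi, mul_comm]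
  set g : ℝ → ℂ := fun t => (1 + p (expi 1 t))⁻¹ * expi (-(-((k : ℤ) + 1))) t with hg
  have hgper : Function.Periodic g (2 * Real.pi) := fun t => by
    have h2 : ∀ m : ℤ, expi m (t + 2 * Real.pi) = expi m t := fun m => by
      simp only [expi]
      rw [Complex.exp_eq_exp_iff_exists_int]
      exact ⟨m, by push_cast; ring⟩
    simp only [hg, h2]
  rw [coef, mean_eq_zero_iff, integral_freq]
  have h3 := hgper.intervalIntegral_add_eq (-Real.pi) 0
  rw [show -Real.pi + 2 * Real.pi = Real.pi by ring, zero_add] at h3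
  rw [h3]
  rw [circleIntegral] at h1
  have h4 : ∀ t : ℝ, deriv (circleMap 0 1) t • (circleMap 0 1 t ^ k * (1 + p (circleMap 0 1 t))⁻¹) =
      Complex.I * g t := fun t => by
    simp only [hg]
    rw [deriv_circleMap, hcm, smul_eq_mul, neg_neg, expi_add, expi_natCast]
    ring
  simp only [h4] at h1
  rw [intervalIntegral.integral_const_mul] at h1
  exact (mul_eq_zero.1 h1).resolve_left Complex.I_ne_zero

lemma norm_inv_one_add_le {z : ℂ} (hz : 0 ≤ z.re) : ‖(1 + z)⁻¹‖ ≤ 1 := by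
  rw [norm_inv]
  apply inv_le_one_of_one_le₀
  have := Complex.re_le_norm (1 + z)
  simp only [Complex.add_re, Complex.one_re] at this
  linarith

lemma coef_inv_one_add_of_memLp {H : ℝ → ℂ} (hH : MemLp H 2 freq) (hspec : ∀ n < 0, coef H n = 0)
    (hre : ∀ᵐ t ∂freq, 0 ≤ (H t).re) {n : ℤ} (hn : n < 0) :
    coef (fun t => (1 + H t)⁻¹) n = 0 := by
  have hi : Integrable H freq := hH.integrable one_le_two
  obtain ⟨ns, -, hns⟩ := exists_subseq_fejer_ae_scalar hH
  have hzero : ∀ N, coef (fun t => (1 + fejer H N t)⁻¹) n = 0 := fun N => by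
    -- The Fejér means of `H` are polynomials in `e^{it}`. Truncating negative exponents to `0` is
    -- harmless because their coefficients vanish.
    set p : ℂ → ℂ := fun z => (N : ℂ)⁻¹ * ∑ j ∈ Finset.range N, ∑ l ∈ Finset.range N,
      coef H ((j : ℤ) - l) * z ^ ((j : ℤ) - l).toNat with hp
    have hpe : ∀ t, p (expi 1 t) = fejer H N t := fun t => by
      simp only [hp, fejer]
      congr 1
      refine Finset.sum_congr rfl fun j _ => Finset.sum_congr rfl fun l _ => ?_
      rcases lt_or_ge ((j : ℤ) - l) 0 with h | h
      · rw [hspec _ h]; simp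
      · rw [← expi_natCast, Int.toNat_of_nonneg h]
    have hpd : Differentiable ℂ p := by
      simp only [hp]; fun_prop
    have := coef_inv_one_add hpd (fun t => by rw [hpe]; exact re_fejer_nonneg hi hre N t) hn
    simpa only [hpe] using this
  have hlim : Tendsto (fun k => coef (fun t => (1 + fejer H (ns k) t)⁻¹) n) atTop
      (𝓝 (coef (fun t => (1 + H t)⁻¹) n)) := by
    refine tendsto_mean_of_dominated (fun _ => 1) (fun k => ?_) (integrable_const _)
      (fun k => ?_) ?_
    · have h1 : Measurable (fun t => (1 + fejer H (ns k) t)⁻¹) :=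
        (measurable_const.add (continuous_fejer _ _).measurable).inv
      exact h1.aestronglyMeasurable.mul (continuous_expi _).aestronglyMeasurable
    · refine Eventually.of_forall fun t => ?_
      rw [norm_mul, norm_expi, mul_one]
      exact norm_inv_one_add_le (re_fejer_nonneg hi hre _ _)
    · filter_upwards [hns, hre] with t ht hr
      refine ((ht.const_add 1).inv₀ ?_).mul_const _
      intro h0
      have := congrArg Complex.re h0
      simp only [Complex.add_re, Complex.one_re, Complex.zero_re] at this
      linarith
  simp only [hzero] at hlim
  exact (tendsto_nhds_unique hlim tendsto_const_nhds)

/-- The analytic completion of a square integrable real function. -/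
lemma exists_analytic_completion {m : ℝ → ℝ} (hm : MemLp (fun t => (m t : ℂ)) 2 freq) :
    ∃ H : ℝ → ℂ, MemLp H 2 freq ∧ (∀ n < 0, coef H n = 0) ∧ ∀ᵐ t ∂freq, (H t).re = m t := by
  set μ : ℤ → ℂ := coef fun t => (m t : ℂ) with hμ
  have hstar : ∀ n, star (μ (-n)) = μ n := fun n => by
    rw [hμ, ← coef_star]; congr 1; ext t; simp
  -- Doubling the positive frequencies and keeping the mean makes the coefficients of `H + conj H`
  -- equal to `2 μ`.
  set c : ℤ → ℂ := fun n => if n < 0 then 0 else if n = 0 then μ 0 else 2 * μ n with hc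
  have hcs : Summable fun n => ‖c n‖ ^ 2 := by
    refine Summable.of_nonneg_of_le (fun _ => by positivity) (fun n => ?_)
      ((summable_coef_sq hm).mul_left 4)
    simp only [hc]
    split_ifs with h1 h2
    · simp
    · rw [h2]; nlinarith [sq_nonneg ‖μ 0‖]
    · rw [norm_mul, mul_pow]; norm_num; exact le_rfl
  obtain ⟨H, hH, hHc⟩ := exists_coef_eq c hcs
  have hi : Integrable H freq := hH.integrable one_le_two
  have hmi : Integrable (fun t => (m t : ℂ)) freq := hm.integrable one_le_two
  have his : Integrable (fun t => star (H t)) freq := by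
    have := (LinearIsometryEquiv.integrable_comp_iff (μ := freq) Complex.conjLIE (φ := H)).2 hi
    exact this
  refine ⟨H, hH, fun n hn => by rw [hHc]; simp [hc, hn], ?_⟩
  have hae : (fun t => H t + star (H t)) =ᵐ[freq] fun t => 2 * (m t : ℂ) := by
    refine ae_eq_of_coef_eq (hi.add his) (hmi.const_mul 2) fun n => ?_
    rw [coef_add hi his, coef_star, coef_const_mul, hHc, hHc, ← hμ]
    simp only [hc]
    rcases lt_trichotomy n 0 with h | h | h
    · rw [if_pos h, if_neg (by omega), if_neg (by omega), zero_add, star_mul', hstar]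
      simp
    · subst h
      have := hstar 0
      simp only [neg_zero] at this
      simp only [lt_irrefl, neg_zero, if_false, if_true, this]
      ring
    · rw [if_neg (by omega), if_neg (by omega), if_pos (by omega)]
      simp
  filter_upwards [hae] with t ht
  have := congrArg Complex.re ht
  simp at this
  linarith

lemma aestronglyMeasurable_inv {f : ℝ → ℂ} (hf : AEStronglyMeasurable f freq) :
    AEStronglyMeasurable (fun t => (f t)⁻¹) freq :=
  (hf.aemeasurable.inv).aestronglyMeasurable

/-- If `u` has only Fourier coefficients of positive index, `v` only of nonnegative index, and
`u ⬝ᵥ v` is integrable, then its integral vanishes. -/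
theorem integral_dotProduct_eq_zero {ι : Type*} [Fintype ι] {u v : ℝ → ι → ℂ}
    (hu : ∀ i, Integrable (fun t => u t i) freq) (hv : ∀ i, Integrable (fun t => v t i) freq)
    (hu0 : ∀ i, ∀ n ≤ 0, coef (fun t => u t i) n = 0)
    (hv0 : ∀ i, ∀ n < 0, coef (fun t => v t i) n = 0)
    (huv : Integrable (fun t => u t ⬝ᵥ v t) freq) : ∫ t, u t ⬝ᵥ v t ∂freq = 0 := by
  -- A common integrable majorant of all coordinates. Its square root is square integrable, which
  -- the analytic completion requires.
  set M : ℝ → ℝ := fun t => ∑ i, (‖u t i‖ + ‖v t i‖) with hM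
  have hM0 : ∀ t, 0 ≤ M t := fun t => Finset.sum_nonneg fun i _ => by positivity
  have hMi : Integrable M freq := integrable_finsetSum _ fun i _ => (hu i).norm.add (hv i).norm
  have hMu : ∀ t i, ‖u t i‖ ≤ M t := fun t i =>
    (le_add_of_nonneg_right (norm_nonneg _)).trans
      (Finset.single_le_sum (f := fun i => ‖u t i‖ + ‖v t i‖) (fun _ _ => by positivity)
        (Finset.mem_univ i))
  have hMv : ∀ t i, ‖v t i‖ ≤ M t := fun t i =>
    (le_add_of_nonneg_left (norm_nonneg _)).trans
      (Finset.single_le_sum (f := fun i => ‖u t i‖ + ‖v t i‖) (fun _ _ => by positivity)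
        (Finset.mem_univ i))
  have hm2 : MemLp (fun t => (Real.sqrt (M t) : ℂ)) 2 freq := by
    rw [memLp_two_iff_integrable_sq_norm]
    · refine hMi.congr (Eventually.of_forall fun t => ?_)
      simp only [Complex.norm_real, Real.norm_eq_abs, sq_abs, Real.sq_sqrt (hM0 t)]
    · exact (Complex.measurable_ofReal.comp_aemeasurable
        (Real.continuous_sqrt.measurable.comp_aemeasurable hMi.1.aemeasurable)).aestronglyMeasurable
  obtain ⟨H, hH, hH0, hre⟩ := exists_analytic_completion hm2
  set e : ℕ → ℝ := fun k => ((k : ℝ) + 1)⁻¹ with he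
  have hepos : ∀ k, 0 < e k := fun k => by positivity
  set φ : ℕ → ℝ → ℂ := fun k t => (1 + e k * H t)⁻¹ with hφ
  have hφre : ∀ k, ∀ᵐ t ∂freq, 0 ≤ ((e k : ℂ) * H t).re := fun k => by
    filter_upwards [hre] with t ht
    rw [Complex.re_ofReal_mul, ht]
    exact mul_nonneg (hepos k).le (Real.sqrt_nonneg _)
  have hφm : ∀ k, AEStronglyMeasurable (φ k) freq := fun k =>
    aestronglyMeasurable_inv (aestronglyMeasurable_const.add (hH.1.const_mul _))
  have hφ1 : ∀ k, ∀ᵐ t ∂freq, ‖φ k t‖ ≤ 1 := fun k =>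
    (hφre k).mono fun t ht => norm_inv_one_add_le ht
  have hφ0 : ∀ k, ∀ n < 0, coef (φ k) n = 0 := fun k n hn => by
    refine coef_inv_one_add_of_memLp (hH.const_mul _) (fun n hn => ?_) (hφre k) hn
    rw [coef_const_mul, hH0 n hn, mul_zero]
  -- `|1 + e H| ≥ e √M`, because the real part of `H` is `√M`.
  have hφM : ∀ k, ∀ᵐ t ∂freq, ‖φ k t‖ ^ 2 * M t ≤ (e k)⁻¹ ^ 2 := fun k => by
    filter_upwards [hre] with t ht
    have h1 : e k * Real.sqrt (M t) ≤ ‖1 + e k * H t‖ := by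
      have := Complex.re_le_norm (1 + e k * H t)
      rw [Complex.add_re, Complex.one_re, Complex.re_ofReal_mul, ht] at this
      linarith
    have h2 : 0 < ‖1 + e k * H t‖ := by
      have := Complex.re_le_norm (1 + e k * H t)
      rw [Complex.add_re, Complex.one_re, Complex.re_ofReal_mul, ht] at this
      have := mul_nonneg (hepos k).le (Real.sqrt_nonneg (M t))
      linarith
    have h3 : (e k) ^ 2 * M t ≤ ‖1 + e k * H t‖ ^ 2 := by
      have := pow_le_pow_left₀ (mul_nonneg (hepos k).le (Real.sqrt_nonneg (M t))) h1 2
      rwa [mul_pow, Real.sq_sqrt (hM0 t)] at this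
    simp only [hφ, norm_inv, inv_pow]
    rw [inv_mul_le_iff₀ (by positivity), ← div_eq_mul_inv,
      le_div_iff₀ (by have := hepos k; positivity)]
    linarith
  -- The square of `φ` offsets a full factor `M`. One copy of `ψ` makes `u` bounded and another
  -- makes `v` bounded, and neither introduces a negative frequency.
  set ψ : ℕ → ℝ → ℂ := fun k t => φ k t * φ k t with hψ
  have hψm : ∀ k, AEStronglyMeasurable (ψ k) freq := fun k => (hφm k).mul (hφm k)
  have hψ1 : ∀ k, ∀ᵐ t ∂freq, ‖ψ k t‖ ≤ 1 := fun k => (hφ1 k).mono fun t ht => by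
    rw [norm_mul]; exact mul_le_one₀ ht (norm_nonneg _) ht
  have hφi : ∀ k, Integrable (φ k) freq := fun k => Integrable.of_bound (hφm k) 1 (hφ1 k)
  have hψ0 : ∀ k, ∀ n < 0, coef (ψ k) n = 0 := fun k n hn =>
    coef_mul_eq_zero (hφm k) (hφ1 k) (hφi k) n fun m => by
      rcases lt_or_ge m 0 with h | h
      · exact Or.inl (hφ0 k m h)
      · exact Or.inr (hφ0 k _ (by omega))
  have hψb : ∀ k, ∀ᵐ t ∂freq, ∀ z : ℂ, ‖z‖ ≤ M t → ‖ψ k t * z‖ ≤ (e k)⁻¹ ^ 2 := fun k =>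
    (hφM k).mono fun t ht z hz => by
      rw [norm_mul, norm_mul, ← sq]
      exact (mul_le_mul_of_nonneg_left hz (by positivity)).trans ht
  have hzero : ∀ k, ∫ t, ψ k t * ψ k t * (u t ⬝ᵥ v t) ∂freq = 0 := fun k => by
    have hui : ∀ i, Integrable (fun t => ψ k t * u t i) freq := fun i =>
      (hu i).bdd_mul (hψm k) (hψ1 k)
    have hvi : ∀ i, Integrable (fun t => ψ k t * v t i) freq := fun i =>
      (hv i).bdd_mul (hψm k) (hψ1 k)
    have hub : ∀ i, ∀ᵐ t ∂freq, ‖ψ k t * u t i‖ ≤ (e k)⁻¹ ^ 2 := fun i =>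
      (hψb k).mono fun t ht => ht _ (hMu t i)
    have e1 : ∀ t, ψ k t * ψ k t * (u t ⬝ᵥ v t) = ∑ i, (ψ k t * u t i) * (ψ k t * v t i) :=
      fun t => by
        rw [dotProduct, Finset.mul_sum]
        exact Finset.sum_congr rfl fun i _ => by ring
    simp only [e1]
    rw [integral_finsetSum]
    · refine Finset.sum_eq_zero fun i _ => ?_
      have h2 : ∀ n ≤ 0, coef (fun t => ψ k t * u t i) n = 0 := fun n hn =>
        coef_mul_eq_zero (hψm k) (hψ1 k) (hu i) n fun m => by
          rcases lt_or_ge m 0 with h | h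
          · exact Or.inl (hψ0 k m h)
          · exact Or.inr (hu0 i _ (by omega))
      have h3 : ∀ n < 0, coef (fun t => ψ k t * v t i) n = 0 := fun n hn =>
        coef_mul_eq_zero (hψm k) (hψ1 k) (hv i) n fun m => by
          rcases lt_or_ge m 0 with h | h
          · exact Or.inl (hψ0 k m h)
          · exact Or.inr (hv0 i _ (by omega))
      have h4 : coef (fun t => (ψ k t * u t i) * (ψ k t * v t i)) 0 = 0 :=
        coef_mul_eq_zero (hui i).1 (hub i) (hvi i) 0 fun m => by
          rcases le_or_gt m 0 with h | h
          · exact Or.inl (h2 m h)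
          · exact Or.inr (h3 _ (by omega))
      simpa only [coef, neg_zero, expi_zero, mul_one, mean_eq_zero_iff] using h4
    · intro i _
      exact (hvi i).bdd_mul (hui i).1 (hub i)
  have hlim : Tendsto (fun k => ∫ t, ψ k t * ψ k t * (u t ⬝ᵥ v t) ∂freq) atTop
      (𝓝 (∫ t, u t ⬝ᵥ v t ∂freq)) := by
    refine tendsto_integral_of_dominated_convergence (fun t => ‖u t ⬝ᵥ v t‖)
      (fun k => ((hψm k).mul (hψm k)).mul huv.1) huv.norm (fun k => ?_) ?_
    · filter_upwards [hψ1 k] with t ht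
      rw [norm_mul, norm_mul]
      exact mul_le_of_le_one_left (norm_nonneg _) (mul_le_one₀ ht (norm_nonneg _) ht)
    · refine Eventually.of_forall fun t => ?_
      have h1 : Tendsto (fun k => (e k : ℂ)) atTop (𝓝 0) := by
        have : Tendsto e atTop (𝓝 0) := by
          simpa [he, one_div] using tendsto_one_div_add_atTop_nhds_zero_nat (𝕜 := ℝ)
        exact_mod_cast (Complex.continuous_ofReal.tendsto 0).comp this
      have h2 : Tendsto (fun k => φ k t) atTop (𝓝 1) := by
        have := ((h1.mul_const (H t)).const_add 1).inv₀ (by simp)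
        simpa using this
      have h3 := (((h2.mul h2).mul (h2.mul h2)).mul_const (u t ⬝ᵥ v t))
      simpa using h3
  simp only [hzero] at hlim
  exact tendsto_nhds_unique hlim tendsto_const_nhds

/-! ### Sesquilinear forms of positive semidefinite matrices -/

section sesq

variable {T : ℕ}

/-- `vᵀ K w̄`. -/
def sesq (K : Matrix (Fin T) (Fin T) ℂ) (v w : Fin T → ℂ) : ℂ := v ⬝ᵥ (K *ᵥ star w)

variable {K : Matrix (Fin T) (Fin T) ℂ}

lemma quad_eq_re_sesq (v : Fin T → ℂ) : quad K v = (sesq K v v).re := rfl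

lemma sesq_add_left (u v w : Fin T → ℂ) : sesq K (u + v) w = sesq K u w + sesq K v w := by
  simp only [sesq, add_dotProduct]

lemma sesq_sub_left (u v w : Fin T → ℂ) : sesq K (u - v) w = sesq K u w - sesq K v w := by
  simp only [sesq, sub_dotProduct]

lemma sesq_smul_left (c : ℂ) (v w : Fin T → ℂ) : sesq K (c • v) w = c * sesq K v w := by
  simp only [sesq, smul_dotProduct, smul_eq_mul]

lemma sesq_add_right (u v w : Fin T → ℂ) : sesq K u (v + w) = sesq K u v + sesq K u w := by
  simp only [sesq, star_add, mulVec_add, dotProduct_add]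

lemma sesq_sub_right (u v w : Fin T → ℂ) : sesq K u (v - w) = sesq K u v - sesq K u w := by
  simp only [sesq, star_sub, mulVec_sub, dotProduct_sub]

lemma sesq_smul_right (c : ℂ) (v w : Fin T → ℂ) : sesq K v (c • w) = star c * sesq K v w := by
  simp only [sesq, star_smul, mulVec_smul, dotProduct_smul, smul_eq_mul]

lemma sesq_eq_vecMul_dotProduct (v w : Fin T → ℂ) : sesq K v w = (v ᵥ* K) ⬝ᵥ star w := by
  rw [sesq, dotProduct_mulVec]

lemma sesq_add_mat (K L : Matrix (Fin T) (Fin T) ℂ) (v w : Fin T → ℂ) :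
    sesq (K + L) v w = sesq K v w + sesq L v w := by
  simp only [sesq, add_mulVec, dotProduct_add]

lemma quad_add_mat (K L : Matrix (Fin T) (Fin T) ℂ) (v : Fin T → ℂ) :
    quad (K + L) v = quad K v + quad L v := by
  simp only [quad_eq_re_sesq, sesq_add_mat, Complex.add_re]

lemma quad_sub_mat (K L : Matrix (Fin T) (Fin T) ℂ) (v : Fin T → ℂ) :
    quad (K - L) v = quad K v - quad L v := by
  simp only [quad, sub_mulVec, dotProduct_sub, Complex.sub_re]

lemma quad_real_smul_mat (c : ℝ) (K : Matrix (Fin T) (Fin T) ℂ) (v : Fin T → ℂ) :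
    quad (c • K) v = c * quad K v := by
  simp only [quad, smul_mulVec, dotProduct_smul, Complex.smul_re, smul_eq_mul]

lemma quad_smul (c : ℂ) (v : Fin T → ℂ) : quad K (c • v) = ‖c‖ ^ 2 * quad K v := by
  rw [quad_eq_re_sesq, sesq_smul_left, sesq_smul_right, ← mul_assoc, Complex.star_def,
    Complex.mul_conj, Complex.re_ofReal_mul, Complex.normSq_eq_norm_sq, quad_eq_re_sesq]

lemma quad_zero : quad K 0 = 0 := by simp [quad]

lemma sesq_conj (hK : K.IsHermitian) (v w : Fin T → ℂ) : star (sesq K v w) = sesq K w v := by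
  rw [sesq_eq_vecMul_dotProduct, sesq, ← star_dotProduct_star, star_star, star_vecMul, hK.eq]

lemma quad_nonneg (hK : K.PosSemidef) (v : Fin T → ℂ) : 0 ≤ quad K v := by
  have := hK.dotProduct_mulVec_nonneg (star v)
  rw [star_star] at this
  exact (Complex.le_def.1 this).1

lemma sesq_self (hK : K.IsHermitian) (v : Fin T → ℂ) : sesq K v v = quad K v := by
  have := sesq_conj hK v v
  rw [Complex.star_def, Complex.conj_eq_iff_real] at this
  obtain ⟨r, hr⟩ := this
  rw [quad_eq_re_sesq, hr, Complex.ofReal_re]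

lemma quad_sub (hK : K.IsHermitian) (v w : Fin T → ℂ) :
    quad K (v - w) = quad K v - 2 * (sesq K v w).re + quad K w := by
  have : (sesq K w v).re = (sesq K v w).re := by
    rw [← sesq_conj hK, Complex.star_def, Complex.conj_re]
  simp only [quad_eq_re_sesq, sesq_sub_left, sesq_sub_right, Complex.sub_re, this]
  ring

lemma quad_add (hK : K.IsHermitian) (v w : Fin T → ℂ) :
    quad K (v + w) = quad K v + 2 * (sesq K v w).re + quad K w := by
  have : (sesq K w v).re = (sesq K v w).re := by
    rw [← sesq_conj hK, Complex.star_def, Complex.conj_re]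
  simp only [quad_eq_re_sesq, sesq_add_left, sesq_add_right, Complex.add_re, this]
  ring

lemma quad_sub_comm (v w : Fin T → ℂ) : quad K (v - w) = quad K (w - v) := by
  have h : v - w = (-1 : ℂ) • (w - v) := by simp
  rw [h, quad_smul]; simp

lemma quad_add_le (hK : K.PosSemidef) (v w : Fin T → ℂ) :
    quad K (v + w) ≤ 2 * quad K v + 2 * quad K w := by
  have h1 := quad_nonneg hK (v - w)
  rw [quad_sub hK.1] at h1
  rw [quad_add hK.1]
  linarith

lemma quad_sub_le (hK : K.PosSemidef) (v w : Fin T → ℂ) :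
    quad K (v - w) ≤ 2 * quad K v + 2 * quad K w := by
  have h1 := quad_nonneg hK (v + w)
  rw [quad_add hK.1] at h1
  rw [quad_sub hK.1]
  linarith

/-- The Cauchy–Schwarz inequality. -/
lemma norm_sesq_sq_le (hK : K.PosSemidef) (v w : Fin T → ℂ) :
    ‖sesq K v w‖ ^ 2 ≤ quad K v * quad K w := by
  let c : PreInnerProductSpace.Core ℂ (Fin T → ℂ) :=
    { inner := fun x y => sesq K y x
      conj_inner_symm := fun x y => sesq_conj hK.1 x y
      re_inner_nonneg := fun x => quad_nonneg hK x
      add_left := fun x y z => sesq_add_right z x y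
      smul_left := fun x y r => sesq_smul_right r y x }
  have h : ‖sesq K v w‖ * ‖sesq K w v‖ ≤ quad K w * quad K v :=
    InnerProductSpace.Core.inner_mul_inner_self_le (𝕜 := ℂ) (F := Fin T → ℂ) w v
  rw [← sesq_conj hK.1 v w, norm_star] at h
  linarith [h, sq ‖sesq K v w‖, mul_comm (quad K w) (quad K v)]

lemma norm_sesq_le (hK : K.PosSemidef) (v w : Fin T → ℂ) :
    ‖sesq K v w‖ ≤ (quad K v + quad K w) / 2 := by
  have h := norm_sesq_sq_le hK v w
  have h1 := quad_nonneg hK v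
  have h2 := quad_nonneg hK w
  nlinarith [sq_nonneg (quad K v - quad K w), norm_nonneg (sesq K v w)]

lemma quad_le_of_bound {v : Fin T → ℂ} {B : ℝ} (hv : ∀ i, ‖v i‖ ≤ B) :
    ‖quad K v‖ ≤ B ^ 2 * ∑ i, ∑ j, ‖K i j‖ := by
  have h1 : ‖quad K v‖ ≤ ‖v ⬝ᵥ (K *ᵥ star v)‖ := Complex.abs_re_le_norm _
  refine h1.trans ?_
  rw [dotProduct, Finset.mul_sum]
  refine (norm_sum_le _ _).trans (Finset.sum_le_sum fun i _ => ?_)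
  rw [norm_mul, mulVec, dotProduct, Finset.mul_sum]
  have hB : 0 ≤ B := (norm_nonneg _).trans (hv i)
  calc ‖v i‖ * ‖∑ j, K i j * star v j‖ ≤ B * ∑ j, ‖K i j‖ * B := by
        refine mul_le_mul (hv i) ((norm_sum_le _ _).trans (Finset.sum_le_sum fun j _ => ?_))
          (norm_nonneg _) hB
        rw [norm_mul, Pi.star_apply, norm_star]
        exact mul_le_mul_of_nonneg_left (hv j) (norm_nonneg _)
    _ = ∑ j, B ^ 2 * ‖K i j‖ := by
        rw [Finset.mul_sum]; exact Finset.sum_congr rfl fun j _ => by ring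

lemma continuous_quad (K : Matrix (Fin T) (Fin T) ℂ) : Continuous (quad K) := by
  unfold quad
  simp only [dotProduct, mulVec]
  fun_prop

variable {L : Matrix (Fin T) (Fin T) ℂ}

/-- The pointwise form of the duality between the weights `K` and `L`: the `L`-form against `w ᵥ* K`
is the unweighted pairing. -/
lemma sesq_dual (hK : K.IsHermitian) (h : K * L = 1) (v w : Fin T → ℂ) :
    sesq L v (w ᵥ* K) = v ⬝ᵥ star w := by
  rw [sesq, star_vecMul, hK.eq, mulVec_mulVec, mul_eq_one_comm.1 h, one_mulVec]

lemma quad_dual (hK : K.IsHermitian) (h : K * L = 1) (v : Fin T → ℂ) :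
    quad L (v ᵥ* K) = quad K v := by
  rw [quad_eq_re_sesq, sesq_dual hK h, quad_eq_re_sesq, sesq_eq_vecMul_dotProduct]

lemma norm_sq_apply_le (hK : K.PosSemidef) (hL : L.IsHermitian) (h : K * L = 1) (v : Fin T → ℂ)
    (i : Fin T) : ‖v i‖ ^ 2 ≤ quad K v * (L i i).re := by
  -- The `K`-form against the `i`-th row of `L` evaluates the coordinate `v i`, and the square of
  -- this row is `L i i`.
  have h1 := norm_sesq_sq_le hK v (Pi.single i 1 ᵥ* L)
  rw [sesq_dual hL (mul_eq_one_comm.1 h), quad_dual hL (mul_eq_one_comm.1 h)] at h1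
  have h2 : v ⬝ᵥ star (Pi.single i 1) = v i := by
    rw [← Pi.single_star]; simp
  have h3 : quad L (Pi.single i 1) = (L i i).re := by
    rw [quad, ← Pi.single_star]; simp
  rwa [h2, h3] at h1

/-- If `F ≤ K` then `F K⁻¹ F ≤ F`. -/
lemma quad_vecMul_le {F : Matrix (Fin T) (Fin T) ℂ} (hF : F.PosSemidef) (hK : K.PosSemidef)
    (hFK : (K - F).PosSemidef) (h : K * L = 1) (v : Fin T → ℂ) :
    quad K (v ᵥ* F ᵥ* L) ≤ quad F v := by
  set w := v ᵥ* F ᵥ* L with hw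
  have h1 : quad F w ≤ quad K w := by
    have := quad_nonneg hFK w
    rw [quad_sub_mat] at this; linarith
  have h2 : sesq F v w = quad K w := by
    rw [← sesq_self hK.1, sesq_eq_vecMul_dotProduct, sesq_eq_vecMul_dotProduct, hw,
      vecMul_vecMul _ L K,
      mul_eq_one_comm.1 h, vecMul_one]
  have h3 := norm_sesq_sq_le hF v w
  rw [h2, Complex.norm_real, Real.norm_eq_abs, sq_abs] at h3
  have h4 := quad_nonneg hF v
  have h5 := quad_nonneg hK w
  -- The two bounds give `(quad K w)² ≤ quad F v * quad K w`; the case `quad K w = 0` is covered by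
  -- `0 ≤ quad F v`.
  by_contra hc
  push Not at hc
  nlinarith [mul_le_mul_of_nonneg_left h1 h4]

end sesq

/-! ### Trigonometric polynomials -/

section trigPoly

variable {T : ℕ}

lemma trigPoly_add (x y : ℤ →₀ (Fin T → ℂ)) : trigPoly (x + y) = trigPoly x + trigPoly y := by
  ext1 t
  exact Finsupp.sum_add_index' (by simp) (by simp)

lemma trigPoly_smul (c : ℂ) (x : ℤ →₀ (Fin T → ℂ)) : trigPoly (c • x) = c • trigPoly x := by
  ext1 t
  simp only [trigPoly, Pi.smul_apply]
  rw [Finsupp.sum_smul_index' (by simp), Finsupp.smul_sum]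
  simp only [smul_comm c]

lemma trigPoly_zero : trigPoly (0 : ℤ →₀ (Fin T → ℂ)) = 0 := by
  ext1 t; simp [trigPoly]

lemma trigPoly_sub (x y : ℤ →₀ (Fin T → ℂ)) : trigPoly (x - y) = trigPoly x - trigPoly y := by
  rw [sub_eq_add_neg, ← neg_one_smul ℂ y, trigPoly_add, trigPoly_smul, neg_one_smul,
    ← sub_eq_add_neg]

lemma trigPoly_single (n : ℤ) (v : Fin T → ℂ) :
    trigPoly (Finsupp.single n v) = fun t => expi n t • v := by
  ext1 t; simp [trigPoly]

lemma trigPoly_apply (x : ℤ →₀ (Fin T → ℂ)) (t : ℝ) (i : Fin T) :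
    trigPoly x t i = ∑ n ∈ x.support, expi n t * x n i := by
  simp [trigPoly, Finsupp.sum]

lemma continuous_trigPoly (x : ℤ →₀ (Fin T → ℂ)) : Continuous (trigPoly x) := by
  refine continuous_pi fun i => ?_
  simp only [trigPoly_apply]
  have := continuous_expi
  fun_prop

lemma norm_trigPoly_apply_le (x : ℤ →₀ (Fin T → ℂ)) (t : ℝ) (i : Fin T) :
    ‖trigPoly x t i‖ ≤ ∑ n ∈ x.support, ‖x n‖ := by
  rw [trigPoly_apply]
  refine (norm_sum_le _ _).trans (Finset.sum_le_sum fun n _ => ?_)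
  rw [norm_mul, norm_expi, one_mul]
  exact norm_le_pi_norm _ _

lemma coef_trigPoly (x : ℤ →₀ (Fin T → ℂ)) (n : ℤ) (i : Fin T) :
    coef (fun t => trigPoly x t i) n = x n i := by
  simp only [trigPoly_apply]
  rw [coef_finset_sum _ fun k _ => (integrable_expi k).mul_const _]
  have : ∀ k, coef (fun t => expi k t * x k i) n = if k = n then x k i else 0 := fun k => by
    simp only [mul_comm (expi k _), coef_const_mul, coef_expi]
    split_ifs <;> simp
  simp only [this, Finset.sum_ite_eq', Finsupp.mem_support_iff]
  split_ifs with h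
  · rfl
  · push Not at h; rw [h]; rfl

lemma support_subset_add {E : Set ℤ} {x y : ℤ →₀ (Fin T → ℂ)} (hx : (x.support : Set ℤ) ⊆ E)
    (hy : (y.support : Set ℤ) ⊆ E) : ((x + y).support : Set ℤ) ⊆ E := by
  classical
  intro n hn
  rcases Finset.mem_union.1 (Finsupp.support_add hn) with h | h
  exacts [hx h, hy h]

lemma support_subset_smul {E : Set ℤ} (c : ℂ) {x : ℤ →₀ (Fin T → ℂ)}
    (hx : (x.support : Set ℤ) ⊆ E) : ((c • x).support : Set ℤ) ⊆ E :=
  fun _ hn => hx (Finsupp.support_smul hn)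

lemma support_subset_single {E : Set ℤ} {n : ℤ} (hn : n ∈ E) (v : Fin T → ℂ) :
    ((Finsupp.single n v).support : Set ℤ) ⊆ E := by
  intro m hm
  rw [Finset.mem_singleton.1 (Finsupp.support_single_subset hm)]
  exact hn

end trigPoly

/-! ### The weighted spaces `L₂(K)` -/

section weighted

variable {T : ℕ} {K L : MatFn T}

lemma aestronglyMeasurable_apply {f : VecFn T} (hf : AEStronglyMeasurable f freq) (i : Fin T) :
    AEStronglyMeasurable (fun t => f t i) freq :=
  (continuous_apply i).comp_aestronglyMeasurable hf

lemma aestronglyMeasurable_of_apply {f : VecFn T}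
    (hf : ∀ i, AEStronglyMeasurable (fun t => f t i) freq) : AEStronglyMeasurable f freq :=
  (aemeasurable_pi_lambda f fun i => (hf i).aemeasurable).aestronglyMeasurable

lemma aestronglyMeasurable_vecMul {f : VecFn T} (hf : AEStronglyMeasurable f freq)
    (hK : ∀ i j, AEStronglyMeasurable (fun t => K t i j) freq) :
    AEStronglyMeasurable (fun t => f t ᵥ* K t) freq := by
  refine aestronglyMeasurable_of_apply fun j => ?_
  simp only [vecMul, dotProduct]
  exact Finset.aestronglyMeasurable_fun_sum _ fun i _ =>
    (aestronglyMeasurable_apply hf i).mul (hK i j)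

lemma aestronglyMeasurable_dotProduct {f g : VecFn T} (hf : AEStronglyMeasurable f freq)
    (hg : AEStronglyMeasurable g freq) :
    AEStronglyMeasurable (fun t => f t ⬝ᵥ star (g t)) freq := by
  simp only [dotProduct]
  exact Finset.aestronglyMeasurable_fun_sum _ fun i _ =>
    (aestronglyMeasurable_apply hf i).mul (aestronglyMeasurable_apply hg i).star

namespace IsSpectralDensity

lemma aestronglyMeasurable_apply (hK : IsSpectralDensity K) (i j : Fin T) :
    AEStronglyMeasurable (fun t => K t i j) freq := (hK.integrable i j).1

lemma aestronglyMeasurable_sesq (hK : IsSpectralDensity K) {f g : VecFn T}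
    (hf : AEStronglyMeasurable f freq) (hg : AEStronglyMeasurable g freq) :
    AEStronglyMeasurable (fun t => sesq (K t) (f t) (g t)) freq := by
  simp only [sesq_eq_vecMul_dotProduct]
  exact aestronglyMeasurable_dotProduct
    (aestronglyMeasurable_vecMul hf hK.aestronglyMeasurable_apply) hg

lemma aestronglyMeasurable_quad (hK : IsSpectralDensity K) {f : VecFn T}
    (hf : AEStronglyMeasurable f freq) :
    AEStronglyMeasurable (fun t => quad (K t) (f t)) freq :=
  Complex.continuous_re.comp_aestronglyMeasurable (hK.aestronglyMeasurable_sesq hf hf)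

lemma quad_nonneg (hK : IsSpectralDensity K) (f : VecFn T) :
    ∀ᵐ t ∂freq, 0 ≤ quad (K t) (f t) :=
  hK.posSemidef.mono fun _ h => MinimaxFiltering.quad_nonneg h _

lemma memL2_of_bound (hK : IsSpectralDensity K) {f : VecFn T} (hf : AEStronglyMeasurable f freq)
    {B : ℝ} (hB : ∀ᵐ t ∂freq, ∀ i, ‖f t i‖ ≤ B) : MemL2 K f := by
  refine ⟨hf, Integrable.mono' (g := fun t => B ^ 2 * ∑ i, ∑ j, ‖K t i j‖) ?_
    (hK.aestronglyMeasurable_quad hf) (hB.mono fun t h => quad_le_of_bound h)⟩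
  exact (integrable_finsetSum _ fun i _ => integrable_finsetSum _ fun j _ =>
    (hK.integrable i j).norm).const_mul _

lemma add {F G : MatFn T} (hF : IsSpectralDensity F) (hG : IsSpectralDensity G) :
    IsSpectralDensity (F + G) where
  integrable i j := (hF.integrable i j).add (hG.integrable i j)
  posSemidef := by
    filter_upwards [hF.posSemidef, hG.posSemidef] with t h1 h2 using h1.add h2

end IsSpectralDensity

namespace MemL2

variable {f g : VecFn T}

lemma zero : MemL2 K 0 :=
  ⟨aestronglyMeasurable_const, by simp [quad_zero]⟩

lemma add (hK : IsSpectralDensity K) (hf : MemL2 K f) (hg : MemL2 K g) : MemL2 K (f + g) := by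
  refine ⟨hf.1.add hg.1, Integrable.mono' ((hf.2.const_mul 2).add (hg.2.const_mul 2))
    (hK.aestronglyMeasurable_quad (hf.1.add hg.1)) ?_⟩
  filter_upwards [hK.posSemidef] with t ht
  rw [Real.norm_of_nonneg (quad_nonneg ht _)]
  exact quad_add_le ht _ _

lemma smul (c : ℂ) (hf : MemL2 K f) : MemL2 K (c • f) := by
  refine ⟨hf.1.const_smul c, ?_⟩
  simp only [Pi.smul_apply, quad_smul]
  exact hf.2.const_mul _

lemma sub (hK : IsSpectralDensity K) (hf : MemL2 K f) (hg : MemL2 K g) : MemL2 K (f - g) := by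
  have := hf.add hK (hg.smul (-1))
  rwa [neg_one_smul, ← sub_eq_add_neg] at this

lemma congr_ae (hf : MemL2 K f) (h : f =ᵐ[freq] g) : MemL2 K g :=
  ⟨hf.1.congr h, hf.2.congr (h.mono fun t ht => by simp only [ht])⟩

lemma integrable_sesq (hK : IsSpectralDensity K) (hf : MemL2 K f) (hg : MemL2 K g) :
    Integrable (fun t => sesq (K t) (f t) (g t)) freq := by
  refine Integrable.mono' ((hf.2.add hg.2).div_const 2)
    (hK.aestronglyMeasurable_sesq hf.1 hg.1) ?_
  filter_upwards [hK.posSemidef] with t ht using norm_sesq_le ht _ _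

end MemL2

lemma IsSpectralDensity.memL2_trigPoly (hK : IsSpectralDensity K) (x : ℤ →₀ (Fin T → ℂ)) :
    MemL2 K (trigPoly x) :=
  hK.memL2_of_bound (continuous_trigPoly x).aestronglyMeasurable
    (Eventually.of_forall fun t i => norm_trigPoly_apply_le x t i)

/-- The functions of `L₂(K)` as a subspace. -/
def l2Submodule (hK : IsSpectralDensity K) : Submodule ℂ (VecFn T) where
  carrier := {f | MemL2 K f}
  add_mem' hf hg := MemL2.add hK hf hg
  zero_mem' := MemL2.zero
  smul_mem' c _ hf := MemL2.smul c hf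

/-- The space `L₂(K)` with its seminorm. -/
def WeightedL2 (hK : IsSpectralDensity K) : Type := l2Submodule hK

/-! ### `L₂(K)` as a seminormed inner product space and its subspaces of polynomials -/

namespace WeightedL2

variable (hK : IsSpectralDensity K)

noncomputable instance : AddCommGroup (WeightedL2 hK) :=
  inferInstanceAs (AddCommGroup (l2Submodule hK))

noncomputable instance : Module ℂ (WeightedL2 hK) :=
  inferInstanceAs (Module ℂ (l2Submodule hK))

/-- The element of `WeightedL2 hK` given by a function. -/
def mk (f : VecFn T) (hf : MemL2 K f) : WeightedL2 hK := ⟨f, hf⟩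

variable {hK}

/-- The underlying function. -/
def fn (x : WeightedL2 hK) : VecFn T := x.1

lemma memL2 (x : WeightedL2 hK) : MemL2 K x.fn := x.2

@[simp] lemma fn_mk (f : VecFn T) (hf : MemL2 K f) : (mk hK f hf).fn = f := rfl

lemma fn_add (x y : WeightedL2 hK) : (x + y).fn = x.fn + y.fn := rfl

lemma fn_sub (x y : WeightedL2 hK) : (x - y).fn = x.fn - y.fn := rfl

lemma fn_smul (c : ℂ) (x : WeightedL2 hK) : (c • x).fn = c • x.fn := rfl

lemma fn_zero : (0 : WeightedL2 hK).fn = 0 := rfl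

variable (hK) in
/-- The pre-inner product of `L₂(K)`. -/
@[reducible] noncomputable def core : PreInnerProductSpace.Core ℂ (WeightedL2 hK) where
  inner x y := ∫ t, sesq (K t) (y.fn t) (x.fn t) ∂freq
  conj_inner_symm x y := by
    rw [← integral_conj]
    apply integral_congr_ae
    filter_upwards [hK.posSemidef] with t ht using sesq_conj ht.1 _ _
  re_inner_nonneg x := by
    have := integral_re (x.memL2.integrable_sesq hK x.memL2)
    rw [← this]
    apply integral_nonneg_of_ae
    filter_upwards [hK.posSemidef] with t ht using quad_nonneg ht _
  add_left x y z := by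
    rw [← integral_add (z.memL2.integrable_sesq hK x.memL2) (z.memL2.integrable_sesq hK y.memL2)]
    simp only [fn_add, Pi.add_apply, sesq_add_right]
  smul_left x y r := by
    rw [← integral_const_mul]
    simp only [fn_smul, Pi.smul_apply, sesq_smul_right]
    rfl

noncomputable instance : SeminormedAddCommGroup (WeightedL2 hK) :=
  InnerProductSpace.Core.toSeminormedAddCommGroup (c := core hK)

noncomputable instance : InnerProductSpace ℂ (WeightedL2 hK) := InnerProductSpace.ofCore (core hK)

lemma inner_def (x y : WeightedL2 hK) :
    inner ℂ x y = ∫ t, sesq (K t) (y.fn t) (x.fn t) ∂freq := rfl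

lemma norm_sq (x : WeightedL2 hK) : ‖x‖ ^ 2 = ∫ t, quad (K t) (x.fn t) ∂freq := by
  rw [norm_sq_eq_re_inner (𝕜 := ℂ), inner_def, ← integral_re (x.memL2.integrable_sesq hK x.memL2)]
  rfl

/-- A Cauchy sequence which converges almost everywhere along a subsequence converges in norm. -/
lemma tendsto_of_cauchySeq_of_ae {x : ℕ → WeightedL2 hK} (hx : CauchySeq x) {ns : ℕ → ℕ}
    (hns : Tendsto ns atTop atTop) {g : VecFn T}
    (hg : ∀ᵐ t ∂freq, Tendsto (fun n => (x (ns n)).fn t) atTop (𝓝 (g t))) :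
    ∃ y : WeightedL2 hK, y.fn = g ∧ Tendsto x atTop (𝓝 y) := by
  have hgm : AEStronglyMeasurable g freq :=
    aestronglyMeasurable_of_tendsto_ae atTop (fun n => (x (ns n)).memL2.1) hg
  -- Fatou's lemma along the almost everywhere convergent subsequence. The lower integral is used
  -- because `g` is not yet known to lie in `L₂(K)`.
  have key : ∀ ε > 0, ∃ N, ∀ n ≥ N, ∫⁻ t, ENNReal.ofReal (quad (K t) ((x n).fn t - g t)) ∂freq ≤
      ENNReal.ofReal (ε ^ 2) := fun ε hε => by
    obtain ⟨N, hN⟩ := Metric.cauchySeq_iff.1 hx ε hε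
    refine ⟨N, fun n hn => ?_⟩
    have h1 : ∀ᵐ t ∂freq, ENNReal.ofReal (quad (K t) ((x n).fn t - g t)) =
        liminf (fun m => ENNReal.ofReal (quad (K t) ((x n).fn t - (x (ns m)).fn t))) atTop := by
      filter_upwards [hg] with t ht
      refine (Tendsto.liminf_eq ?_).symm
      exact (ENNReal.continuous_ofReal.tendsto _).comp
        (((continuous_quad (K t)).tendsto _).comp (ht.const_sub _))
    rw [lintegral_congr_ae h1]
    refine (lintegral_liminf_le' fun m => ?_).trans ?_
    · exact ENNReal.measurable_ofReal.comp_aemeasurable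
        (hK.aestronglyMeasurable_quad ((x n).memL2.1.sub (x (ns m)).memL2.1)).aemeasurable
    · refine (liminf_le_liminf (v := fun _ => ENNReal.ofReal (ε ^ 2)) ?_).trans
        (by simp)
      filter_upwards [hns.eventually_ge_atTop N] with m hm
      have h2 := hN n hn _ hm
      rw [dist_eq_norm] at h2
      have e := ofReal_integral_eq_lintegral_ofReal ((x n).memL2.sub hK (x (ns m)).memL2).2
        (hK.quad_nonneg _)
      simp only [Pi.sub_apply] at e
      rw [← e]
      apply ENNReal.ofReal_le_ofReal
      have h3 := norm_sq (x n - x (ns m))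
      rw [fn_sub] at h3
      simp only [Pi.sub_apply] at h3 ⊢
      rw [← h3]
      exact pow_le_pow_left₀ (norm_nonneg _) h2.le 2
  have hmem : ∀ n, ∫⁻ t, ENNReal.ofReal (quad (K t) ((x n).fn t - g t)) ∂freq ≠ ⊤ →
      MemL2 K ((x n).fn - g) := fun n hn => by
    have hm := hK.aestronglyMeasurable_quad ((x n).memL2.1.sub hgm)
    refine ⟨(x n).memL2.1.sub hgm, (lintegral_ofReal_ne_top_iff_integrable hm
      (hK.quad_nonneg _)).1 hn⟩
  have hgL : MemL2 K g := by
    obtain ⟨N, hN⟩ := key 1 one_pos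
    have := hmem N (ne_top_of_le_ne_top ENNReal.ofReal_ne_top (hN N le_rfl))
    have h2 := (x N).memL2.sub hK this
    rwa [sub_sub_cancel] at h2
  refine ⟨mk hK g hgL, rfl, ?_⟩
  rw [Metric.tendsto_atTop]
  intro ε hε
  obtain ⟨N, hN⟩ := key (ε / 2) (half_pos hε)
  refine ⟨N, fun n hn => ?_⟩
  have h1 := hN n hn
  have e := ofReal_integral_eq_lintegral_ofReal ((x n).memL2.sub hK hgL).2
    (hK.quad_nonneg ((x n).fn - g))
  simp only [Pi.sub_apply] at e
  rw [← e, ENNReal.ofReal_le_ofReal_iff (by positivity)] at h1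
  have h2 : ‖x n - mk hK g hgL‖ ^ 2 ≤ (ε / 2) ^ 2 := by
    rw [norm_sq]; exact h1
  rw [dist_eq_norm]
  have h3 := abs_le_of_sq_le_sq h2 (by positivity)
  rw [abs_norm] at h3
  linarith

/-- The trigonometric polynomials with frequencies in `E`. -/
def trigSubmodule (hK : IsSpectralDensity K) (E : Set ℤ) : Submodule ℂ (WeightedL2 hK) where
  carrier := {x | ∃ y : ℤ →₀ (Fin T → ℂ), (y.support : Set ℤ) ⊆ E ∧ x.fn = trigPoly y}
  add_mem' := by
    rintro _ _ ⟨y, hy, h⟩ ⟨z, hz, h'⟩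
    exact ⟨y + z, support_subset_add hy hz, by rw [fn_add, h, h', trigPoly_add]⟩
  zero_mem' := ⟨0, by simp, by rw [fn_zero, trigPoly_zero]⟩
  smul_mem' := by
    rintro c _ ⟨y, hy, h⟩
    exact ⟨c • y, support_subset_smul c hy, by rw [fn_smul, h, trigPoly_smul]⟩

/-- A trigonometric polynomial as an element of `L₂(K)`. -/
noncomputable def poly (hK : IsSpectralDensity K) (x : ℤ →₀ (Fin T → ℂ)) : WeightedL2 hK :=
  mk hK (trigPoly x) (hK.memL2_trigPoly x)

lemma poly_mem {E : Set ℤ} {x : ℤ →₀ (Fin T → ℂ)} (hx : (x.support : Set ℤ) ⊆ E) :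
    poly hK x ∈ trigSubmodule hK E := ⟨x, hx, rfl⟩

lemma mem_closure_trigSubmodule {E : Set ℤ} {h : WeightedL2 hK} :
    h ∈ closure (trigSubmodule hK E : Set (WeightedL2 hK)) ↔
      ∀ ε > 0, ∃ x : ℤ →₀ (Fin T → ℂ), (x.support : Set ℤ) ⊆ E ∧
        ∫ t, quad (K t) (h.fn t - trigPoly x t) ∂freq < ε := by
  rw [Metric.mem_closure_iff]
  constructor
  · intro H ε hε
    obtain ⟨y, ⟨x, hx, hyx⟩, hd⟩ := H (Real.sqrt ε) (Real.sqrt_pos.2 hε)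
    refine ⟨x, hx, ?_⟩
    rw [dist_eq_norm] at hd
    have := norm_sq (h - y)
    rw [fn_sub, hyx] at this
    simp only [Pi.sub_apply] at this
    rw [← this]
    exact (Real.lt_sqrt (norm_nonneg _)).1 hd
  · intro H ε hε
    obtain ⟨x, hx, hd⟩ := H (ε ^ 2) (by positivity)
    refine ⟨poly hK x, poly_mem hx, ?_⟩
    rw [dist_eq_norm]
    have := norm_sq (h - poly hK x)
    rw [fn_sub] at this
    simp only [poly, fn_mk, Pi.sub_apply] at this
    rw [← this] at hd
    exact lt_of_pow_lt_pow_left₀ 2 hε.le hd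

lemma memL2s_iff {S : Set ℤ} {h : VecFn T} :
    MemL2s S K h ↔ ∃ hh : MemL2 K h,
      mk hK h hh ∈ closure (trigSubmodule hK (observed S) : Set (WeightedL2 hK)) := by
  constructor
  · rintro ⟨h1, h2⟩
    exact ⟨h1, mem_closure_trigSubmodule.2 h2⟩
  · rintro ⟨h1, h2⟩
    exact ⟨h1, mem_closure_trigSubmodule.1 h2⟩

lemma exists_seq_poly {E : Set ℤ} {h : WeightedL2 hK}
    (hh : h ∈ closure (trigSubmodule hK E : Set (WeightedL2 hK))) :
    ∃ x : ℕ → ℤ →₀ (Fin T → ℂ), (∀ n, ((x n).support : Set ℤ) ⊆ E) ∧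
      Tendsto (fun n => poly hK (x n)) atTop (𝓝 h) := by
  obtain ⟨u, hu, hlim⟩ := mem_closure_iff_seq_limit.1 hh
  choose y hy hyu using hu
  refine ⟨y, hy, ?_⟩
  have : (fun n => poly hK (y n)) = u := by
    ext1 n; exact Subtype.ext (hyu n).symm
  rwa [this]

end WeightedL2

/-- The projection onto the closure of a subspace of a complete pre-inner product space. -/
lemma exists_mem_closure_inner_eq_zero {X : Type*} [SeminormedAddCommGroup X]
    [InnerProductSpace ℂ X] [CompleteSpace X] (P : Submodule ℂ X) (f : X) :
    ∃ h ∈ closure (P : Set X), ∀ p ∈ closure (P : Set X), inner ℂ p (f - h) = 0 := by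
  -- Orthogonal projections need a Hilbert space, so the projection is taken in the Hausdorff
  -- quotient and lifted; closures and inner products are not affected.
  let q : X →L[ℂ] SeparationQuotient X := SeparationQuotient.mkCLM ℂ X
  let Q : Submodule ℂ (SeparationQuotient X) := (P.map q.toLinearMap).topologicalClosure
  have : CompleteSpace Q := (Submodule.isClosed_topologicalClosure _).completeSpace_coe
  obtain ⟨h, hh⟩ := SeparationQuotient.surjective_mk
    (Q.starProjection (SeparationQuotient.mk f))
  have hcl : ∀ p : X, p ∈ closure (P : Set X) ↔ SeparationQuotient.mk p ∈ Q := fun p => by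
    rw [SeparationQuotient.isInducing_mk.closure_eq_preimage_closure_image]
    rfl
  refine ⟨h, (hcl h).2 (hh ▸ Submodule.starProjection_apply_mem _ _), fun p hp => ?_⟩
  have h1 := Q.sub_starProjection_mem_orthogonal (SeparationQuotient.mk f)
  rw [← hh, Submodule.mem_orthogonal] at h1
  exact h1 _ ((hcl p).1 hp)

end weighted

/-! ### Dual weights -/

/-- Two spectral densities which are inverse to each other almost everywhere. -/
structure DualWeights {T : ℕ} (K L : MatFn T) : Prop where
  left : IsSpectralDensity K
  right : IsSpectralDensity L
  mul_eq_one : ∀ᵐ t ∂freq, K t * L t = 1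

namespace DualWeights

variable {T : ℕ} {K L : MatFn T}

lemma symm (d : DualWeights K L) : DualWeights L K :=
  ⟨d.right, d.left, d.mul_eq_one.mono fun _ h => mul_eq_one_comm.1 h⟩

lemma vecMul_vecMul (d : DualWeights K L) (f : VecFn T) :
    (fun t => f t ᵥ* K t ᵥ* L t) =ᵐ[freq] f := by
  filter_upwards [d.mul_eq_one] with t ht
  rw [Matrix.vecMul_vecMul, ht, vecMul_one]

lemma memL2_vecMul (d : DualWeights K L) {f : VecFn T} (hf : MemL2 K f) :
    MemL2 L fun t => f t ᵥ* K t := by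
  refine ⟨aestronglyMeasurable_vecMul hf.1 d.left.aestronglyMeasurable_apply, hf.2.congr ?_⟩
  filter_upwards [d.mul_eq_one, d.left.posSemidef] with t h1 h2
  exact (quad_dual h2.1 h1 _).symm

lemma integral_quad_vecMul (d : DualWeights K L) (f : VecFn T) :
    ∫ t, quad (L t) (f t ᵥ* K t) ∂freq = ∫ t, quad (K t) (f t) ∂freq := by
  apply integral_congr_ae
  filter_upwards [d.mul_eq_one, d.left.posSemidef] with t h1 h2
  exact quad_dual h2.1 h1 _

lemma integrable_dotProduct (d : DualWeights K L) {f g : VecFn T} (hf : MemL2 K f)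
    (hg : MemL2 L g) : Integrable (fun t => f t ⬝ᵥ star (g t)) freq := by
  refine (hf.integrable_sesq d.left (d.symm.memL2_vecMul hg)).congr ?_
  filter_upwards [d.symm.mul_eq_one, d.right.posSemidef] with t h1 h2
  exact sesq_dual h2.1 h1 _ _

lemma inner_vecMul (d : DualWeights K L) (f : WeightedL2 d.left) (g : WeightedL2 d.right) :
    inner ℂ (WeightedL2.mk d.left _ (d.symm.memL2_vecMul g.memL2)) f =
      ∫ t, f.fn t ⬝ᵥ star (g.fn t) ∂freq := by
  rw [WeightedL2.inner_def]
  apply integral_congr_ae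
  filter_upwards [d.symm.mul_eq_one, d.right.posSemidef] with t h1 h2
  exact sesq_dual h2.1 h1 _ _

lemma integrable_apply (d : DualWeights K L) {f : VecFn T} (hf : MemL2 K f) (i : Fin T) :
    Integrable (fun t => f t i) freq := by
  have := d.integrable_dotProduct hf (d.right.memL2_trigPoly (Finsupp.single 0 (Pi.single i 1)))
  simpa [trigPoly_single, ← Pi.single_star] using this

/-- The Fourier coefficients depend continuously on the function. -/
lemma tendsto_coef (d : DualWeights K L) {x : ℕ → WeightedL2 d.left} {y : WeightedL2 d.left}
    (h : Tendsto x atTop (𝓝 y)) (n : ℤ) (i : Fin T) :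
    Tendsto (fun k => coef (fun t => (x k).fn t i) n) atTop (𝓝 (coef (fun t => y.fn t i) n)) := by
  -- A Fourier coefficient is an unweighted pairing with a character, hence an inner product in
  -- `L₂(K)` with that character multiplied by `L`.
  have key : ∀ z : WeightedL2 d.left, coef (fun t => z.fn t i) n = (1 / (2 * Real.pi) : ℝ) •
      inner ℂ (WeightedL2.mk d.left _ (d.symm.memL2_vecMul
        (WeightedL2.poly d.right (Finsupp.single n (Pi.single i 1))).memL2)) z := fun z => by
    rw [d.inner_vecMul, coef, mean]
    congr 2; ext t
    simp [WeightedL2.poly, trigPoly_single, star_smul, ← star_expi, mul_comm]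
  simp only [key]
  exact ((continuous_const.inner continuous_id).tendsto y |>.comp h).const_smul _

/-- The bound `|f i|² ≤ quad K f * L i i` combined with the inequality of arithmetic and geometric
means. The free scale `r` turns it into a bound for the `L₁` norm that is linear in the `L₂(K)`
norm. -/
lemma norm_le_of_pos (d : DualWeights K L) (f : VecFn T) {r : ℝ} (hr : 0 < r) :
    ∀ᵐ t ∂freq, ‖f t‖ ≤ (T * r⁻¹ * quad (K t) (f t) + r * ∑ i, ‖L t i i‖) / 2 := by
  filter_upwards [d.mul_eq_one, d.left.posSemidef, d.right.posSemidef] with t h h1 h2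
  have hq := quad_nonneg h1 (f t)
  have hi : ∀ i, ‖f t i‖ ≤ (r⁻¹ * quad (K t) (f t) + r * ‖L t i i‖) / 2 := fun i => by
    have h3 := norm_sq_apply_le h1 h2.1 h (f t) i
    have h4 : (L t i i).re ≤ ‖L t i i‖ := Complex.re_le_norm _
    have h5 : ‖f t i‖ ^ 2 ≤ (r⁻¹ * quad (K t) (f t)) * (r * ‖L t i i‖) := by
      calc ‖f t i‖ ^ 2 ≤ quad (K t) (f t) * ‖L t i i‖ :=
            h3.trans (mul_le_mul_of_nonneg_left h4 hq)
        _ = _ := by field_simp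
    refine abs_le_of_sq_le_sq' (h5.trans ?_) (by positivity) |>.2
    nlinarith [sq_nonneg (r⁻¹ * quad (K t) (f t) - r * ‖L t i i‖)]
  have h6 : (T * r⁻¹ * quad (K t) (f t) + r * ∑ i, ‖L t i i‖) / 2 =
      ∑ i, (r⁻¹ * quad (K t) (f t) + r * ‖L t i i‖) / 2 := by
    rw [← Finset.sum_div, Finset.sum_add_distrib]
    simp [Finset.mul_sum]; ring
  rw [h6]
  have h7 : ∀ i, 0 ≤ (r⁻¹ * quad (K t) (f t) + r * ‖L t i i‖) / 2 := fun i => by positivity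
  refine (pi_norm_le_iff_of_nonneg (Finset.sum_nonneg fun i _ => h7 i)).2 fun i => ?_
  exact (hi i).trans (Finset.single_le_sum (f := fun i =>
    (r⁻¹ * quad (K t) (f t) + r * ‖L t i i‖) / 2) (fun i _ => h7 i) (Finset.mem_univ i))

/-- The embedding of `L₂(K)` into `L₁`. The bound uses any positive `r ≥ ‖x‖` instead of `‖x‖`,
which may vanish, since the scale is inverted. -/
lemma exists_eLpNorm_le (d : DualWeights K L) : ∃ c : ℝ, 0 ≤ c ∧ ∀ (x : WeightedL2 d.left) (r : ℝ),
    0 < r → ‖x‖ ≤ r → eLpNorm x.fn 1 freq ≤ ENNReal.ofReal (r * c) := by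
  have hLi : Integrable (fun t => ∑ i, ‖L t i i‖) freq :=
    integrable_finsetSum _ fun i _ => (d.right.integrable i i).norm
  have hL0 : 0 ≤ ∫ t, ∑ i, ‖L t i i‖ ∂freq :=
    integral_nonneg fun t => Finset.sum_nonneg fun i _ => norm_nonneg _
  refine ⟨(T + ∫ t, ∑ i, ‖L t i i‖ ∂freq) / 2, by positivity, fun x r hr hx => ?_⟩
  have hint : Integrable (fun t => (T * r⁻¹ * quad (K t) (x.fn t) + r * ∑ i, ‖L t i i‖) / 2) freq :=
    ((x.memL2.2.const_mul _).add (hLi.const_mul r)).div_const 2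
  have hb := d.norm_le_of_pos x.fn hr
  rw [eLpNorm_one_eq_lintegral_enorm]
  calc ∫⁻ t, ‖x.fn t‖ₑ ∂freq
      ≤ ∫⁻ t, ENNReal.ofReal ((T * r⁻¹ * quad (K t) (x.fn t) + r * ∑ i, ‖L t i i‖) / 2) ∂freq := by
        refine lintegral_mono_ae (hb.mono fun t ht => ?_)
        rw [← ofReal_norm]
        exact ENNReal.ofReal_le_ofReal ht
    _ = ENNReal.ofReal (∫ t, (T * r⁻¹ * quad (K t) (x.fn t) + r * ∑ i, ‖L t i i‖) / 2 ∂freq) :=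
        (ofReal_integral_eq_lintegral_ofReal hint
          (hb.mono fun t ht => (norm_nonneg _).trans ht)).symm
    _ ≤ _ := by
        apply ENNReal.ofReal_le_ofReal
        rw [integral_div, integral_add (x.memL2.2.const_mul _) (hLi.const_mul r),
          integral_const_mul, integral_const_mul, ← WeightedL2.norm_sq]
        have h1 : T * r⁻¹ * ‖x‖ ^ 2 ≤ T * r := by
          have h2 : ‖x‖ ^ 2 ≤ r ^ 2 := pow_le_pow_left₀ (norm_nonneg _) hx 2
          calc T * r⁻¹ * ‖x‖ ^ 2 ≤ T * r⁻¹ * r ^ 2 := by gcongr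
            _ = T * r := by field_simp
        linarith

/-- The Riesz–Fischer argument: a geometrically controlled sequence is controlled in `L₁` as well,
so it converges almost everywhere, and `tendsto_of_cauchySeq_of_ae` upgrades this to convergence in
`L₂(K)`. -/
lemma completeSpace (d : DualWeights K L) : CompleteSpace (WeightedL2 d.left) := by
  obtain ⟨c, hc, hcb⟩ := d.exists_eLpNorm_le
  refine Metric.complete_of_convergent_controlled_sequences (fun n => (1 / 2 : ℝ) ^ n)
    (fun n => by positivity) fun u hu => ?_
  have hcau : CauchySeq u := by
    rw [Metric.cauchySeq_iff]
    intro ε hε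
    obtain ⟨N, hN⟩ := exists_pow_lt_of_lt_one hε (by norm_num : (1 / 2 : ℝ) < 1)
    exact ⟨N, fun m hm n hn => (hu N m n hm hn).trans hN⟩
  have hsum : Summable fun n : ℕ => (1 / 2 : ℝ) ^ n * (c + 1) :=
    (summable_geometric_of_lt_one (by norm_num) (by norm_num)).mul_right _
  have hae : ∀ᵐ t ∂freq, ∃ l, Tendsto (fun n => (u n).fn t) atTop (𝓝 l) := by
    refine Lp.ae_tendsto_of_cauchy_eLpNorm (p := 1)
      (B := fun n => ENNReal.ofReal ((1 / 2 : ℝ) ^ n * (c + 1))) (fun n => (u n).memL2.1) le_rfl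
      ?_ fun N n m hn hm => ?_
    · exact hsum.tsum_ofReal_ne_top
    · have h1 := hcb (u n - u m) _ (by positivity)
        ((dist_eq_norm (u n) (u m)) ▸ (hu N n m hn hm).le)
      refine h1.trans_lt ?_
      rw [ENNReal.ofReal_lt_ofReal_iff (by positivity)]
      have : (0 : ℝ) < (1 / 2) ^ N := by positivity
      nlinarith
  -- The limit function is set to `0` where the sequence diverges.
  have hex : ∀ t, ∃ l, (∃ l, Tendsto (fun n => (u n).fn t) atTop (𝓝 l)) →
      Tendsto (fun n => (u n).fn t) atTop (𝓝 l) := fun t => by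
    by_cases h : ∃ l, Tendsto (fun n => (u n).fn t) atTop (𝓝 l)
    · exact ⟨h.choose, fun _ => h.choose_spec⟩
    · exact ⟨0, fun h' => absurd h' h⟩
  choose g hg using hex
  obtain ⟨y, -, hy⟩ := WeightedL2.tendsto_of_cauchySeq_of_ae hcau tendsto_id (g := g)
    (hae.mono fun t ht => hg t ht)
  exact ⟨y, hy⟩

lemma ae_eq_zero_of_integral_quad (d : DualWeights K L) {f : VecFn T} (hf : MemL2 K f)
    (h : ∫ t, quad (K t) (f t) ∂freq = 0) : f =ᵐ[freq] 0 := by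
  have h1 := (integral_eq_zero_iff_of_nonneg_ae (d.left.quad_nonneg f) hf.2).1 h
  filter_upwards [h1, d.mul_eq_one, d.left.posSemidef, d.right.posSemidef] with t h2 h3 h4 h5
  ext i
  have h6 := norm_sq_apply_le h4 h5.1 h3 (f t) i
  rw [h2, Pi.zero_apply, zero_mul] at h6
  have h7 : ‖f t i‖ = 0 := by nlinarith [norm_nonneg (f t i)]
  simpa using h7

end DualWeights

/-! ### Pairing of coefficient sequences with trigonometric polynomials -/

section pairing

variable {T : ℕ}

/-- The Fourier coefficients of a vector function. -/
noncomputable def vcoef (f : VecFn T) (n : ℤ) : Fin T → ℂ := fun i => coef (fun t => f t i) n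

lemma mean_dotProduct_star_trigPoly {c : VecFn T} (hc : ∀ i, Integrable (fun t => c t i) freq)
    (x : ℤ →₀ (Fin T → ℂ)) :
    mean (fun t => c t ⬝ᵥ star (trigPoly x t)) = pairing (vcoef c) x := by
  have h : ∀ t, c t ⬝ᵥ star (trigPoly x t) =
      ∑ n ∈ x.support, ∑ i, star (x n i) * (c t i * expi (-n) t) := fun t => by
    rw [Finset.sum_comm]
    simp only [dotProduct, Pi.star_apply, trigPoly_apply, star_sum, Finset.mul_sum]
    refine Finset.sum_congr rfl fun i _ => Finset.sum_congr rfl fun n _ => ?_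
    rw [star_mul', star_expi]; ring
  simp only [h]
  rw [mean_finset_sum _ fun n _ => integrable_finsetSum _ fun i _ =>
    (integrable_mul_expi (hc i) _).const_mul _]
  simp only [pairing, Finsupp.sum]
  refine Finset.sum_congr rfl fun n _ => ?_
  rw [mean_finset_sum _ fun i _ => (integrable_mul_expi (hc i) _).const_mul _]
  simp only [dotProduct, vcoef, Pi.star_apply]
  refine Finset.sum_congr rfl fun i _ => ?_
  rw [mean_const_mul, coef, mul_comm]

lemma pairing_single (c : ℤ → Fin T → ℂ) (n : ℤ) (i : Fin T) :
    pairing c (Finsupp.single n (Pi.single i 1)) = c n i := by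
  simp [pairing]

lemma pairing_eq_zero {c : ℤ → Fin T → ℂ} {E : Set ℤ} (hc : ∀ n ∈ E, c n = 0)
    {x : ℤ →₀ (Fin T → ℂ)} (hx : (x.support : Set ℤ) ⊆ E) : pairing c x = 0 := by
  refine Finset.sum_eq_zero fun n hn => ?_
  simp only
  rw [hc n (hx hn), zero_dotProduct]

end pairing

/-! ### Orthogonality and density of trigonometric polynomials -/

section density

variable {T : ℕ} {K L : MatFn T}

lemma vcoef_congr_ae {f g : VecFn T} (h : f =ᵐ[freq] g) (n : ℤ) : vcoef f n = vcoef g n := by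
  ext i
  exact coef_congr_ae (h.mono fun t ht => by simp only [ht]) n

lemma vcoef_sub {f g : VecFn T} (hf : ∀ i, Integrable (fun t => f t i) freq)
    (hg : ∀ i, Integrable (fun t => g t i) freq) (n : ℤ) :
    vcoef (f - g) n = vcoef f n - vcoef g n := by
  ext i
  exact coef_sub (hf i) (hg i) n

lemma IsSpectralDensity.integrable_vecMul_apply (hK : IsSpectralDensity K) {f : VecFn T}
    (hf : MemL2 K f) (i : Fin T) : Integrable (fun t => (f t ᵥ* K t) i) freq := by
  have := hf.integrable_sesq hK (hK.memL2_trigPoly (Finsupp.single 0 (Pi.single i 1)))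
  simpa [trigPoly_single, sesq_eq_vecMul_dotProduct, ← Pi.single_star] using this

namespace WeightedL2

variable {hK : IsSpectralDensity K}

lemma inner_poly (y : ℤ →₀ (Fin T → ℂ)) (x : WeightedL2 hK) :
    inner ℂ (poly hK y) x =
      (2 * Real.pi : ℂ) * pairing (vcoef fun t => x.fn t ᵥ* K t) y := by
  rw [← mean_dotProduct_star_trigPoly (hK.integrable_vecMul_apply x.memL2), inner_def, mean,
    Complex.real_smul]
  simp only [sesq_eq_vecMul_dotProduct]
  have : (Real.pi : ℂ) ≠ 0 := by exact_mod_cast Real.pi_ne_zero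
  push_cast
  rw [← mul_assoc, mul_one_div_cancel (by simp [this]), one_mul]
  rfl

lemma inner_eq_zero_of_mem_closure {P : Submodule ℂ (WeightedL2 hK)} {x : WeightedL2 hK}
    (h : ∀ p ∈ P, inner ℂ p x = 0) {p : WeightedL2 hK}
    (hp : p ∈ closure (P : Set (WeightedL2 hK))) : inner ℂ p x = 0 := by
  have hc : IsClosed {p : WeightedL2 hK | inner ℂ p x = 0} :=
    isClosed_eq (continuous_id.inner continuous_const) continuous_const
  exact closure_minimal (fun p hp => h p hp) hc hp

/-- Orthogonality in `L₂(K)` is a condition on the frequencies of `xᵀ K`, not of `x`. This turns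
normal equations into statements about spectra. -/
lemma inner_trigSubmodule_eq_zero_iff {E : Set ℤ} {x : WeightedL2 hK} :
    (∀ p ∈ trigSubmodule hK E, inner ℂ p x = 0) ↔
      ∀ n ∈ E, vcoef (fun t => x.fn t ᵥ* K t) n = 0 := by
  have h2 : (2 * Real.pi : ℂ) ≠ 0 := by simp [Real.pi_ne_zero]
  constructor
  · intro h n hn
    ext i
    have h1 := h _ (poly_mem (support_subset_single hn (Pi.single i 1)))
    rw [inner_poly, pairing_single] at h1
    exact (mul_eq_zero.1 h1).resolve_left h2
  · rintro h p ⟨y, hy, hp⟩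
    have h1 : p = poly hK y := Subtype.ext hp
    rw [h1, inner_poly, pairing_eq_zero h hy, mul_zero]

end WeightedL2

namespace DualWeights

variable (d : DualWeights K L)
include d

/-- Fourier coefficients are continuous on `L₂(K)` because the inverse weight is integrable. -/
lemma vcoef_eq_zero_of_mem_closure {E : Set ℤ} {x : WeightedL2 d.left}
    (hx : x ∈ closure (WeightedL2.trigSubmodule d.left E : Set (WeightedL2 d.left))) {n : ℤ}
    (hn : n ∉ E) : vcoef x.fn n = 0 := by
  obtain ⟨y, hy, hlim⟩ := WeightedL2.exists_seq_poly hx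
  ext i
  have h1 := d.tendsto_coef hlim n i
  have h2 : ∀ k, coef (fun t => (WeightedL2.poly d.left (y k)).fn t i) n = 0 := fun k => by
    simp only [WeightedL2.poly, WeightedL2.fn_mk, coef_trigPoly]
    have : y k n = 0 := by
      by_contra h
      exact hn (hy k (by simpa using h))
    rw [this]; rfl
  simp only [h2] at h1
  exact tendsto_nhds_unique h1 tendsto_const_nhds

lemma ae_eq_zero_of_norm {x : WeightedL2 d.left} (h : ‖x‖ = 0) : x.fn =ᵐ[freq] 0 :=
  d.ae_eq_zero_of_integral_quad x.memL2 (by rw [← WeightedL2.norm_sq, h]; simp)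

/-- A function of `L₂(L)` whose Fourier coefficients vanish at the observed frequencies is a limit
of trigonometric polynomials with unobserved frequencies. -/
theorem mem_closure_of_vcoef {S : Set ℤ} (hS : S.Finite)
    {C : WeightedL2 d.right} (hC : ∀ n ∈ observed S, vcoef C.fn n = 0) :
    C ∈ closure (WeightedL2.trigSubmodule d.right (unobserved S) : Set (WeightedL2 d.right)) := by
  classical
  have := d.symm.completeSpace
  obtain ⟨C', hC', horth⟩ := exists_mem_closure_inner_eq_zero
    (WeightedL2.trigSubmodule d.right (unobserved S)) C
  -- The aim is `‖D‖ = 0`, that is `∫ g ⬝ᵥ star D = 0` for the row `g = D L` introduced below.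
  set D := C - C' with hD
  have hdis : ∀ n ∈ observed S, n ∉ unobserved S := fun n hn hn' => by
    rcases hn' with h | h
    · exact hn.2 h
    · exact absurd hn.1 (not_lt.2 h)
  have hDi : ∀ i, Integrable (fun t => D.fn t i) freq := d.symm.integrable_apply D.memL2
  have hD0 : ∀ n ∈ observed S, vcoef D.fn n = 0 := fun n hn => by
    rw [hD, WeightedL2.fn_sub, vcoef_sub (d.symm.integrable_apply C.memL2)
      (d.symm.integrable_apply C'.memL2), hC n hn,
      d.symm.vcoef_eq_zero_of_mem_closure hC' (hdis n hn), sub_zero]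
  set g : VecFn T := fun t => D.fn t ᵥ* L t with hg
  have hgm : MemL2 K g := d.symm.memL2_vecMul D.memL2
  have hgi : ∀ i, Integrable (fun t => g t i) freq := d.integrable_apply hgm
  have hg0 : ∀ n ∈ unobserved S, vcoef g n = 0 :=
    WeightedL2.inner_trigSubmodule_eq_zero_iff.1 fun p hp => horth p (subset_closure hp)
  -- The part of `D` with frequencies in `S`. Finiteness of `S` makes it a polynomial, orthogonal to
  -- `g`, and `D` minus this part has no negative frequency.
  set xq : ℤ →₀ (Fin T → ℂ) := ∑ n ∈ hS.toFinset, Finsupp.single n (vcoef D.fn n) with hxq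
  have hxqv : ∀ n, xq n = if n ∈ S then vcoef D.fn n else 0 := fun n => by
    rw [hxq, Finsupp.finsetSum_apply]
    simp [Finsupp.single_apply]
  have hxqs : (xq.support : Set ℤ) ⊆ unobserved S := fun n hn => by
    have : xq n ≠ 0 := by simpa using hn
    rw [hxqv] at this
    exact Or.inl (by by_contra h; simp [h] at this)
  have hgD : Integrable (fun t => g t ⬝ᵥ star (D.fn t)) freq := d.integrable_dotProduct hgm D.memL2
  have hgq : Integrable (fun t => g t ⬝ᵥ star (trigPoly xq t)) freq :=
    d.integrable_dotProduct hgm (d.right.memL2_trigPoly xq)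
  have hq0 : ∫ t, g t ⬝ᵥ star (trigPoly xq t) ∂freq = 0 := by
    rw [← mean_eq_zero_iff, mean_dotProduct_star_trigPoly hgi, pairing_eq_zero hg0 hxqs]
  have hstar : ∀ {f : ℝ → ℂ}, Integrable f freq → Integrable (fun t => star (f t)) freq :=
    fun hf => (LinearIsometryEquiv.integrable_comp_iff (μ := freq) Complex.conjLIE).2 hf
  have hpt : ∀ t, star (g t) ⬝ᵥ (D.fn t - trigPoly xq t) =
      star (g t ⬝ᵥ star (D.fn t)) - star (g t ⬝ᵥ star (trigPoly xq t)) := fun t => by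
    rw [dotProduct_sub, ← star_dotProduct_star, ← star_dotProduct_star, star_star, star_star,
      dotProduct_comm, dotProduct_comm (trigPoly xq t)]
  -- `g` has no frequency `≥ 0`, so its conjugate has none `≤ 0`; this strict inequality is what the
  -- Smirnov type theorem needs.
  have hzero : ∫ t, star (g t) ⬝ᵥ (D.fn t - trigPoly xq t) ∂freq = 0 := by
    refine integral_dotProduct_eq_zero (fun i => hstar (hgi i)) (fun i => ?_) (fun i n hn => ?_)
      (fun i n hn => ?_) ?_
    · exact (hDi i).sub (d.symm.integrable_apply (d.right.memL2_trigPoly xq) i)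
    · have h1 := congrFun (hg0 (-n) (Or.inr (by simpa using hn))) i
      have h2 := coef_star (fun t => g t i) n
      rw [show coef (fun t => g t i) (-n) = 0 from h1, star_zero] at h2
      exact h2
    · have h1 := coef_sub (hDi i) (d.symm.integrable_apply (d.right.memL2_trigPoly xq) i) n
      rw [coef_trigPoly, hxqv] at h1
      refine h1.trans ?_
      split_ifs with h
      · exact sub_self _
      · rw [show coef (fun t => D.fn t i) n = 0 from congrFun (hD0 n ⟨hn, h⟩) i]; simp
    · simp only [hpt]
      exact (hstar hgD).sub (hstar hgq)
  have hgD0 : ∫ t, g t ⬝ᵥ star (D.fn t) ∂freq = 0 := by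
    simp only [hpt] at hzero
    rw [integral_sub (hstar hgD) (hstar hgq)] at hzero
    simp only [Complex.star_def, integral_conj, hq0, map_zero, sub_zero] at hzero
    simpa using hzero
  have hn : ‖D‖ = 0 := by
    rw [← sq_eq_zero_iff, norm_sq_eq_re_inner (𝕜 := ℂ), WeightedL2.inner_def]
    simp only [sesq_eq_vecMul_dotProduct]
    rw [hgD0]; simp
  -- In a seminormed space norm zero gives only inseparability, which suffices for membership in a
  -- closed set.
  have hins : Inseparable C C' := by
    rw [Metric.inseparable_iff, dist_eq_norm, hn]
  exact (hins.mem_closed_iff isClosed_closure).2 hC'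

end DualWeights

end density

/-! ### The functional and the operators in terms of functions of the frequency -/

section operators

variable {T : ℕ} {S : Set ℤ} {a : ℤ → Fin T → ℂ}

lemma norm_apply_le_sum (v : Fin T → ℂ) (i : Fin T) : ‖v i‖ ≤ ∑ k, ‖v k‖ :=
  Finset.single_le_sum (f := fun k => ‖v k‖) (fun _ _ => norm_nonneg _) (Finset.mem_univ i)

lemma norm_le_sum (v : Fin T → ℂ) : ‖v‖ ≤ ∑ k, ‖v k‖ :=
  (pi_norm_le_iff_of_nonneg (Finset.sum_nonneg fun _ _ => norm_nonneg _)).2 (norm_apply_le_sum v)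

variable (ha : Summable fun j : weightIndex S => ∑ k, ‖a j k‖)
include ha

lemma summable_norm_a : Summable fun j : weightIndex S => ‖a j‖ :=
  Summable.of_nonneg_of_le (fun _ => norm_nonneg _) (fun j => norm_le_sum (a j)) ha

lemma hasSum_symbolA (t : ℝ) :
    HasSum (fun j : weightIndex S => expi (-(j : ℤ)) t • a j) (symbolA S a t) := by
  refine Summable.hasSum (Summable.of_norm ?_)
  simp only [norm_smul, norm_expi, one_mul]
  exact summable_norm_a ha

lemma continuous_symbolA : Continuous (symbolA S a) := by
  refine continuous_tsum (u := fun j : weightIndex S => ‖a j‖)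
    (fun j => (continuous_expi _).smul continuous_const) (summable_norm_a ha) fun j t => ?_
  rw [norm_smul, norm_expi, one_mul]

lemma norm_symbolA_apply_le (t : ℝ) (i : Fin T) :
    ‖symbolA S a t i‖ ≤ ∑' j : weightIndex S, ‖a j‖ := by
  refine (norm_le_pi_norm _ i).trans ?_
  refine (norm_tsum_le_tsum_norm ?_).trans (le_of_eq ?_)
  · simp only [norm_smul, norm_expi, one_mul]
    exact summable_norm_a ha
  · simp only [norm_smul, norm_expi, one_mul]

/-- Termwise integration of the series defining the functional. -/
lemma hasSum_mean_symbolA {φ : VecFn T} (hφ : ∀ i, Integrable (fun t => φ t i) freq) :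
    HasSum (fun j : weightIndex S => mean fun t => expi (-(j : ℤ)) t * (a j ⬝ᵥ φ t))
      (mean fun t => symbolA S a t ⬝ᵥ φ t) := by
  have hd : ∀ v : Fin T → ℂ, Integrable (fun t => v ⬝ᵥ φ t) freq := fun v =>
    integrable_finsetSum _ fun i _ => (hφ i).const_mul _
  have hI : Integrable (fun t => ∑ i, ‖φ t i‖) freq := integrable_finsetSum _ fun i _ => (hφ i).norm
  have h := hasSum_integral_of_summable_integral_norm (μ := freq)
    (F := fun (j : weightIndex S) t => expi (-(j : ℤ)) t * (a j ⬝ᵥ φ t))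
    (fun j => (hd (a j)).bdd_mul (c := 1) (continuous_expi _).aestronglyMeasurable
      (Eventually.of_forall fun t => by simp)) ?_
  · have h2 : ∀ t, ∑' j : weightIndex S, expi (-(j : ℤ)) t * (a j ⬝ᵥ φ t) =
        symbolA S a t ⬝ᵥ φ t := fun t => by
      have h3 := hasSum_symbolA ha t
      have h4 := hasSum_sum (s := Finset.univ) fun i _ =>
        ((Pi.hasSum.1 h3 i).mul_right (φ t i))
      refine HasSum.tsum_eq (h4.congr_fun ?_)
      intro j
      simp [dotProduct, Finset.mul_sum, mul_assoc]
    simp only [h2] at h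
    exact h.const_smul _
  · refine Summable.of_nonneg_of_le (fun _ => integral_nonneg fun t => norm_nonneg _) (fun j => ?_)
      ((summable_norm_a ha).mul_right (∫ t, ∑ i, ‖φ t i‖ ∂freq))
    rw [← integral_const_mul]
    refine integral_mono_of_nonneg (Eventually.of_forall fun t => norm_nonneg _)
      (hI.const_mul _) (Eventually.of_forall fun t => ?_)
    change ‖expi _ t * (a j ⬝ᵥ φ t)‖ ≤ ‖a j‖ * ∑ i, ‖φ t i‖
    rw [norm_mul, norm_expi, one_mul, dotProduct, Finset.mul_sum]
    refine (norm_sum_le _ _).trans (Finset.sum_le_sum fun i _ => ?_)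
    rw [norm_mul]
    exact mul_le_mul_of_nonneg_right (norm_le_pi_norm _ i) (norm_nonneg _)

omit ha

variable {F G : MatFn T}

/-- The function `Aᵀ F (F + G)⁻¹`. -/
noncomputable def filterFn (A : VecFn T) (F G : MatFn T) : VecFn T :=
  fun t => A t ᵥ* F t ᵥ* (F t + G t)⁻¹

lemma dualWeights_of_minimality (hF : IsSpectralDensity F) (hG : IsSpectralDensity G)
    (h : Minimality F G) : DualWeights (F + G) fun t => (F t + G t)⁻¹ where
  left := hF.add hG
  right := ⟨h.2, by
    filter_upwards [(hF.add hG).posSemidef] with t ht using ht.inv⟩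
  mul_eq_one := by
    filter_upwards [h.1] with t ht using mul_nonsing_inv _ ht

variable (hF : IsSpectralDensity F) (hG : IsSpectralDensity G)
  (d : DualWeights (F + G) fun t => (F t + G t)⁻¹)

include d in
lemma applyB_eq_vcoef (x : ℤ →₀ (Fin T → ℂ)) :
    applyB F G x = vcoef fun t => trigPoly x t ᵥ* (F t + G t)⁻¹ := by
  ext k i
  have hi := fun l => d.right.integrable l i
  simp only [applyB, vcoef, vecMul, dotProduct, Finsupp.sum, Finset.sum_apply, blockB, fourierMat,
    of_apply, trigPoly_apply, Finset.sum_mul]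
  have h1 : ∀ l, Integrable (fun t => ∑ n ∈ x.support, expi n t * x n l * (F t + G t)⁻¹ l i)
      freq := fun l => integrable_finsetSum _ fun n _ => by
    have := (integrable_mul_expi (hi l) n).const_mul (x n l)
    exact this.congr (Eventually.of_forall fun t => by simp only; ring)
  rw [coef_finset_sum _ fun l _ => h1 l, Finset.sum_comm]
  refine Finset.sum_congr rfl fun l _ => ?_
  rw [coef_finset_sum]
  · refine Finset.sum_congr rfl fun n _ => ?_
    have : (fun t => expi n t * x n l * (F t + G t)⁻¹ l i) =
        fun t => x n l * (expi n t * (F t + G t)⁻¹ l i) := by ext t; ring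
    rw [this, coef_const_mul, coef_expi_mul]
    rfl
  · intro n _
    have := (integrable_mul_expi (hi l) n).const_mul (x n l)
    exact this.congr (Eventually.of_forall fun t => by simp only; ring)

/-- This identifies the energy completion for `B` with a closed subspace of `L₂((F + G)⁻¹)`. -/
lemma pairing_applyB (x : ℤ →₀ (Fin T → ℂ)) :
    pairing (applyB F G x) x = ((2 * Real.pi)⁻¹ * ‖WeightedL2.poly d.right x‖ ^ 2 : ℝ) := by
  have h1 := WeightedL2.inner_poly x (WeightedL2.poly d.right x)
  have h2 : (Real.pi : ℂ) ≠ 0 := by exact_mod_cast Real.pi_ne_zero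
  rw [inner_self_eq_norm_sq_to_K] at h1
  rw [applyB_eq_vcoef d]
  simp only [WeightedL2.poly, WeightedL2.fn_mk] at h1 ⊢
  push_cast
  rw [eq_inv_mul_iff_mul_eq₀ (by simp [h2]), ← h1]
  rfl

include hG in
lemma posSemidef_add_sub : ∀ᵐ t ∂freq, ((F + G) t - F t).PosSemidef := by
  filter_upwards [hG.posSemidef] with t ht
  simpa using ht

-- Although `A` is only assumed to lie in `L₂(F)`, the inequality `F (F + G)⁻¹ F ≤ F` bounds the
-- norm of `Aᵀ F (F + G)⁻¹` in `L₂(F + G)` by that of `A` in `L₂(F)`.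
include hF hG d in
lemma memL2_filterFn {A : VecFn T} (hA : MemL2 F A) : MemL2 (F + G) (filterFn A F G) := by
  have hm : AEStronglyMeasurable (filterFn A F G) freq :=
    aestronglyMeasurable_vecMul (aestronglyMeasurable_vecMul hA.1 hF.aestronglyMeasurable_apply)
      d.right.aestronglyMeasurable_apply
  refine ⟨hm, Integrable.mono' hA.2 (d.left.aestronglyMeasurable_quad hm) ?_⟩
  filter_upwards [hF.posSemidef, d.left.posSemidef, posSemidef_add_sub (F := F) hG, d.mul_eq_one]
    with t h1 h2 h3 h4
  rw [Real.norm_of_nonneg (quad_nonneg h2 _)]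
  exact quad_vecMul_le h1 h2 h3 h4 _

include d in
lemma filterFn_vecMul (A : VecFn T) :
    (fun t => filterFn A F G t ᵥ* (F + G) t) =ᵐ[freq] fun t => A t ᵥ* F t := by
  filter_upwards [d.symm.mul_eq_one] with t ht
  simp only [filterFn]
  rw [vecMul_vecMul _ (F t + G t)⁻¹, ht, vecMul_one]

include hF hG d in
lemma memL2_vecMul_density {A : VecFn T} (hA : MemL2 F A) :
    MemL2 (fun t => (F t + G t)⁻¹) fun t => A t ᵥ* F t :=
  (d.memL2_vecMul (memL2_filterFn hF hG d hA)).congr_ae (filterFn_vecMul d A)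

lemma memL2_const (hF : IsSpectralDensity F) (v : Fin T → ℂ) : MemL2 F fun _ => v :=
  hF.memL2_of_bound aestronglyMeasurable_const
    (Eventually.of_forall fun _ i => norm_le_pi_norm v i)

include hF hG d in
lemma integrable_mul_inv (i j : Fin T) :
    Integrable (fun t => (F t * (F t + G t)⁻¹) i j) freq := by
  have := d.integrable_apply (memL2_filterFn hF hG d (memL2_const hF (Pi.single i 1))) j
  refine this.congr (Eventually.of_forall fun t => ?_)
  simp only [filterFn, single_one_vecMul]
  rfl

include hF hG d in
lemma integrable_mul_inv_mul (i j : Fin T) :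
    Integrable (fun t => (F t * (F t + G t)⁻¹ * G t) i j) freq := by
  have h1 := (memL2_vecMul_density hF hG d (memL2_const hF (Pi.single i 1))).integrable_sesq
    d.right (memL2_vecMul_density hF hG d (memL2_const hF (Pi.single j 1)))
  refine ((hF.integrable i j).sub h1).congr ?_
  filter_upwards [d.symm.mul_eq_one, hF.posSemidef] with t h2 h3
  -- This symmetric form expresses the entries through inner products of elements of `L₂((F +
  -- G)⁻¹)`.
  have h4 : F t * (F t + G t)⁻¹ * G t = F t - F t * (F t + G t)⁻¹ * F t := by
    have : F t * (F t + G t)⁻¹ * (F t + G t) = F t := by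
      rw [Matrix.mul_assoc]; erw [h2]; rw [mul_one]
    rw [eq_sub_iff_add_eq, ← Matrix.mul_add, add_comm (G t), this]
  rw [h4]
  simp only [Pi.sub_apply, sesq, star_vecMul, h3.1.eq, Matrix.sub_apply]
  congr 1
  rw [← Pi.single_star, star_one, mulVec_mulVec, dotProduct_mulVec,
    dotProduct_single_one, vecMul_vecMul, single_one_vecMul, ← Matrix.mul_assoc]
  rfl

include ha hF hG d in
lemma applyR_eq_vcoef : applyR S a F G = vcoef (filterFn (symbolA S a) F G) := by
  ext k i
  have h : HasSum (fun j : weightIndex S => a j ᵥ* blockR F G k j)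
      (vcoef (filterFn (symbolA S a) F G) k) := by
    refine Pi.hasSum.2 fun i => ?_
    have h1 := hasSum_mean_symbolA ha
      (φ := fun t l => (F t * (F t + G t)⁻¹) l i * expi (-k) t)
      fun l => integrable_mul_expi (integrable_mul_inv hF hG d l i) _
    convert! h1 using 1
    · ext j
      simp only [vecMul, dotProduct, blockR, fourierMat, of_apply, Finset.mul_sum]
      rw [mean_finset_sum]
      · refine Finset.sum_congr rfl fun l _ => ?_
        rw [← mean_const_mul]
        congr 1; ext t
        rw [neg_add, expi_add]; ring
      · intro l _
        have := (integrable_mul_expi (integrable_mul_inv hF hG d l i) (-k + -j)).const_mul (a j l)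
        refine this.congr (Eventually.of_forall fun t => ?_)
        simp only [expi_add]; ring
    · simp only [vcoef, coef, filterFn, vecMul_vecMul]
      congr 1; ext t
      simp only [vecMul, dotProduct, Finset.sum_mul, mul_assoc]
  rw [applyR, h.tsum_eq]

include ha hF hG d in
lemma formQ_eq_mean : formQ S a F G = (mean fun t => symbolA S a t ⬝ᵥ
    ((F t * (F t + G t)⁻¹ * G t) *ᵥ star (symbolA S a t))).re := by
  have hA := continuous_symbolA ha
  have hAi : ∀ i, Continuous fun t => symbolA S a t i := fun i => (continuous_apply i).comp hA
  have hQ := integrable_mul_inv_mul hF hG d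
  set Q : MatFn T := fun t => F t * (F t + G t)⁻¹ * G t with hQdef
  have hφ : ∀ i, Integrable (fun t => (Q t *ᵥ star (symbolA S a t)) i) freq := fun i => by
    simp only [mulVec, dotProduct, Pi.star_apply]
    exact integrable_finsetSum _ fun j _ => (hQ i j).mul_bdd
      (c := ∑' j : weightIndex S, ‖a j‖) (hAi j).star.aestronglyMeasurable
      (Eventually.of_forall fun t => by rw [norm_star]; exact norm_symbolA_apply_le ha t j)
  have h1 := hasSum_mean_symbolA ha hφ
  rw [formQ, ← h1.tsum_eq]
  congr 1
  refine tsum_congr fun k => ?_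
  -- Termwise integration is linear in `A`, so the second, conjugated copy of `A` is expanded in the
  -- conjugate expression and conjugated back.
  have hψ : ∀ i, Integrable (fun t => (expi k t • star (a k ᵥ* Q t)) i) freq := fun i => by
    have h2 : Integrable (fun t => (a k ᵥ* Q t) i) freq := by
      simp only [vecMul, dotProduct]
      exact integrable_finsetSum _ fun j _ => (hQ j i).const_mul _
    have h3 : Integrable (fun t => star ((a k ᵥ* Q t) i)) freq :=
      (LinearIsometryEquiv.integrable_comp_iff (μ := freq) Complex.conjLIE).2 h2
    refine (integrable_mul_expi h3 k).congr (Eventually.of_forall fun t => ?_)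
    simp [mul_comm]
  have h2 := (hasSum_mean_symbolA ha hψ).star
  rw [← mean_star] at h2
  have h3 : (fun t => star (symbolA S a t ⬝ᵥ (expi k t • star (a k ᵥ* Q t)))) =
      fun t => expi (-k) t * (a k ⬝ᵥ (Q t *ᵥ star (symbolA S a t))) := by
    ext t
    rw [dotProduct_smul, smul_eq_mul, star_mul', star_expi, ← star_dotProduct_star, star_star,
      dotProduct_mulVec]
  rw [h3] at h2
  rw [← h2.tsum_eq]
  refine tsum_congr fun j => ?_
  rw [← mean_star]
  have h4 : ∀ t, star (expi (-j) t * (a j ⬝ᵥ (expi k t • star (a k ᵥ* Q t)))) =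
      ∑ l, ∑ i, (a k i * star (a j l)) * (Q t i l * expi (-(k - j)) t) := fun t => by
    rw [dotProduct_smul, smul_eq_mul, star_mul', star_mul', star_expi, star_expi,
      ← star_dotProduct_star, star_star, neg_neg, neg_sub, sub_eq_add_neg, expi_add]
    simp only [dotProduct, vecMul, Finset.mul_sum, Finset.sum_mul, Pi.star_apply]
    exact Finset.sum_congr rfl fun l _ => Finset.sum_congr rfl fun i _ => by ring
  simp only [h4]
  have h5 : ∀ l i, Integrable (fun t => (a k i * star (a j l)) * (Q t i l * expi (-(k - j)) t))
      freq := fun l i => (integrable_mul_expi (hQ i l) _).const_mul _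
  rw [mean_finset_sum _ fun l _ => integrable_finsetSum _ fun i _ => h5 l i]
  simp only [dotProduct, mulVec, blockQ, fourierMat, of_apply, Finset.mul_sum]
  rw [Finset.sum_comm]
  refine Finset.sum_congr rfl fun l _ => ?_
  rw [mean_finset_sum _ fun i _ => h5 l i]
  refine Finset.sum_congr rfl fun i _ => ?_
  rw [mean_const_mul, Pi.star_apply]
  ring

end operators

/-! ### The optimal estimate -/

lemma notMem_unobserved_iff {S : Set ℤ} {n : ℤ} : n ∉ unobserved S ↔ n ∈ observed S := by
  simp only [unobserved, observed, Set.mem_union, Set.mem_ofPred_eq, not_or, not_le]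
  tauto

section optimal

variable {T : ℕ} {S : Set ℤ} {a : ℤ → Fin T → ℂ} {F G : MatFn T}

lemma MemL2.of_add_left (hF : IsSpectralDensity F) (hG : IsSpectralDensity G) {h : VecFn T}
    (hh : MemL2 (F + G) h) : MemL2 F h := by
  refine ⟨hh.1, Integrable.mono' hh.2 (hF.aestronglyMeasurable_quad hh.1) ?_⟩
  filter_upwards [hF.posSemidef, hG.posSemidef] with t h1 h2
  rw [Real.norm_of_nonneg (quad_nonneg h1 _), Pi.add_apply, quad_add_mat]
  linarith [quad_nonneg h2 (h t)]

lemma MemL2.of_add_right (hF : IsSpectralDensity F) (hG : IsSpectralDensity G) {h : VecFn T}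
    (hh : MemL2 (F + G) h) : MemL2 G h := by
  rw [add_comm] at hh
  exact hh.of_add_left hG hF

lemma memL2_symbolA (ha : Summable fun j : weightIndex S => ∑ k, ‖a j k‖) {K : MatFn T}
    (hK : IsSpectralDensity K) : MemL2 K (symbolA S a) :=
  hK.memL2_of_bound (continuous_symbolA ha).aestronglyMeasurable
    (Eventually.of_forall fun t i => norm_symbolA_apply_le ha t i)

lemma mse_nonneg (hF : IsSpectralDensity F) (hG : IsSpectralDensity G) (h : VecFn T) :
    0 ≤ mse S a h F G :=
  add_nonneg (mean_nonneg (hF.quad_nonneg fun t => symbolA S a t - h t))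
    (mean_nonneg (hG.quad_nonneg h))

variable (ha : Summable fun j : weightIndex S => ∑ k, ‖a j k‖)
  (hF : IsSpectralDensity F) (hG : IsSpectralDensity G)
  (d : DualWeights (F + G) fun t => (F t + G t)⁻¹)

include ha hF hG d

/-- Completing the square in `h`. The cross term is `Aᵀ F h̄`, which is the `F + G` form of
`filterFn` against `h`, and the remainder is `Aᵀ F (F + G)⁻¹ G Ā`. -/
lemma mse_eq {h : VecFn T} (hh : MemL2 (F + G) h) : mse S a h F G = formQ S a F G +
    mean fun t => quad ((F + G) t) (filterFn (symbolA S a) F G t - h t) := by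
  have hA : MemL2 F (symbolA S a) := memL2_symbolA ha hF
  have hf0 := memL2_filterFn hF hG d hA
  have hid : ∀ᵐ t ∂freq, symbolA S a t ⬝ᵥ ((F t * (F t + G t)⁻¹ * G t) *ᵥ star (symbolA S a t)) =
      sesq (F t) (symbolA S a t) (symbolA S a t) - sesq ((F + G) t)
        (filterFn (symbolA S a) F G t) (filterFn (symbolA S a) F G t) := by
    filter_upwards [d.symm.mul_eq_one, filterFn_vecMul d (symbolA S a), d.right.posSemidef,
      hF.posSemidef] with t h1 h2 h3 h4
    have h5 : F t * (F t + G t)⁻¹ * G t = F t - F t * (F t + G t)⁻¹ * F t := by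
      have : F t * (F t + G t)⁻¹ * (F t + G t) = F t := by
        rw [Matrix.mul_assoc]; erw [h1]; rw [mul_one]
      rw [eq_sub_iff_add_eq, ← Matrix.mul_add, add_comm (G t), this]
    rw [sesq_eq_vecMul_dotProduct (K := (F + G) t), h2, h5, sub_mulVec, dotProduct_sub, sesq,
      filterFn, star_vecMul, star_vecMul, h3.1.eq, h4.1.eq, mulVec_mulVec,
      dotProduct_mulVec (symbolA S a t ᵥ* F t), vecMul_vecMul, ← Matrix.mul_assoc,
      ← dotProduct_mulVec]
  have hint : Integrable (fun t => sesq (F t) (symbolA S a t) (symbolA S a t) - sesq ((F + G) t)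
      (filterFn (symbolA S a) F G t) (filterFn (symbolA S a) F G t)) freq :=
    (hA.integrable_sesq hF hA).sub (hf0.integrable_sesq d.left hf0)
  have hi1 : Integrable (fun t => quad (F t) (symbolA S a t - h t)) freq :=
    (hA.sub hF (hh.of_add_left hF hG)).2
  have hi2 : Integrable (fun t => quad ((F + G) t) (filterFn (symbolA S a) F G t - h t)) freq :=
    (hf0.sub d.left hh).2
  have hi3 : Integrable (fun t => (sesq (F t) (symbolA S a t) (symbolA S a t) - sesq ((F + G) t)
      (filterFn (symbolA S a) F G t) (filterFn (symbolA S a) F G t)).re) freq := hint.re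
  rw [formQ_eq_mean ha hF hG d, mean_congr_ae hid, ← mean_re hint, mse,
    ← mean_add hi1 (hh.of_add_right hF hG).2, ← mean_add hi3 hi2]
  apply mean_congr_ae
  filter_upwards [filterFn_vecMul d (symbolA S a), hF.posSemidef, d.left.posSemidef]
    with t h1 h2 h3
  have h4 : sesq ((F + G) t) (filterFn (symbolA S a) F G t) (h t) =
      sesq (F t) (symbolA S a t) (h t) := by
    rw [sesq_eq_vecMul_dotProduct, h1, sesq_eq_vecMul_dotProduct]
  rw [quad_sub h2.1, quad_sub h3.1, h4, Pi.add_apply, quad_add_mat (F t) (G t) (h t),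
    Complex.sub_re, ← quad_eq_re_sesq, ← quad_eq_re_sesq]
  ring

omit ha hF hG in
/-- `h` is the optimal spectral characteristic and `C` is the function `Aᵀ F - hᵀ (F + G)`. -/
structure IsOptimal (S : Set ℤ) (a : ℤ → Fin T → ℂ) (h : WeightedL2 d.left)
    (C : WeightedL2 d.right) : Prop where
  mem : h ∈ closure (WeightedL2.trigSubmodule d.left (observed S) : Set (WeightedL2 d.left))
  mem_unobserved :
    C ∈ closure (WeightedL2.trigSubmodule d.right (unobserved S) : Set (WeightedL2 d.right))
  eq : ∀ᵐ t ∂freq, C.fn t = symbolA S a t ᵥ* F t - h.fn t ᵥ* (F t + G t)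

/-- `h` is the projection of `filterFn` onto the observed span. The normal equations say that the
residual multiplied by `F + G` has no observed frequency, and the density theorem then puts it in
the unobserved span. -/
lemma exists_isOptimal (hS : S.Finite) : ∃ h C, IsOptimal d S a h C := by
  have := d.completeSpace
  have hA : MemL2 F (symbolA S a) := memL2_symbolA ha hF
  set f₀ : WeightedL2 d.left := WeightedL2.mk d.left _ (memL2_filterFn hF hG d hA) with hf₀
  obtain ⟨h, hh, horth⟩ := exists_mem_closure_inner_eq_zero
    (WeightedL2.trigSubmodule d.left (observed S)) f₀
  set C : WeightedL2 d.right := WeightedL2.mk d.right _ (d.memL2_vecMul (f₀ - h).memL2) with hC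
  refine ⟨h, C, hh, d.mem_closure_of_vcoef hS ?_, ?_⟩
  · exact WeightedL2.inner_trigSubmodule_eq_zero_iff.1 fun p hp => horth p (subset_closure hp)
  · filter_upwards [filterFn_vecMul d (symbolA S a)] with t ht
    rw [← ht]
    exact sub_vecMul ((F + G) t) (filterFn (symbolA S a) F G t) (h.fn t)

variable {d}
variable {h : WeightedL2 d.left} {C : WeightedL2 d.right}

omit ha hF hG in
lemma IsOptimal.vecMul_ae (o : IsOptimal d S a h C) : (fun t => C.fn t ᵥ* (F t + G t)⁻¹) =ᵐ[freq]
    filterFn (symbolA S a) F G - h.fn := by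
  filter_upwards [o.eq, d.vecMul_vecMul h.fn] with t h1 h2
  rw [h1, sub_vecMul]
  erw [h2]
  rfl

omit ha hF hG in
lemma IsOptimal.isGivenByFormula_iff (o : IsOptimal d S a h C) {g : VecFn T} :
    IsGivenByFormula S a F G C.fn g ↔ g =ᵐ[freq] h.fn := by
  have h1 := o.vecMul_ae
  simp only [IsGivenByFormula]
  constructor <;> intro H <;> filter_upwards [H, h1] with t h2 h3
  · rw [h2, h3, Pi.sub_apply, filterFn, vecMul_vecMul]; simp
  · rw [h2, h3, Pi.sub_apply, filterFn, vecMul_vecMul]; simp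

omit ha hF hG in
lemma IsOptimal.vcoef_eq_zero (o : IsOptimal d S a h C) {n : ℤ} (hn : n ∈ unobserved S) :
    vcoef h.fn n = 0 :=
  d.vcoef_eq_zero_of_mem_closure o.mem fun h' => notMem_unobserved_iff.2 h' hn

omit ha hF hG in
lemma IsOptimal.vcoef_C_eq_zero (o : IsOptimal d S a h C) {n : ℤ} (hn : n ∈ observed S) :
    vcoef C.fn n = 0 :=
  d.symm.vcoef_eq_zero_of_mem_closure o.mem_unobserved (notMem_unobserved_iff.2 hn)

/-- Pythagoras in `L₂(F + G)`: the residual `f₀ - h` is orthogonal to `h - g`, and its norm equals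
that of `C` in the dual space. -/
lemma IsOptimal.mean_quad_sub (o : IsOptimal d S a h C) {g : WeightedL2 d.left}
    (hg : g ∈ closure (WeightedL2.trigSubmodule d.left (observed S) : Set (WeightedL2 d.left))) :
    mean (fun t => quad ((F + G) t) (filterFn (symbolA S a) F G t - g.fn t)) =
      mean (fun t => quad ((F t + G t)⁻¹) (C.fn t)) +
        mean (fun t => quad ((F + G) t) (h.fn t - g.fn t)) := by
  have hA : MemL2 F (symbolA S a) := memL2_symbolA ha hF
  set f₀ : WeightedL2 d.left := WeightedL2.mk d.left _ (memL2_filterFn hF hG d hA) with hf₀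
  set P := WeightedL2.trigSubmodule d.left (observed S)
  have hmem : h - g ∈ P.topologicalClosure := P.topologicalClosure.sub_mem o.mem hg
  have hCK : (fun t => (f₀ - h).fn t ᵥ* (F + G) t) =ᵐ[freq] C.fn := by
    filter_upwards [o.eq, filterFn_vecMul d (symbolA S a)] with t h1 h2
    rw [h1, ← h2]
    exact sub_vecMul ((F + G) t) (filterFn (symbolA S a) F G t) (h.fn t)
  have horth : inner ℂ (h - g) (f₀ - h) = 0 := by
    refine WeightedL2.inner_eq_zero_of_mem_closure
      (WeightedL2.inner_trigSubmodule_eq_zero_iff.2 fun n hn => ?_) hmem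
    rw [vcoef_congr_ae hCK, o.vcoef_C_eq_zero hn]
  have hpyth : ‖f₀ - g‖ ^ 2 = ‖f₀ - h‖ ^ 2 + ‖h - g‖ ^ 2 := by
    have := norm_add_sq_eq_norm_sq_add_norm_sq_of_inner_eq_zero (h - g) (f₀ - h) horth
    rw [show h - g + (f₀ - h) = f₀ - g by abel] at this
    nlinarith
  have hfh : ∫ t, quad ((F + G) t) ((f₀ - h).fn t) ∂freq =
      ∫ t, quad ((F t + G t)⁻¹) (C.fn t) ∂freq := by
    rw [← d.integral_quad_vecMul]
    exact integral_congr_ae (hCK.mono fun t ht => by simp only [ht])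
  rw [WeightedL2.norm_sq, WeightedL2.norm_sq, WeightedL2.norm_sq, hfh] at hpyth
  simp only [mean, ← smul_add]
  congr 1

/-- The excess of the mean-square error over the optimal one. -/
lemma IsOptimal.mse_eq (o : IsOptimal d S a h C) {g : VecFn T} (hg : MemL2s S (F + G) g) :
    mse S a g F G = formQ S a F G + mean (fun t => quad ((F t + G t)⁻¹) (C.fn t)) +
      mean (fun t => quad ((F + G) t) (h.fn t - g t)) := by
  obtain ⟨hg1, hg2⟩ := (WeightedL2.memL2s_iff (hK := d.left)).1 hg
  rw [MinimaxFiltering.mse_eq ha hF hG d hg1, add_assoc]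
  have key := o.mean_quad_sub ha hF hG hg2
  simp only [WeightedL2.fn_mk] at key
  rw [key]

omit ha hF hG in
lemma IsOptimal.memL2s (o : IsOptimal d S a h C) : MemL2s S (F + G) h.fn :=
  WeightedL2.memL2s_iff.2 ⟨h.memL2, o.mem⟩

lemma IsOptimal.mse_self (o : IsOptimal d S a h C) : mse S a h.fn F G =
    formQ S a F G + mean (fun t => quad ((F t + G t)⁻¹) (C.fn t)) := by
  rw [o.mse_eq ha hF hG o.memL2s]
  simp [mean, quad_zero]

omit ha d in
lemma optimalError_le {g : VecFn T} (hg : MemL2s S (F + G) g) :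
    optimalError S a F G ≤ mse S a g F G :=
  csInf_le ⟨0, by rintro _ ⟨g, -, rfl⟩; exact mse_nonneg hF hG g⟩ ⟨g, hg, rfl⟩

lemma IsOptimal.optimalError_eq (o : IsOptimal d S a h C) :
    optimalError S a F G = mse S a h.fn F G := by
  refine le_antisymm (optimalError_le hF hG o.memL2s) ?_
  refine le_csInf ⟨_, h.fn, o.memL2s, rfl⟩ ?_
  rintro _ ⟨g, hg, rfl⟩
  rw [o.mse_eq ha hF hG hg, o.mse_self ha hF hG]
  have := mean_nonneg (d.left.quad_nonneg fun t => h.fn t - g t)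
  linarith

lemma IsOptimal.ae_eq_of_mse_le (o : IsOptimal d S a h C) {g : VecFn T}
    (hg : MemL2s S (F + G) g) (hle : mse S a g F G ≤ mse S a h.fn F G) : g =ᵐ[freq] h.fn := by
  rw [o.mse_eq ha hF hG hg, o.mse_self ha hF hG] at hle
  have h0 := mean_nonneg (d.left.quad_nonneg fun t => h.fn t - g t)
  have h1 : mean (fun t => quad ((F + G) t) (h.fn t - g t)) = 0 := by linarith
  rw [mean_eq_zero_iff] at h1
  have h2 := d.ae_eq_zero_of_integral_quad (h.memL2.sub d.left hg.1) h1
  filter_upwards [h2] with t ht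
  exact (sub_eq_zero.1 ht).symm

omit ha hF hG in
lemma IsOptimal.isFourierSum (_o : IsOptimal d S a h C) : IsFourierSum (vcoef C.fn) C.fn :=
  ⟨d.symm.integrable_apply C.memL2, fun _ _ => rfl⟩

omit ha hF hG d in
lemma IsFourierSum.ae_eq {c : ℤ → Fin T → ℂ} {C C' : VecFn T} (h : IsFourierSum c C)
    (h' : IsFourierSum c C') : C =ᵐ[freq] C' := by
  have : ∀ᵐ t ∂freq, ∀ i, C t i = C' t i := by
    rw [ae_all_iff]
    exact fun i => ae_eq_of_coef_eq (h.1 i) (h'.1 i) fun n => (h.2 n i).trans (h'.2 n i).symm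
  exact this.mono fun t ht => funext ht

end optimal

/-! ### Identification of `C` with the inverse image of `R a` under `B` -/

section inverse

variable {T : ℕ} {S : Set ℤ} {a : ℤ → Fin T → ℂ} {F G : MatFn T}
  (ha : Summable fun j : weightIndex S => ∑ k, ‖a j k‖)
  (hF : IsSpectralDensity F) (hG : IsSpectralDensity G)
  {d : DualWeights (F + G) fun t => (F t + G t)⁻¹}
  {h : WeightedL2 d.left} {C : WeightedL2 d.right} (o : IsOptimal d S a h C)

include o

/-- The function `Aᵀ F` and `C` have the same inner products with the limits of trigonometric
polynomials with unobserved frequencies. -/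
lemma IsOptimal.inner_eq (hA : MemL2 (fun t => (F t + G t)⁻¹) fun t => symbolA S a t ᵥ* F t)
    {p : WeightedL2 d.right}
    (hp : p ∈ closure (WeightedL2.trigSubmodule d.right (unobserved S) :
      Set (WeightedL2 d.right))) :
    inner ℂ p (WeightedL2.mk d.right _ hA) = inner ℂ p C := by
  set y := WeightedL2.mk d.right _ hA with hy
  have hyC : (fun t => (y - C).fn t ᵥ* (F t + G t)⁻¹) =ᵐ[freq] h.fn := by
    filter_upwards [o.eq, d.vecMul_vecMul h.fn] with t h1 h2
    rw [WeightedL2.fn_sub, Pi.sub_apply, h1, hy, WeightedL2.fn_mk, sub_sub_cancel]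
    exact h2
  have : inner ℂ p (y - C) = 0 := by
    refine WeightedL2.inner_eq_zero_of_mem_closure
      (WeightedL2.inner_trigSubmodule_eq_zero_iff.2 fun n hn => ?_) hp
    rw [vcoef_congr_ae hyC, o.vcoef_eq_zero hn]
  rw [inner_sub_right, sub_eq_zero] at this
  exact this

include ha hF hG

lemma IsOptimal.pairing_applyR {x : ℤ →₀ (Fin T → ℂ)} (hx : (x.support : Set ℤ) ⊆ unobserved S) :
    (2 * Real.pi : ℂ) * pairing (applyR S a F G) x = inner ℂ (WeightedL2.poly d.right x) C := by
  have hA := memL2_vecMul_density hF hG d (memL2_symbolA ha hF)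
  rw [← o.inner_eq hA (subset_closure (WeightedL2.poly_mem hx)), WeightedL2.inner_poly,
    applyR_eq_vcoef ha hF hG d]
  rfl

lemma IsOptimal.applyR_eq {k : ℤ} (hk : k ∈ unobserved S) :
    applyR S a F G k = vcoef (fun t => C.fn t ᵥ* (F t + G t)⁻¹) k := by
  ext i
  have h2 : (2 * Real.pi : ℂ) ≠ 0 := by simp [Real.pi_ne_zero]
  have h1 := o.pairing_applyR ha hF hG (support_subset_single hk (Pi.single i 1))
  rw [WeightedL2.inner_poly, pairing_single, pairing_single] at h1
  exact mul_left_cancel₀ h2 h1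

/-- The value `⟨R a, B⁻¹ R a⟩`. -/
lemma IsOptimal.isInverseImage : IsInverseImage S F G (applyR S a F G) (vcoef C.fn)
    (mean fun t => quad ((F t + G t)⁻¹) (C.fn t) : ℝ) := by
  have h2 : (2 * Real.pi : ℂ) ≠ 0 := by simp [Real.pi_ne_zero]
  refine ⟨fun k hk => o.vcoef_C_eq_zero (notMem_unobserved_iff.1 hk), ?_⟩
  obtain ⟨x, hx, hlim⟩ := WeightedL2.exists_seq_poly o.mem_unobserved
  refine ⟨x, hx, ?_, fun k _ => ?_, fun k hk => ?_, ?_⟩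
  · simp only [pairing_applyB d]
    have h1 : Tendsto (fun p : ℕ × ℕ => WeightedL2.poly d.right (x p.1 - x p.2)) atTop (𝓝 0) := by
      have h3 := (hlim.comp tendsto_fst).sub (hlim.comp tendsto_snd)
      rw [sub_self, prod_atTop_atTop_eq] at h3
      refine h3.congr fun p => Subtype.ext (trigPoly_sub _ _).symm
    have h3 := ((h1.norm.pow 2).const_mul (2 * Real.pi)⁻¹)
    rw [norm_zero, zero_pow two_ne_zero, mul_zero] at h3
    exact_mod_cast (Complex.continuous_ofReal.tendsto 0).comp h3
  · rw [tendsto_pi_nhds]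
    intro i
    refine (d.symm.tendsto_coef hlim k i).congr fun n => ?_
    exact coef_trigPoly _ _ _
  · rw [o.applyR_eq ha hF hG hk, tendsto_pi_nhds]
    intro i
    have h3 : Tendsto (fun n => inner ℂ (WeightedL2.poly d.right (Finsupp.single k (Pi.single i 1)))
        (WeightedL2.poly d.right (x n))) atTop (𝓝 (inner ℂ
          (WeightedL2.poly d.right (Finsupp.single k (Pi.single i 1))) C)) :=
      tendsto_const_nhds.inner hlim
    simp only [WeightedL2.inner_poly, pairing_single] at h3
    have h4 := h3.const_mul (2 * Real.pi : ℂ)⁻¹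
    simp only [inv_mul_cancel_left₀ h2] at h4
    simp only [applyB_eq_vcoef d]
    exact h4
  · have h3 : Tendsto (fun n => inner ℂ (WeightedL2.poly d.right (x n)) C) atTop
        (𝓝 (inner ℂ C C)) := hlim.inner tendsto_const_nhds
    simp only [← o.pairing_applyR ha hF hG (hx _)] at h3
    have h4 := h3.const_mul (2 * Real.pi : ℂ)⁻¹
    simp only [inv_mul_cancel_left₀ h2] at h4
    convert h4 using 2
    rw [inner_self_eq_norm_sq_to_K]
    have h5 := WeightedL2.norm_sq C
    rw [mean, ← h5]
    simp

/-- `B⁻¹ R a` and `⟨R a, B⁻¹ R a⟩` are uniquely determined. -/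
lemma IsOptimal.eq_of_isInverseImage {c : ℤ → Fin T → ℂ} {v : ℂ}
    (hc : IsInverseImage S F G (applyR S a F G) c v) :
    c = vcoef C.fn ∧ v = (mean fun t => quad ((F t + G t)⁻¹) (C.fn t) : ℝ) := by
  have h2 : (2 * Real.pi : ℂ) ≠ 0 := by simp [Real.pi_ne_zero]
  obtain ⟨hc0, x, hx, hcau, hxc, hBx, hv⟩ := hc
  set U := WeightedL2.trigSubmodule d.right (unobserved S) with hU
  -- Cauchy for the energy norm means Cauchy in `L₂((F + G)⁻¹)`. The energy is a squared norm, hence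
  -- the square root.
  have hcau' : CauchySeq fun n => WeightedL2.poly d.right (x n) := by
    rw [cauchySeq_iff_tendsto_dist_atTop_0]
    simp only [pairing_applyB d] at hcau
    have h1 := (Complex.continuous_re.tendsto 0).comp hcau
    have h3 : Tendsto (fun p : ℕ × ℕ => ‖WeightedL2.poly d.right (x p.1 - x p.2)‖ ^ 2) atTop
        (𝓝 0) := by
      have h4 := h1.const_mul (2 * Real.pi)
      simp only [Function.comp_def, Complex.ofReal_re, Complex.zero_re, mul_zero] at h4
      refine h4.congr fun p => ?_
      have := Real.pi_ne_zero
      field_simp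
    have h4 := (Real.continuous_sqrt.tendsto 0).comp h3
    rw [Real.sqrt_zero] at h4
    refine h4.congr fun p => ?_
    rw [Function.comp_apply, Real.sqrt_sq (norm_nonneg _), dist_eq_norm]
    congr 1
    exact Subtype.ext (trigPoly_sub _ _)
  have := d.symm.completeSpace
  obtain ⟨C₁, hC₁⟩ := cauchySeq_tendsto_of_complete hcau'
  have hC₁mem : C₁ ∈ U.topologicalClosure := mem_closure_of_tendsto hC₁
    (Eventually.of_forall fun n => WeightedL2.poly_mem (hx n))
  have hcC₁ : c = vcoef C₁.fn := by
    ext1 k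
    by_cases hk : k ∈ unobserved S
    · refine tendsto_nhds_unique (hxc k hk) (tendsto_pi_nhds.2 fun i => ?_)
      refine (d.symm.tendsto_coef hC₁ k i).congr fun n => ?_
      exact coef_trigPoly _ _ _
    · rw [hc0 k hk]
      exact (d.symm.vcoef_eq_zero_of_mem_closure hC₁mem hk).symm
  -- Coordinatewise convergence of `B (x n)` is enough here, since it is tested against finitely
  -- supported sequences only. As `C₁ - C` lies in the closure of `U`, it is orthogonal to itself.
  have hinner : ∀ p ∈ U, inner ℂ p (C₁ - C) = 0 := by
    rintro p ⟨y, hy, hp⟩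
    have h1 : p = WeightedL2.poly d.right y := Subtype.ext hp
    have h3 : Tendsto (fun n => inner ℂ p (WeightedL2.poly d.right (x n))) atTop
        (𝓝 (inner ℂ p C₁)) := tendsto_const_nhds.inner hC₁
    have h4 : Tendsto (fun n => inner ℂ p (WeightedL2.poly d.right (x n))) atTop
        (𝓝 (inner ℂ p C)) := by
      rw [h1, ← o.pairing_applyR ha hF hG hy]
      simp only [WeightedL2.inner_poly]
      refine Tendsto.const_mul _ ?_
      simp only [pairing, Finsupp.sum]
      refine tendsto_finsetSum _ fun k hk => ?_
      have h5 := hBx k (hy hk)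
      simp only [applyB_eq_vcoef d] at h5
      simp only [dotProduct]
      exact tendsto_finsetSum _ fun i _ => ((tendsto_pi_nhds.1 h5 i).mul_const _)
    rw [inner_sub_right, tendsto_nhds_unique h3 h4, sub_self]
  have hn : ‖C₁ - C‖ = 0 := by
    have h1 := WeightedL2.inner_eq_zero_of_mem_closure hinner
      (U.topologicalClosure.sub_mem hC₁mem o.mem_unobserved)
    rw [inner_self_eq_norm_sq_to_K] at h1
    simpa using h1
  have hae : C₁.fn =ᵐ[freq] C.fn := by
    filter_upwards [d.symm.ae_eq_zero_of_norm hn] with t ht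
    exact sub_eq_zero.1 ht
  refine ⟨hcC₁.trans (funext fun n => vcoef_congr_ae hae n), ?_⟩
  have h3 : Tendsto (fun n => inner ℂ (WeightedL2.poly d.right (x n)) C) atTop
      (𝓝 (inner ℂ C₁ C)) := hC₁.inner tendsto_const_nhds
  simp only [← o.pairing_applyR ha hF hG (hx _)] at h3
  have h4 := h3.const_mul (2 * Real.pi : ℂ)⁻¹
  simp only [inv_mul_cancel_left₀ h2] at h4
  rw [tendsto_nhds_unique hv h4]
  have h5 : inner ℂ C₁ C = inner ℂ C C := by
    rw [WeightedL2.inner_def, WeightedL2.inner_def]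
    exact integral_congr_ae (hae.mono fun t ht => by simp only [ht])
  rw [h5, inner_self_eq_norm_sq_to_K]
  have h6 := WeightedL2.norm_sq C
  rw [mean, ← h6]
  simp

/-- The bridge between the operator formula and the estimation problem; the existence and the
uniqueness of the inverse image give the two directions. -/
lemma IsOptimal.isErrorValue_iff {e : ℝ} :
    IsErrorValue S a F G e ↔ e = optimalError S a F G := by
  rw [o.optimalError_eq ha hF hG, o.mse_self ha hF hG, add_comm]
  constructor
  · rintro ⟨c, v, hc, rfl⟩
    rw [(o.eq_of_isInverseImage ha hF hG hc).2, Complex.ofReal_re]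
  · rintro rfl
    exact ⟨_, _, o.isInverseImage ha hF hG, by rw [Complex.ofReal_re]⟩

lemma IsOptimal.isCoefficient_iff {c : ℤ → Fin T → ℂ} :
    IsCoefficient S a F G c ↔ c = vcoef C.fn := by
  constructor
  · rintro ⟨v, hc⟩
    exact (o.eq_of_isInverseImage ha hF hG hc).1
  · rintro rfl
    exact ⟨_, o.isInverseImage ha hF hG⟩

end inverse

/-! ### Comparison and convex combinations of densities -/

section comparison

variable {T : ℕ} {S : Set ℤ} {K L K₀ L₀ : MatFn T}

lemma IsSpectralDensity.const_smul (hK : IsSpectralDensity K) {c : ℝ} (hc : 0 ≤ c) :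
    IsSpectralDensity (c • K) where
  integrable i j := (hK.integrable i j).smul c
  posSemidef := hK.posSemidef.mono fun t ht => by
    have h1 : (c • K) t = (c : ℂ) • K t := by ext; simp
    rw [h1]
    exact ht.smul (by exact_mod_cast hc)

lemma quad_single (K : Matrix (Fin T) (Fin T) ℂ) (i : Fin T) :
    quad K (Pi.single i 1) = (K i i).re := by
  simp [quad]

lemma sesq_single (K : Matrix (Fin T) (Fin T) ℂ) (i j : Fin T) :
    sesq K (Pi.single i 1) (Pi.single j 1) = K i j := by
  simp [sesq]

/-- The comparison of forms bounds the diagonal entries, and Cauchy–Schwarz bounds the others by the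
diagonal ones. -/
lemma isSpectralDensity_of_le (hL : IsSpectralDensity L)
    (hm : ∀ i j, AEStronglyMeasurable (fun t => K t i j) freq)
    (hK : ∀ᵐ t ∂freq, (K t).PosSemidef) (hKL : ∀ᵐ t ∂freq, ∀ v, quad (K t) v ≤ quad (L t) v) :
    IsSpectralDensity K where
  integrable i j := by
    refine Integrable.mono' ((hL.integrable i i).re.add (hL.integrable j j).re) (hm i j) ?_
    filter_upwards [hK, hKL] with t h1 h2
    have h3 := norm_sesq_le h1 (Pi.single i 1) (Pi.single j 1)
    rw [sesq_single] at h3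
    have h4 := h2 (Pi.single i 1)
    have h5 := h2 (Pi.single j 1)
    have h6 := MinimaxFiltering.quad_nonneg h1 (Pi.single i 1)
    have h7 := MinimaxFiltering.quad_nonneg h1 (Pi.single j 1)
    rw [quad_single, quad_single] at h4 h5
    rw [quad_single] at h6 h7
    rw [quad_single, quad_single] at h3
    simp only [Pi.add_apply, RCLike.re_eq_complex_re]
    linarith
  posSemidef := hK

lemma aestronglyMeasurable_inv_apply
    (hm : ∀ i j, AEStronglyMeasurable (fun t => K t i j) freq) (i j : Fin T) :
    AEStronglyMeasurable (fun t => (K t)⁻¹ i j) freq := by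
  have h1 : AEStronglyMeasurable (β := Fin T → Fin T → ℂ) K freq :=
    (aemeasurable_pi_lambda _ fun i => aemeasurable_pi_lambda _ fun j =>
      (hm i j).aemeasurable).aestronglyMeasurable
  have h2 : AEStronglyMeasurable (fun t => (K t).det) freq :=
    (continuous_id.matrix_det).comp_aestronglyMeasurable h1
  have h3 : AEStronglyMeasurable (fun t => (K t).adjugate i j) freq :=
    ((continuous_id.matrix_adjugate).matrix_elem i j).comp_aestronglyMeasurable h1
  have h4 : AEStronglyMeasurable (fun t => ((K t).det)⁻¹) freq :=
    (h2.aemeasurable.inv).aestronglyMeasurable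
  refine (h4.mul h3).congr (Eventually.of_forall fun t => ?_)
  simp [Matrix.inv_def]

/-- Inversion reverses the order: pairing `v` with `v L` gives `quad L v`, and Cauchy–Schwarz for
`L₀` and `K₀` bounds its square by `quad L₀ v * quad K₀ (v L) ≤ quad L₀ v * quad L v`. -/
lemma quad_inv_le {K₀ K L₀ L : Matrix (Fin T) (Fin T) ℂ} (hK₀ : K₀.PosSemidef)
    (hL₀ : L₀.PosSemidef) (hL : L.PosSemidef) (h₀ : K₀ * L₀ = 1)
    (h : K * L = 1) (hle : ∀ v, quad K₀ v ≤ quad K v) (v : Fin T → ℂ) :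
    quad L v ≤ quad L₀ v := by
  have h1 := norm_sesq_sq_le hL₀ v (v ᵥ* L ᵥ* K₀)
  rw [sesq_dual hK₀.1 h₀, quad_dual hK₀.1 h₀] at h1
  have h2 : v ⬝ᵥ star (v ᵥ* L) = quad L v := by
    rw [← sesq_self hL.1, star_vecMul, hL.1.eq, sesq]
  have h3 : quad K (v ᵥ* L) = quad L v := quad_dual hL.1 (mul_eq_one_comm.1 h) v
  have h4 := hle (v ᵥ* L)
  have h5 := MinimaxFiltering.quad_nonneg hL v
  have h6 := MinimaxFiltering.quad_nonneg hL₀ v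
  rw [h2, Complex.norm_real, Real.norm_of_nonneg h5] at h1
  rw [h3] at h4
  have h7 : quad L v ^ 2 ≤ quad L₀ v * quad L v := h1.trans (by gcongr)
  rcases h5.eq_or_lt with h8 | h8
  · rw [← h8]; exact h6
  · rw [sq] at h7
    exact le_of_mul_le_mul_right h7 h8

lemma DualWeights.const_smul (d : DualWeights K L) {c : ℝ} (hc : 0 < c) :
    DualWeights (c • K) (c⁻¹ • L) where
  left := d.left.const_smul hc.le
  right := d.right.const_smul (inv_pos.2 hc).le
  mul_eq_one := d.mul_eq_one.mono fun t ht => by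
    simp only [Pi.smul_apply, smul_mul_smul_comm, ht, mul_inv_cancel₀ hc.ne', one_smul]

/-- Adding a density to one which has a dual weight. -/
lemma DualWeights.add_density (d : DualWeights K₀ L₀) (hK : IsSpectralDensity K) :
    DualWeights (K₀ + K) fun t => ((K₀ + K) t)⁻¹ := by
  have hs := d.left.add hK
  have hu : ∀ᵐ t ∂freq, IsUnit ((K₀ + K) t) := by
    filter_upwards [d.left.posSemidef, hK.posSemidef, d.mul_eq_one] with t h1 h2 h3
    have h4 : (K₀ t).PosDef := (Matrix.PosSemidef.posDef_iff_isUnit h1).2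
      (IsUnit.of_mul_eq_one _ h3)
    exact (h4.add_posSemidef h2).isUnit
  refine ⟨hs, isSpectralDensity_of_le d.right
    (aestronglyMeasurable_inv_apply hs.aestronglyMeasurable_apply)
    (hs.posSemidef.mono fun t ht => ht.inv) ?_, ?_⟩
  · filter_upwards [hs.posSemidef, d.left.posSemidef, d.right.posSemidef, d.mul_eq_one, hu,
      hK.posSemidef] with t h1 h2 h3 h4 h5 h6
    refine quad_inv_le h2 h3 h1.inv h4
      (Matrix.mul_nonsing_inv _ ((Matrix.isUnit_iff_isUnit_det _).1 h5)) fun v => ?_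
    rw [Pi.add_apply, quad_add_mat]
    linarith [MinimaxFiltering.quad_nonneg h6 v]
  · filter_upwards [hu] with t ht
    exact Matrix.mul_nonsing_inv _ ((Matrix.isUnit_iff_isUnit_det _).1 ht)

lemma DualWeights.minimality {F G : MatFn T}
    (d : DualWeights (F + G) fun t => (F t + G t)⁻¹) : Minimality F G :=
  ⟨d.mul_eq_one.mono fun _ h => (Matrix.isUnit_iff_isUnit_det _).1 (IsUnit.of_mul_eq_one _ h),
    d.right.integrable⟩

lemma MemL2.mono (hK : IsSpectralDensity K) {c : ℝ}
    (hKL : ∀ᵐ t ∂freq, ∀ v, quad (K t) v ≤ c * quad (L t) v) {h : VecFn T} (hh : MemL2 L h) :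
    MemL2 K h := by
  refine ⟨hh.1, Integrable.mono' (hh.2.const_mul c) (hK.aestronglyMeasurable_quad hh.1) ?_⟩
  filter_upwards [hKL, hK.posSemidef] with t h1 h2
  rw [Real.norm_of_nonneg (MinimaxFiltering.quad_nonneg h2 _)]
  exact h1 _

lemma MemL2s.mono (hK : IsSpectralDensity K) (hL : IsSpectralDensity L) {c : ℝ} (hc : 0 < c)
    (hKL : ∀ᵐ t ∂freq, ∀ v, quad (K t) v ≤ c * quad (L t) v) {h : VecFn T}
    (hh : MemL2s S L h) : MemL2s S K h := by
  refine ⟨hh.1.mono hK hKL, fun ε hε => ?_⟩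
  obtain ⟨x, hx, hlt⟩ := hh.2 (c⁻¹ * ε) (by positivity)
  refine ⟨x, hx, ?_⟩
  have h1 : MemL2 L fun t => h t - trigPoly x t := hh.1.sub hL (hL.memL2_trigPoly x)
  calc ∫ t, quad (K t) (h t - trigPoly x t) ∂freq
      ≤ ∫ t, c * quad (L t) (h t - trigPoly x t) ∂freq :=
        integral_mono_ae (h1.mono hK hKL).2 (h1.2.const_mul c) (hKL.mono fun t ht => ht _)
    _ = c * ∫ t, quad (L t) (h t - trigPoly x t) ∂freq := integral_const_mul _ _
    _ < c * (c⁻¹ * ε) := by gcongr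
    _ = ε := by field_simp

lemma MemL2s.congr_ae {h g : VecFn T} (hh : MemL2s S K h) (hg : h =ᵐ[freq] g) :
    MemL2s S K g := by
  refine ⟨hh.1.congr_ae hg, fun ε hε => ?_⟩
  obtain ⟨x, hx, hlt⟩ := hh.2 ε hε
  refine ⟨x, hx, lt_of_eq_of_lt (integral_congr_ae ?_) hlt⟩
  filter_upwards [hg] with t ht
  simp only [ht]

lemma MemL2s.zero : MemL2s S K 0 :=
  ⟨MemL2.zero, fun ε hε => ⟨0, by simp, by simpa [trigPoly_zero, quad_zero] using hε⟩⟩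

lemma mse_congr_ae {a : ℤ → Fin T → ℂ} {F G : MatFn T} {h g : VecFn T} (hg : h =ᵐ[freq] g) :
    mse S a h F G = mse S a g F G := by
  unfold mse
  congr 1 <;> refine mean_congr_ae ?_ <;> filter_upwards [hg] with t ht <;> simp only [ht]

lemma WeightedL2.dist_sq {hK : IsSpectralDensity K} (x y : WeightedL2 hK) :
    dist x y ^ 2 = ∫ t, quad (K t) (x.fn t - y.fn t) ∂freq := by
  rw [dist_eq_norm]
  exact WeightedL2.norm_sq (x - y)

lemma WeightedL2.dist_le_of_quad_le {hK : IsSpectralDensity K} {hL : IsSpectralDensity L}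
    (hKL : ∀ᵐ t ∂freq, ∀ v, quad (K t) v ≤ 1 * quad (L t) v) {x y : WeightedL2 hL}
    {x' y' : WeightedL2 hK} (hx : x'.fn = x.fn) (hy : y'.fn = y.fn) : dist x' y' ≤ dist x y := by
  refine (pow_le_pow_iff_left₀ dist_nonneg dist_nonneg two_ne_zero).1 ?_
  rw [WeightedL2.dist_sq, WeightedL2.dist_sq, hx, hy]
  have h2 : MemL2 L (x.fn - y.fn) := x.memL2.sub hL y.memL2
  refine integral_mono_ae (h2.mono hK hKL).2 h2.2 (hKL.mono fun t ht => ?_)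
  exact (ht _).trans_eq (one_mul _)

lemma WeightedL2.mean_quad_sub {hK : IsSpectralDensity K} {g : VecFn T} (hg : MemL2 K g)
    (x : WeightedL2 hK) : mean (fun t => quad (K t) (g t - x.fn t)) =
      1 / (2 * Real.pi) * dist (WeightedL2.mk hK g hg) x ^ 2 := by
  rw [WeightedL2.dist_sq, WeightedL2.fn_mk, mean, smul_eq_mul]

lemma WeightedL2.continuous_of_quad_le {hK : IsSpectralDensity K} {hL : IsSpectralDensity L}
    (hKL : ∀ᵐ t ∂freq, ∀ v, quad (K t) v ≤ 1 * quad (L t) v)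
    {ι : WeightedL2 hL → WeightedL2 hK} (hι : ∀ x, (ι x).fn = x.fn) : Continuous ι := by
  refine LipschitzWith.continuous (K := 1) (LipschitzWith.of_dist_le_mul fun x y => ?_)
  rw [NNReal.coe_one, one_mul]
  exact WeightedL2.dist_le_of_quad_le hKL (hι x) (hι y)

/-- The quadratic error is continuous in a larger weighted space. -/
lemma continuous_mean_quad_sub (hK : IsSpectralDensity K) (hL : IsSpectralDensity L)
    (hKL : ∀ᵐ t ∂freq, ∀ v, quad (K t) v ≤ 1 * quad (L t) v) {g : VecFn T} (hg : MemL2 K g) :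
    Continuous fun x : WeightedL2 hL => mean fun t => quad (K t) (g t - x.fn t) := by
  obtain ⟨ι, hι⟩ : ∃ ι : WeightedL2 hL → WeightedL2 hK, ∀ x, (ι x).fn = x.fn :=
    ⟨fun x => WeightedL2.mk hK x.fn (x.memL2.mono hK hKL), fun x => WeightedL2.fn_mk _ _⟩
  have h1 : (fun x : WeightedL2 hL => mean fun t => quad (K t) (g t - x.fn t)) =
      fun x => 1 / (2 * Real.pi) * dist (WeightedL2.mk hK g hg) (ι x) ^ 2 := by
    ext x
    rw [← WeightedL2.mean_quad_sub hg, hι]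
  rw [h1]
  exact continuous_const.mul
    ((continuous_const.dist (WeightedL2.continuous_of_quad_le hKL hι)).pow 2)

end comparison

/-! ### A weak compactness substitute for nested convex sets -/

section cauchy

/-- A decreasing sequence of bounded, nonempty, closed and midpoint convex sets of a complete
pre-inner product space has a common point. -/
lemma exists_mem_of_antitone {X : Type*} [SeminormedAddCommGroup X] [InnerProductSpace ℂ X]
    [CompleteSpace X] {C : ℕ → Set X} (hanti : Antitone C) (hne : ∀ n, (C n).Nonempty)
    (hcl : ∀ n, IsClosed (C n)) (hmid : ∀ n, ∀ x ∈ C n, ∀ y ∈ C n, (2⁻¹ : ℂ) • (x + y) ∈ C n)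
    {r : ℝ} (hr : ∀ x ∈ C 0, ‖x‖ ^ 2 ≤ r) : ∃ x, ∀ n, x ∈ C n := by
  let m : ℕ → ℝ := fun n => sInf ((fun x => ‖x‖ ^ 2) '' C n)
  have hbdd : ∀ n, BddBelow ((fun x => ‖x‖ ^ 2) '' C n) := fun n =>
    ⟨0, by rintro _ ⟨x, -, rfl⟩; positivity⟩
  have hle : ∀ n, ∀ x ∈ C n, m n ≤ ‖x‖ ^ 2 := fun n x hx => csInf_le (hbdd n) ⟨x, hx, rfl⟩
  have hmono : Monotone m := fun i j hij =>
    csInf_le_csInf (hbdd i) ((hne j).image _) (Set.image_mono (hanti hij))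
  have hmr : BddAbove (Set.range m) := by
    refine ⟨r, ?_⟩
    rintro _ ⟨n, rfl⟩
    obtain ⟨x, hx⟩ := hne n
    exact (hle n x hx).trans (hr x (hanti (Nat.zero_le n) hx))
  have hlim := tendsto_atTop_ciSup hmono hmr
  have hex : ∀ n : ℕ, ∃ x ∈ C n, ‖x‖ ^ 2 < m n + 1 / (n + 1) := fun n => by
    obtain ⟨_, ⟨x, hx, rfl⟩, hlt⟩ := exists_lt_of_csInf_lt ((hne n).image _)
      (lt_add_of_pos_right (m n) (by positivity : (0 : ℝ) < 1 / (n + 1)))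
    exact ⟨x, hx, hlt⟩
  choose p hp hpm using hex
  set M := ⨆ n, m n with hM
  -- The midpoint of `p k` and `p l` lies in `C n`, so its squared norm is at least `m n`. With the
  -- parallelogram law, almost minimal points form a Cauchy sequence because the minima converge.
  have hdist : ∀ n k l : ℕ, n ≤ k → n ≤ l →
      ‖p k - p l‖ ^ 2 ≤ 4 * (M - m n + 1 / (n + 1)) := by
    intro n k l hk hl
    have h1 := parallelogram_law_with_norm ℂ (p k) (p l)
    have h2 := hle n _ (hmid n _ (hanti hk (hp k)) _ (hanti hl (hp l)))
    rw [norm_smul, mul_pow] at h2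
    norm_num at h2
    have h3 := le_ciSup hmr k
    have h4 := le_ciSup hmr l
    have h5 : (1 : ℝ) / (k + 1) ≤ 1 / (n + 1) := by gcongr
    have h6 : (1 : ℝ) / (l + 1) ≤ 1 / (n + 1) := by gcongr
    have h7 := hpm k
    have h8 := hpm l
    nlinarith
  have hcau : CauchySeq p := by
    refine Metric.cauchySeq_iff.2 fun ε hε => ?_
    have h1 : Tendsto (fun n : ℕ => 4 * (M - m n + 1 / ((n : ℝ) + 1))) atTop
        (𝓝 (4 * (M - M + 0))) :=
      ((tendsto_const_nhds.sub hlim).add tendsto_one_div_add_atTop_nhds_zero_nat).const_mul 4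
    rw [sub_self, add_zero, mul_zero] at h1
    obtain ⟨n, hn⟩ := (h1.eventually_lt_const (by positivity : 0 < ε ^ 2)).exists
    refine ⟨n, fun k hk l hl => ?_⟩
    rw [dist_eq_norm]
    exact lt_of_pow_lt_pow_left₀ 2 hε.le ((hdist n k l hk hl).trans_lt hn)
  obtain ⟨x, hx⟩ := cauchySeq_tendsto_of_complete hcau
  exact ⟨x, fun n => (hcl n).mem_of_tendsto hx
    ((eventually_ge_atTop n).mono fun k hk => hanti hk (hp k))⟩

end cauchy

/-! ### Errors of mixtures of pairs of densities -/

section mixture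

variable {T : ℕ} {S : Set ℤ} {a : ℤ → Fin T → ℂ} {K₀ K F₀ G₀ F G : MatFn T} {ε : ℝ}

lemma quad_mix (t : ℝ) (v : Fin T → ℂ) : quad (((1 - ε) • K₀ + ε • K) t) v =
    (1 - ε) * quad (K₀ t) v + ε * quad (K t) v := by
  rw [Pi.add_apply, quad_add_mat, Pi.smul_apply, Pi.smul_apply, quad_real_smul_mat,
    quad_real_smul_mat]

lemma mean_quad_mix {f : VecFn T} (h₀ : MemL2 K₀ f) (h : MemL2 K f) :
    mean (fun t => quad (((1 - ε) • K₀ + ε • K) t) (f t)) =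
      (1 - ε) * mean (fun t => quad (K₀ t) (f t)) + ε * mean (fun t => quad (K t) (f t)) := by
  simp only [quad_mix]
  rw [mean_add (h₀.2.const_mul _) (h.2.const_mul _), mean_const_mul_real, mean_const_mul_real]

lemma mix_add : (1 - ε) • F₀ + ε • F + ((1 - ε) • G₀ + ε • G) =
    (1 - ε) • (F₀ + G₀) + ε • (F + G) := by
  rw [smul_add, smul_add]
  abel

lemma mse_mix (ha : Summable fun j : weightIndex S => ∑ k, ‖a j k‖) (hF₀ : IsSpectralDensity F₀)
    (hG₀ : IsSpectralDensity G₀) (hF : IsSpectralDensity F) (hG : IsSpectralDensity G)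
    {h : VecFn T} (h₀ : MemL2 (F₀ + G₀) h) (h₁ : MemL2 (F + G) h) :
    mse S a h ((1 - ε) • F₀ + ε • F) ((1 - ε) • G₀ + ε • G) =
      (1 - ε) * mse S a h F₀ G₀ + ε * mse S a h F G := by
  have h2 : MemL2 F₀ fun t => symbolA S a t - h t :=
    (memL2_symbolA ha hF₀).sub hF₀ (h₀.of_add_left hF₀ hG₀)
  have h3 : MemL2 F fun t => symbolA S a t - h t :=
    (memL2_symbolA ha hF).sub hF (h₁.of_add_left hF hG)
  unfold mse
  rw [mean_quad_mix h2 h3, mean_quad_mix (h₀.of_add_right hF₀ hG₀) (h₁.of_add_right hF hG)]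
  ring

lemma IsSpectralDensity.mix (hK₀ : IsSpectralDensity K₀) (hK : IsSpectralDensity K)
    (h0 : 0 < ε) (h1 : ε < 1) : IsSpectralDensity ((1 - ε) • K₀ + ε • K) :=
  (hK₀.const_smul (by linarith)).add (hK.const_smul h0.le)

lemma DualWeights.mix (d : DualWeights (F₀ + G₀) fun t => (F₀ t + G₀ t)⁻¹)
    (hF : IsSpectralDensity F) (hG : IsSpectralDensity G) (h0 : 0 < ε) (h1 : ε < 1) :
    DualWeights ((1 - ε) • F₀ + ε • F + ((1 - ε) • G₀ + ε • G))
      fun t => (((1 - ε) • F₀ + ε • F) t + ((1 - ε) • G₀ + ε • G) t)⁻¹ := by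
  have h := (d.const_smul (sub_pos.2 h1)).add_density ((hF.add hG).const_smul h0.le)
  rw [← mix_add] at h
  exact h

/-- For `0 < ε < 1` the sum `K₀ + K` is bounded by a multiple of the mixture, so estimates
admissible for a mixture live in one space that does not depend on `ε`. -/
lemma MemL2s.add_of_mix (hK₀ : IsSpectralDensity K₀) (hK : IsSpectralDensity K)
    (h0 : 0 < ε) (h1 : ε < 1) {h : VecFn T} (hh : MemL2s S ((1 - ε) • K₀ + ε • K) h) :
    MemL2s S (K₀ + K) h := by
  have h2 : 0 < 1 - ε := sub_pos.2 h1
  refine hh.mono (c := ε⁻¹ + (1 - ε)⁻¹) (hK₀.add hK) (hK₀.mix hK h0 h1) (by positivity) ?_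
  filter_upwards [hK₀.posSemidef, hK.posSemidef] with t p0 p v
  rw [quad_mix, Pi.add_apply, quad_add_mat]
  have q0 := quad_nonneg p0 v
  have q := quad_nonneg p v
  have e : (ε⁻¹ + (1 - ε)⁻¹) * ((1 - ε) * quad (K₀ t) v + ε * quad (K t) v) =
      quad (K₀ t) v + quad (K t) v + (1 - ε) / ε * quad (K₀ t) v +
        ε / (1 - ε) * quad (K t) v := by
    field_simp
    ring
  rw [e]
  have e1 : 0 ≤ (1 - ε) / ε * quad (K₀ t) v := by positivity
  have e2 : 0 ≤ ε / (1 - ε) * quad (K t) v := by positivity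
  linarith

lemma quad_le_add_left (hK : IsSpectralDensity K) :
    ∀ᵐ t ∂freq, ∀ v, quad (K₀ t) v ≤ 1 * quad ((K₀ + K) t) v := by
  filter_upwards [hK.posSemidef] with t p v
  rw [Pi.add_apply, quad_add_mat]
  linarith [quad_nonneg p v]

lemma quad_le_add_right (hK₀ : IsSpectralDensity K₀) :
    ∀ᵐ t ∂freq, ∀ v, quad (K t) v ≤ 1 * quad ((K₀ + K) t) v := by
  rw [add_comm]
  exact quad_le_add_left hK₀

lemma MemL2s.of_add_left (hK₀ : IsSpectralDensity K₀) (hK : IsSpectralDensity K) {h : VecFn T}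
    (hh : MemL2s S (K₀ + K) h) : MemL2s S K₀ h :=
  hh.mono hK₀ (hK₀.add hK) one_pos (quad_le_add_left hK)

lemma MemL2s.of_add_right (hK₀ : IsSpectralDensity K₀) (hK : IsSpectralDensity K) {h : VecFn T}
    (hh : MemL2s S (K₀ + K) h) : MemL2s S K h :=
  hh.mono hK (hK₀.add hK) one_pos (quad_le_add_right hK₀)

/-- The mean-square error is continuous in a larger weighted space. -/
lemma continuous_mse (ha : Summable fun j : weightIndex S => ∑ k, ‖a j k‖)
    (hF : IsSpectralDensity F) (hG : IsSpectralDensity G) (hK : IsSpectralDensity K)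
    (hle : ∀ᵐ t ∂freq, ∀ v, quad ((F + G) t) v ≤ 1 * quad (K t) v) :
    Continuous fun x : WeightedL2 hK => mse S a x.fn F G := by
  have h1 : ∀ᵐ t ∂freq, ∀ v, quad (F t) v ≤ 1 * quad (K t) v := by
    filter_upwards [hle, quad_le_add_left (K₀ := F) hG] with t p q v
    linarith [p v, q v]
  have h2 : ∀ᵐ t ∂freq, ∀ v, quad (G t) v ≤ 1 * quad (K t) v := by
    filter_upwards [hle, quad_le_add_right (K := G) hF] with t p q v
    linarith [p v, q v]
  refine (continuous_mean_quad_sub hF hK h1 (memL2_symbolA ha hF)).add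
    ((continuous_mean_quad_sub hG hK h2 MemL2.zero).congr fun x => ?_)
  refine mean_congr_ae (Eventually.of_forall fun t => ?_)
  simp only [Pi.zero_apply]
  rw [quad_sub_comm, sub_zero]

lemma quad_midpoint_le {K : Matrix (Fin T) (Fin T) ℂ} (hK : K.PosSemidef) (v w : Fin T → ℂ) :
    quad K ((2⁻¹ : ℂ) • (v + w)) ≤ 2⁻¹ * quad K v + 2⁻¹ * quad K w := by
  rw [quad_smul]
  have := quad_add_le hK v w
  norm_num
  linarith

lemma mean_quad_midpoint_le (hK : IsSpectralDensity K) {f g : VecFn T} (hf : MemL2 K f)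
    (hg : MemL2 K g) : mean (fun t => quad (K t) ((2⁻¹ : ℂ) • (f t + g t))) ≤
      2⁻¹ * mean (fun t => quad (K t) (f t)) + 2⁻¹ * mean (fun t => quad (K t) (g t)) := by
  rw [← mean_const_mul_real, ← mean_const_mul_real,
    ← mean_add (hf.2.const_mul _) (hg.2.const_mul _)]
  refine mean_mono ((hf.add hK hg).smul (2⁻¹ : ℂ)).2
    ((hf.2.const_mul _).add (hg.2.const_mul _)) ?_
  exact hK.posSemidef.mono fun t ht => quad_midpoint_le ht _ _

lemma mse_midpoint_le (ha : Summable fun j : weightIndex S => ∑ k, ‖a j k‖)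
    (hF : IsSpectralDensity F) (hG : IsSpectralDensity G) {f g : VecFn T}
    (hf : MemL2 (F + G) f) (hg : MemL2 (F + G) g) {r : ℝ} (hfr : mse S a f F G ≤ r)
    (hgr : mse S a g F G ≤ r) : mse S a ((2⁻¹ : ℂ) • (f + g)) F G ≤ r := by
  have hA := memL2_symbolA ha hF
  have h1 := mean_quad_midpoint_le hF (hA.sub hF (hf.of_add_left hF hG))
    (hA.sub hF (hg.of_add_left hF hG))
  have h2 := mean_quad_midpoint_le hG (hf.of_add_right hF hG) (hg.of_add_right hF hG)
  have h3 : ∀ t, symbolA S a t - ((2⁻¹ : ℂ) • (f + g)) t =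
      (2⁻¹ : ℂ) • ((symbolA S a - f) t + (symbolA S a - g) t) := fun t => by
    ext i
    simp only [Pi.sub_apply, Pi.smul_apply, Pi.add_apply, smul_eq_mul]
    ring
  unfold mse at *
  simp only [h3]
  simp only [Pi.sub_apply] at h1 ⊢
  simp only [Pi.smul_apply, Pi.add_apply] at h2 ⊢
  linarith

lemma exists_mse_lt {r : ℝ} (h : optimalError S a F G < r) :
    ∃ g, MemL2s S (F + G) g ∧ mse S a g F G < r := by
  obtain ⟨_, ⟨g, hg, rfl⟩, hlt⟩ := exists_lt_of_csInf_lt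
    (s := {e | ∃ h, MemL2s S (F + G) h ∧ e = mse S a h F G}) ⟨_, 0, MemL2s.zero, rfl⟩ h
  exact ⟨g, hg, hlt⟩

end mixture

/-! ### Least favorable pairs and the saddle point -/

section leastFavorable

variable {T : ℕ} {S : Set ℤ} {a : ℤ → Fin T → ℂ} {F₀ G₀ : MatFn T} {DF DG : Set (MatFn T)}
  (ha : Summable fun j : weightIndex S => ∑ k, ‖a j k‖)
  (hDF : Convex ℝ DF) (hDG : Convex ℝ DG) (hsF : ∀ F ∈ DF, IsSpectralDensity F)
  (hsG : ∀ G ∈ DG, IsSpectralDensity G) (hF₀ : F₀ ∈ DF) (hG₀ : G₀ ∈ DG)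
  {d : DualWeights (F₀ + G₀) fun t => (F₀ t + G₀ t)⁻¹}
  {h : WeightedL2 d.left} {C : WeightedL2 d.right} (o : IsOptimal d S a h C)

include ha hDF hDG hsF hsG hF₀ hG₀ o

/-- Only the passage from pairs with minimality to all pairs is at issue. The midpoint of any pair
with `(F₀, G₀)` satisfies minimality, so its error is at most that of `(F₀, G₀)`; by concavity it is
at least the average of the two errors. -/
lemma IsOptimal.isExtremal_iff (hS : S.Finite) :
    IsExtremal S a DF DG F₀ G₀ ↔ IsLeastFavorable S a DF DG F₀ G₀ := by
  have hF₀s := hsF _ hF₀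
  have hG₀s := hsG _ hG₀
  constructor
  · rintro ⟨e₀, he₀, hmax⟩
    rw [o.isErrorValue_iff ha hF₀s hG₀s] at he₀
    subst he₀
    refine ⟨hF₀, hG₀, fun F hF G hG => ?_⟩
    have hFs := hsF _ hF
    have hGs := hsG _ hG
    have h0 : (0 : ℝ) < 2⁻¹ := by norm_num
    have h1 : (2⁻¹ : ℝ) < 1 := by norm_num
    have d' := d.mix hFs hGs h0 h1
    have hFm := hF₀s.mix hFs h0 h1
    have hGm := hG₀s.mix hGs h0 h1
    obtain ⟨h', C', o'⟩ := exists_isOptimal ha hFm hGm d' hS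
    have h2 := hmax _ (hDF hF₀ hF (by norm_num : (0 : ℝ) ≤ 1 - 2⁻¹) h0.le (by norm_num)) _
      (hDG hG₀ hG (by norm_num : (0 : ℝ) ≤ 1 - 2⁻¹) h0.le (by norm_num)) d'.minimality _
      ((o'.isErrorValue_iff ha hFm hGm).2 rfl)
    have h3 := o'.memL2s
    rw [o'.optimalError_eq ha hFm hGm] at h2
    generalize h'.fn = g at h2 h3
    rw [mix_add] at h3
    have h4 := h3.add_of_mix (hF₀s.add hG₀s) (hFs.add hGs) h0 h1
    have h5 := h4.of_add_left (hF₀s.add hG₀s) (hFs.add hGs)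
    have h6 := h4.of_add_right (hF₀s.add hG₀s) (hFs.add hGs)
    rw [mse_mix ha hF₀s hG₀s hFs hGs h5.1 h6.1] at h2
    have h7 := optimalError_le (a := a) hF₀s hG₀s h5
    have h8 := optimalError_le (a := a) hFs hGs h6
    norm_num at h2
    linarith
  · rintro ⟨-, -, hmax⟩
    refine ⟨_, (o.isErrorValue_iff ha hF₀s hG₀s).2 rfl, fun F hF G hG hmin e he => ?_⟩
    have d' := dualWeights_of_minimality (hsF _ hF) (hsG _ hG) hmin
    obtain ⟨h', C', o'⟩ := exists_isOptimal ha (hsF _ hF) (hsG _ hG) d' hS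
    rw [o'.isErrorValue_iff ha (hsF _ hF) (hsG _ hG)] at he
    subst he
    exact hmax F hF G hG

/-- The optimal estimate of a least favorable pair is admissible for every pair of densities, and
its error is the largest for the least favorable pair. -/
lemma IsOptimal.saddle (hlf : IsLeastFavorable S a DF DG F₀ G₀) {F G : MatFn T} (hF : F ∈ DF)
    (hG : G ∈ DG) :
    MemL2s S (F + G) h.fn ∧ mse S a h.fn F G ≤ mse S a h.fn F₀ G₀ := by
  have hF₀s := hsF _ hF₀
  have hG₀s := hsG _ hG₀
  have hFs := hsF _ hF
  have hGs := hsG _ hG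
  have hW₀ := hF₀s.add hG₀s
  have hW := hFs.add hGs
  -- The pair `(F, G)` need not satisfy minimality, but the weight `F₀ + G₀ + F + G` has an
  -- integrable inverse, so its space is complete and controls both errors.
  have dX := d.add_density hW
  have := dX.completeSpace
  set Δ := mse S a h.fn F₀ G₀ with hΔ
  have hΔ0 : 0 ≤ Δ := mse_nonneg hF₀s hG₀s _
  set P := WeightedL2.trigSubmodule dX.left (observed S) with hP
  have hclP : ∀ x : WeightedL2 dX.left, x ∈ P.topologicalClosure ↔
      MemL2s S (F₀ + G₀ + (F + G)) x.fn := fun x =>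
    ⟨fun hx => WeightedL2.memL2s_iff.2 ⟨x.memL2, hx⟩, fun hx =>
      (WeightedL2.memL2s_iff (hK := dX.left).1 hx).2⟩
  have hcont₀ : Continuous fun x : WeightedL2 dX.left => mse S a x.fn F₀ G₀ :=
    continuous_mse ha hF₀s hG₀s dX.left (quad_le_add_left hW)
  have hcont₁ : Continuous fun x : WeightedL2 dX.left => mse S a x.fn F G :=
    continuous_mse ha hFs hGs dX.left (quad_le_add_right hW₀)
  let E : ℕ → Set (WeightedL2 dX.left) := fun n => {x | x ∈ P.topologicalClosure ∧
    mse S a x.fn F₀ G₀ ≤ Δ + 1 / (n + 1) ∧ mse S a x.fn F G ≤ Δ + 1 / (n + 1)}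
  have hne : ∀ n, (E n).Nonempty := by
    intro n
    set η : ℝ := 1 / (n + 1) with hη
    have hη0 : 0 < η := by positivity
    -- With accuracy `ε η / 2` for the mixture, the lower bound `Δ` for the first error leaves at
    -- most `Δ + η / 2` for the second after division by `ε`. The size of `ε` keeps the first error
    -- below `Δ + η` after division by `1 - ε`.
    set ε : ℝ := η / (2 * (Δ + η) + 1) with hε
    have hε0 : 0 < ε := by positivity
    have hε' : ε * (2 * (Δ + η) + 1) = η := div_mul_cancel₀ _ (by positivity)
    have hε1 : ε < 1 := by
      rw [hε, div_lt_one (by positivity)]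
      linarith
    have h1 := hlf.2.2 _ (hDF hF₀ hF (by linarith : (0 : ℝ) ≤ 1 - ε) hε0.le (by ring)) _
      (hDG hG₀ hG (by linarith : (0 : ℝ) ≤ 1 - ε) hε0.le (by ring))
    rw [o.optimalError_eq ha hF₀s hG₀s, ← hΔ] at h1
    obtain ⟨g, hg, hlt⟩ := exists_mse_lt (h1.trans_lt
      (lt_add_of_pos_right Δ (by positivity : 0 < ε * η / 2)))
    rw [mix_add] at hg
    have h4 := hg.add_of_mix hW₀ hW hε0 hε1
    have h5 := h4.of_add_left hW₀ hW
    have h6 := h4.of_add_right hW₀ hW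
    rw [mse_mix ha hF₀s hG₀s hFs hGs h5.1 h6.1] at hlt
    have h7 : Δ ≤ mse S a g F₀ G₀ := by
      rw [hΔ, ← o.optimalError_eq ha hF₀s hG₀s]
      exact optimalError_le hF₀s hG₀s h5
    have h8 := mse_nonneg (S := S) (a := a) hFs hGs g
    refine ⟨WeightedL2.mk dX.left g h4.1, (hclP _).2 h4, ?_, ?_⟩
    · rw [WeightedL2.fn_mk]
      have h9 : (1 - ε) * mse S a g F₀ G₀ < Δ + ε * η / 2 := by nlinarith
      by_contra! h10
      nlinarith
    · rw [WeightedL2.fn_mk]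
      by_contra! h10
      nlinarith
  have hex : ∃ x, ∀ n, x ∈ E n := by
    -- The radius comes from `h = A - (A - h)`: an error at most `Δ + 1` and the norm of `A` bound
    -- the norm of `h` for each of the two pairs.
    refine exists_mem_of_antitone (r := 2 * Real.pi *
      (2 * (Δ + 1) + 2 * mean (fun t => quad (F₀ t) (symbolA S a t)) +
        (2 * (Δ + 1) + 2 * mean (fun t => quad (F t) (symbolA S a t))))) ?_ hne ?_ ?_ ?_
    · intro m n hmn x hx
      have h1 : (1 : ℝ) / (n + 1) ≤ 1 / (m + 1) := by gcongr
      exact ⟨hx.1, hx.2.1.trans (by linarith), hx.2.2.trans (by linarith)⟩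
    · intro n
      exact P.isClosed_topologicalClosure.inter
        ((isClosed_le hcont₀ continuous_const).inter (isClosed_le hcont₁ continuous_const))
    · intro n x hx y hy
      have hx0 := ((hclP x).1 hx.1).of_add_left hW₀ hW
      have hx1 := ((hclP x).1 hx.1).of_add_right hW₀ hW
      have hy0 := ((hclP y).1 hy.1).of_add_left hW₀ hW
      have hy1 := ((hclP y).1 hy.1).of_add_right hW₀ hW
      exact ⟨P.topologicalClosure.smul_mem _ (P.topologicalClosure.add_mem hx.1 hy.1),
        mse_midpoint_le ha hF₀s hG₀s hx0.1 hy0.1 hx.2.1 hy.2.1,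
        mse_midpoint_le ha hFs hGs hx1.1 hy1.1 hx.2.2 hy.2.2⟩
    · intro x hx
      have key : ∀ {F G : MatFn T}, IsSpectralDensity F → IsSpectralDensity G →
          MemL2 (F + G) x.fn → mse S a x.fn F G ≤ Δ + 1 →
          mean (fun t => quad ((F + G) t) (x.fn t)) ≤
            2 * (Δ + 1) + 2 * mean (fun t => quad (F t) (symbolA S a t)) := by
        intro F G hF hG hm hle
        have hA := memL2_symbolA ha hF
        have hmF := hm.of_add_left hF hG
        have hmG := hm.of_add_right hF hG
        have hAx : MemL2 F fun t => symbolA S a t - x.fn t := hA.sub hF hmF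
        have h1 : mean (fun t => quad (F t) (x.fn t)) ≤
            2 * mean (fun t => quad (F t) (symbolA S a t - x.fn t)) +
              2 * mean (fun t => quad (F t) (symbolA S a t)) := by
          rw [← mean_const_mul_real, ← mean_const_mul_real,
            ← mean_add (hAx.2.const_mul 2) (hA.2.const_mul 2)]
          refine mean_mono hmF.2 ((hAx.2.const_mul 2).add (hA.2.const_mul 2)) ?_
          filter_upwards [hF.posSemidef] with t ht
          have h2 := quad_sub_le ht (symbolA S a t - x.fn t) (symbolA S a t)
          rwa [quad_sub_comm, sub_sub_cancel] at h2
        have h3 : mean (fun t => quad ((F + G) t) (x.fn t)) =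
            mean (fun t => quad (F t) (x.fn t)) + mean (fun t => quad (G t) (x.fn t)) := by
          rw [← mean_add hmF.2 hmG.2]
          exact mean_congr_ae (Eventually.of_forall fun t => quad_add_mat _ _ _)
        have h4 := mean_nonneg (hG.quad_nonneg x.fn)
        have h5 : mean (fun t => quad (F t) (symbolA S a t - x.fn t)) +
          mean (fun t => quad (G t) (x.fn t)) ≤ Δ + 1 := hle
        linarith
      have hx' := (hclP x).1 hx.1
      have hm₀ := (hx'.of_add_left hW₀ hW).1
      have hm₁ := (hx'.of_add_right hW₀ hW).1
      have h1 := hx.2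
      simp only [Nat.cast_zero, zero_add, div_one] at h1
      have h2 := key hF₀s hG₀s hm₀ h1.1
      have h3 := key hFs hGs hm₁ h1.2
      have h4 : mean (fun t => quad ((F₀ + G₀ + (F + G)) t) (x.fn t)) =
          mean (fun t => quad ((F₀ + G₀) t) (x.fn t)) +
            mean (fun t => quad ((F + G) t) (x.fn t)) := by
        rw [← mean_add hm₀.2 hm₁.2]
        exact mean_congr_ae (Eventually.of_forall fun t => quad_add_mat _ _ _)
      have h5 : ‖x‖ ^ 2 = 2 * Real.pi * mean fun t => quad ((F₀ + G₀ + (F + G)) t) (x.fn t) := by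
        have := Real.pi_pos
        rw [WeightedL2.norm_sq, mean, smul_eq_mul]
        field_simp
      rw [h5, h4]
      have := Real.pi_pos
      gcongr
  obtain ⟨x, hx⟩ := hex
  have hlim : Tendsto (fun n : ℕ => Δ + 1 / ((n : ℝ) + 1)) atTop (𝓝 Δ) := by
    simpa using tendsto_one_div_add_atTop_nhds_zero_nat.const_add Δ
  have hle₀ : mse S a x.fn F₀ G₀ ≤ Δ := by
    exact ge_of_tendsto' hlim fun n => (hx n).2.1
  have hle₁ : mse S a x.fn F G ≤ Δ := by
    exact ge_of_tendsto' hlim fun n => (hx n).2.2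
  have hxs := (hclP x).1 (hx 0).1
  -- The common point is optimal for `(F₀, G₀)`, so uniqueness identifies it with `h`, which
  -- inherits its admissibility and error bound for `(F, G)`.
  have hxh := o.ae_eq_of_mse_le ha hF₀s hG₀s (hxs.of_add_left hW₀ hW) hle₀
  exact ⟨(hxs.of_add_right hW₀ hW).congr_ae hxh, (mse_congr_ae hxh).symm.trans_le hle₁⟩

/-- The saddle point makes `h` a competitor with worst error `Δ(F₀, G₀)`. A minimax-robust `g` thus
has no larger error at `(F₀, G₀)`, and uniqueness of the optimal estimate there forces `g = h`
almost everywhere. -/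
lemma IsOptimal.isMinimaxRobust_iff (hlf : IsLeastFavorable S a DF DG F₀ G₀) {g : VecFn T} :
    IsMinimaxRobust S a DF DG g ↔ g =ᵐ[freq] h.fn := by
  have hsad : ∀ F ∈ DF, ∀ G ∈ DG,
      MemL2s S (F + G) h.fn ∧ mse S a h.fn F G ≤ mse S a h.fn F₀ G₀ := fun F hF G hG =>
    o.saddle ha hDF hDG hsF hsG hF₀ hG₀ hlf hF hG
  constructor
  · rintro ⟨hmem, -, hmin⟩
    exact o.ae_eq_of_mse_le ha (hsF _ hF₀) (hsG _ hG₀) (hmem _ hF₀ _ hG₀)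
      (hmin h.fn (fun F hF G hG => (hsad F hF G hG).1) _ (fun F hF G hG => (hsad F hF G hG).2)
        _ hF₀ _ hG₀)
  · intro hg
    refine ⟨fun F hF G hG => (hsad F hF G hG).1.congr_ae hg.symm,
      ⟨F₀, hF₀, G₀, hG₀, fun F hF G hG => ?_⟩, fun f hf b hb F hF G hG => ?_⟩
    · rw [mse_congr_ae hg, mse_congr_ae hg]
      exact (hsad F hF G hG).2
    · rw [mse_congr_ae hg]
      refine (hsad F hF G hG).2.trans (le_trans ?_ (hb _ hF₀ _ hG₀))
      rw [← o.optimalError_eq ha (hsF _ hF₀) (hsG _ hG₀)]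
      exact optimalError_le (hsF _ hF₀) (hsG _ hG₀) (hf _ hF₀ _ hG₀)

end leastFavorable

/-! ### Bounded spectral characteristics -/

section bounded

variable {T : ℕ} {S : Set ℤ} {K : MatFn T}

lemma trigPoly_sum_single {ι : Type*} (s : Finset ι) (n : ι → ℤ) (v : ι → Fin T → ℂ) (t : ℝ) :
    trigPoly (∑ p ∈ s, Finsupp.single (n p) (v p)) t = ∑ p ∈ s, expi (n p) t • v p := by
  classical
  induction s using Finset.induction_on with
  | empty => simp [trigPoly_zero]
  | insert p s hp ih =>
    rw [Finset.sum_insert hp, Finset.sum_insert hp, trigPoly_add, Pi.add_apply, ih,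
      trigPoly_single]

/-- The Fejér means of a vector function are trigonometric polynomials without new frequencies. -/
lemma exists_trigPoly_eq_fejer {E : Set ℤ} {h : VecFn T} (hh : ∀ n, n ∉ E → vcoef h n = 0)
    (N : ℕ) : ∃ x : ℤ →₀ (Fin T → ℂ), (x.support : Set ℤ) ⊆ E ∧
      ∀ t i, trigPoly x t i = fejer (fun t => h t i) N t := by
  refine ⟨∑ p ∈ Finset.range N ×ˢ Finset.range N, Finsupp.single ((p.1 : ℤ) - p.2)
    ((N : ℂ)⁻¹ • vcoef h ((p.1 : ℤ) - p.2)), fun n hn => ?_, fun t i => ?_⟩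
  · by_contra hnE
    rw [Finset.mem_coe, Finsupp.mem_support_iff, Finsupp.finsetSum_apply] at hn
    refine hn (Finset.sum_eq_zero fun p _ => ?_)
    rw [Finsupp.single_apply]
    split_ifs with hp
    · rw [hp, hh n hnE, smul_zero]
    · rfl
  · rw [trigPoly_sum_single, Finset.sum_apply, fejer, ← Finset.sum_product', Finset.mul_sum]
    refine Finset.sum_congr rfl fun p _ => ?_
    simp only [Pi.smul_apply, smul_eq_mul, vcoef]
    ring

/-- A bounded function without unobserved frequencies is an admissible spectral characteristic for
every density. -/
lemma memL2s_of_bound (hK : IsSpectralDensity K) {h : VecFn T} (hm : AEStronglyMeasurable h freq)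
    {B : ℝ} (hB : ∀ᵐ t ∂freq, ∀ i, ‖h t i‖ ≤ B) (hc : ∀ n ∈ unobserved S, vcoef h n = 0) :
    MemL2s S K h := by
  -- The bound for Fejér means requires a nonnegative constant, and `B` is not assumed to be one.
  set B' := max B 0 with hB'
  have hB1 : ∀ᵐ t ∂freq, ∀ i, ‖h t i‖ ≤ B' := hB.mono fun t ht i => (ht i).trans (le_max_left _ _)
  have hB2 : ∀ i, ∀ᵐ t ∂freq, ‖h t i‖ ≤ B' := ae_all_iff.1 hB1
  have hmi := aestronglyMeasurable_apply hm
  obtain ⟨ns, -, hns⟩ := exists_subseq_fejer_ae fun i => memLp_two_of_bound (hmi i) (hB2 i)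
  have hex : ∀ N, ∃ x : ℤ →₀ (Fin T → ℂ), (x.support : Set ℤ) ⊆ observed S ∧
      ∀ t i, trigPoly x t i = fejer (fun t => h t i) N t := exists_trigPoly_eq_fejer fun n hn =>
    hc n (by_contra fun hn' => hn (notMem_unobserved_iff.1 hn'))
  choose x hx hxf using hex
  refine ⟨hK.memL2_of_bound hm hB1, fun ε hε => ?_⟩
  have hlim : Tendsto (fun k => ∫ t, quad (K t) (h t - trigPoly (x (ns k)) t) ∂freq) atTop
      (𝓝 (∫ _t, (0 : ℝ) ∂freq)) := by
    refine tendsto_integral_of_dominated_convergence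
      (fun t => (2 * B') ^ 2 * ∑ i, ∑ j, ‖K t i j‖) (fun k => ?_) ?_ (fun k => ?_) ?_
    · exact hK.aestronglyMeasurable_quad
        (hm.sub (continuous_trigPoly _).aestronglyMeasurable)
    · exact (integrable_finsetSum _ fun i _ => integrable_finsetSum _ fun j _ =>
        (hK.integrable i j).norm).const_mul _
    · filter_upwards [hB1] with t ht
      refine quad_le_of_bound fun i => ?_
      rw [Pi.sub_apply, hxf]
      refine (norm_sub_le _ _).trans ?_
      have := norm_fejer_le (hmi i) (le_max_right B 0) (hB2 i) (ns k) t
      linarith [ht i]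
    · filter_upwards [hns] with t ht
      have h1 : Tendsto (fun k => h t - trigPoly (x (ns k)) t) atTop (𝓝 0) := by
        rw [tendsto_pi_nhds]
        intro i
        have := (ht i).const_sub (h t i)
        rw [sub_self] at this
        refine this.congr fun k => ?_
        rw [Pi.sub_apply, hxf]
      have h2 := (continuous_quad (K t)).continuousAt.tendsto.comp h1
      rwa [quad_zero] at h2
  rw [integral_zero] at hlim
  obtain ⟨k, hk⟩ := (hlim.eventually_lt_const hε).exists
  exact ⟨x (ns k), hx _, hk⟩

end bounded

/-! ### Real-linear functionals of densities -/

section linear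

variable {T : ℕ} {E : Type*} [NormedAddCommGroup E] [NormedSpace ℝ E] {F F' F₀ F₁ G₀ G : MatFn T}

lemma integrable_linear (φ : Matrix (Fin T) (Fin T) ℂ →ₗ[ℝ] E)
    (hF : ∀ i j, Integrable (fun t => F t i j) freq) : Integrable (fun t => φ (F t)) freq := by
  have h1 : Integrable (ε := Fin T → Fin T → ℂ) F freq :=
    Integrable.of_eval fun i => Integrable.of_eval fun j => hF i j
  let ψ : (Fin T → Fin T → ℂ) →ₗ[ℝ] E := φ
  exact (LinearMap.toContinuousLinearMap ψ).integrable_comp h1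

/-- All four balls around `F₁` are described by real-linear functionals (trace, entries, `⟨B₁, ·⟩`),
so one convexity argument serves them all. -/
lemma mean_norm_linear_mix_le (φ : Matrix (Fin T) (Fin T) ℂ →ₗ[ℝ] E)
    (hF : IsSpectralDensity F) (hF' : IsSpectralDensity F') (hF₁ : IsSpectralDensity F₁)
    {s r δ : ℝ} (hs : 0 ≤ s) (hr : 0 ≤ r) (hsr : s + r = 1)
    (h : mean (fun t => ‖φ (F t - F₁ t)‖) ≤ δ) (h' : mean (fun t => ‖φ (F' t - F₁ t)‖) ≤ δ) :
    mean (fun t => ‖φ ((s • F + r • F') t - F₁ t)‖) ≤ δ := by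
  have hi : ∀ {F : MatFn T}, IsSpectralDensity F →
      Integrable (fun t => ‖φ (F t - F₁ t)‖) freq := fun hF =>
    (integrable_linear φ fun i j => (hF.integrable i j).sub (hF₁.integrable i j)).norm
  calc mean (fun t => ‖φ ((s • F + r • F') t - F₁ t)‖)
      ≤ mean (fun t => s * ‖φ (F t - F₁ t)‖ + r * ‖φ (F' t - F₁ t)‖) := by
        refine mean_mono (hi ((hF.const_smul hs).add (hF'.const_smul hr)))
          (((hi hF).const_mul s).add ((hi hF').const_mul r)) (Eventually.of_forall fun t => ?_)
        have e : (s • F + r • F') t - F₁ t = s • (F t - F₁ t) + r • (F' t - F₁ t) := by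
          have : F₁ t = s • F₁ t + r • F₁ t := by rw [← add_smul, hsr, one_smul]
          simp only [Pi.add_apply, Pi.smul_apply, smul_sub]
          nth_rw 1 [this]
          abel
        rw [e, map_add, map_smul, map_smul]
        refine (norm_add_le _ _).trans_eq ?_
        rw [norm_smul, norm_smul, Real.norm_of_nonneg hs, Real.norm_of_nonneg hr]
    _ = s * mean (fun t => ‖φ (F t - F₁ t)‖) + r * mean (fun t => ‖φ (F' t - F₁ t)‖) := by
        rw [mean_add ((hi hF).const_mul s) ((hi hF').const_mul r), mean_const_mul_real,
          mean_const_mul_real]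
    _ ≤ s * δ + r * δ := by gcongr
    _ = δ := by rw [← add_mul, hsr, one_mul]

lemma mean_linear_mix (φ : Matrix (Fin T) (Fin T) ℂ →ₗ[ℝ] E)
    (hF : IsSpectralDensity F) (hF' : IsSpectralDensity F') {s r : ℝ} :
    mean (fun t => φ ((s • F + r • F') t)) =
      s • mean (fun t => φ (F t)) + r • mean (fun t => φ (F' t)) := by
  have h1 : Integrable (fun t => s • φ (F t)) freq := (integrable_linear φ hF.integrable).smul s
  have h2 : Integrable (fun t => r • φ (F' t)) freq := (integrable_linear φ hF'.integrable).smul r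
  simp only [Pi.add_apply, Pi.smul_apply, map_add, map_smul]
  rw [mean_add h1 h2]
  simp only [mean, integral_smul]
  rw [smul_comm s, smul_comm r]

/-- `⟨B, ·⟩` as a linear functional. -/
noncomputable def matPairLinear (B : Matrix (Fin T) (Fin T) ℂ) :
    Matrix (Fin T) (Fin T) ℂ →ₗ[ℝ] ℝ where
  toFun := matPair B
  map_add' X Y := by
    simp only [matPair, Matrix.add_apply, mul_add, Finset.sum_add_distrib, Complex.add_re]
  map_smul' c X := by
    simp only [matPair, Matrix.smul_apply, mul_smul_comm, ← Finset.smul_sum, Complex.smul_re,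
      RingHom.id_apply]

/-- A bounded number of linear functionals whose mean deviations do not increase controls the mean
of a quadratic form. -/
lemma mean_quad_le_of_norm {ι : Type*} [Fintype ι]
    (φ : ι → Matrix (Fin T) (Fin T) ℂ →ₗ[ℝ] E) {c : ι → ℝ} (hc : ∀ i, 0 ≤ c i)
    (hF : IsSpectralDensity F) (hF₀ : IsSpectralDensity F₀) (hF₁ : IsSpectralDensity F₁)
    (hle : ∀ i, mean (fun t => ‖φ i (F t - F₁ t)‖) ≤ mean (fun t => ‖φ i (F₀ t - F₁ t)‖))
    {v : VecFn T} (hv : MemL2 F v) (hv₀ : MemL2 F₀ v)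
    (key : ∀ᵐ t ∂freq, quad (F t - F₀ t) (v t) ≤
      ∑ i, c i * (‖φ i (F t - F₁ t)‖ - ‖φ i (F₀ t - F₁ t)‖)) :
    mean (fun t => quad (F t) (v t)) ≤ mean (fun t => quad (F₀ t) (v t)) := by
  have hi : ∀ {F : MatFn T}, IsSpectralDensity F → ∀ i,
      Integrable (fun t => ‖φ i (F t - F₁ t)‖) freq := fun hF i =>
    (integrable_linear (φ i) fun k l => (hF.integrable k l).sub (hF₁.integrable k l)).norm
  have hi' : ∀ i, Integrable
      (fun t => c i * (‖φ i (F t - F₁ t)‖ - ‖φ i (F₀ t - F₁ t)‖)) freq := fun i =>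
    ((hi hF i).sub (hi hF₀ i)).const_mul _
  rw [← sub_nonpos, ← mean_sub hv.2 hv₀.2]
  calc mean (fun t => quad (F t) (v t) - quad (F₀ t) (v t))
      ≤ mean (fun t => ∑ i, c i * (‖φ i (F t - F₁ t)‖ - ‖φ i (F₀ t - F₁ t)‖)) := by
        refine mean_mono (hv.2.sub hv₀.2) (integrable_finsetSum _ fun i _ => hi' i) ?_
        filter_upwards [key] with t ht
        rwa [← quad_sub_mat]
    _ = ∑ i, c i * (mean (fun t => ‖φ i (F t - F₁ t)‖) -
          mean (fun t => ‖φ i (F₀ t - F₁ t)‖)) := by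
        rw [mean_finset_sum _ fun i _ => hi' i]
        refine Finset.sum_congr rfl fun i _ => ?_
        rw [mean_const_mul_real, mean_sub (hi hF i) (hi hF₀ i)]
    _ ≤ 0 := Finset.sum_nonpos fun i _ =>
        mul_nonpos_of_nonneg_of_nonpos (hc i) (sub_nonpos.2 (hle i))

/-- Linear functionals with prescribed means control the mean of a quadratic form. -/
lemma mean_quad_le_of_eq {ι : Type*} [Fintype ι]
    (φ : ι → Matrix (Fin T) (Fin T) ℂ →ₗ[ℝ] ℝ)
    (hG : IsSpectralDensity G) (hG₀ : IsSpectralDensity G₀)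
    (heq : ∀ i, mean (fun t => φ i (G t)) = mean (fun t => φ i (G₀ t)))
    {v : VecFn T} (hv : MemL2 G v) (hv₀ : MemL2 G₀ v) (c : ι → ℝ)
    (key : ∀ᵐ t ∂freq, quad (G t - G₀ t) (v t) ≤ ∑ i, c i * φ i (G t - G₀ t)) :
    mean (fun t => quad (G t) (v t)) ≤ mean (fun t => quad (G₀ t) (v t)) := by
  have hi : ∀ i, Integrable (fun t => c i * (φ i (G t) - φ i (G₀ t))) freq := fun i =>
    ((integrable_linear (φ i) hG.integrable).sub
      (integrable_linear (φ i) hG₀.integrable)).const_mul _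
  rw [← sub_nonpos, ← mean_sub hv.2 hv₀.2]
  calc mean (fun t => quad (G t) (v t) - quad (G₀ t) (v t))
      ≤ mean (fun t => ∑ i, c i * (φ i (G t) - φ i (G₀ t))) := by
        refine mean_mono (hv.2.sub hv₀.2) (integrable_finsetSum _ fun i _ => hi i) ?_
        filter_upwards [key] with t ht
        simp only [map_sub] at ht
        rwa [← quad_sub_mat]
    _ = 0 := by
        rw [mean_finset_sum _ fun i _ => hi i]
        refine Finset.sum_eq_zero fun i _ => ?_
        rw [mean_const_mul_real, mean_sub (integrable_linear (φ i) hG.integrable)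
          (integrable_linear (φ i) hG₀.integrable), heq, sub_self, mul_zero]
    _ ≤ 0 := le_rfl

end linear

/-! ### The classes of densities are convex -/

section convex

variable {T : ℕ}

/-- The trace as a real-linear map. -/
noncomputable def traceLinear : Matrix (Fin T) (Fin T) ℂ →ₗ[ℝ] ℂ :=
  Matrix.traceLinearMap (Fin T) ℝ ℂ

/-- An entry as a real-linear map. -/
noncomputable def entryLinear (i j : Fin T) : Matrix (Fin T) (Fin T) ℂ →ₗ[ℝ] ℂ :=
  Matrix.entryLinearMap ℝ ℂ i j

lemma ClassPair.convex_classF (P : ClassPair T) {F₁ : MatFn T} (hF₁ : IsSpectralDensity F₁) :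
    Convex ℝ (P.classF F₁) := by
  rw [convex_iff_forall_pos]
  rintro F ⟨hF, h⟩ F' ⟨hF', h'⟩ s r hs hr hsr
  refine ⟨(hF.const_smul hs.le).add (hF'.const_smul hr.le), ?_⟩
  cases P with
  | first δ q => exact mean_norm_linear_mix_le traceLinear hF hF' hF₁ hs.le hr.le hsr h h'
  | second δ q =>
    exact fun k => mean_norm_linear_mix_le (entryLinear k k) hF hF' hF₁ hs.le hr.le hsr
      (h k) (h' k)
  | third B₁ B₂ hB₁ hB₂ δ q =>
    exact mean_norm_linear_mix_le (matPairLinear B₁) hF hF' hF₁ hs.le hr.le hsr h h'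
  | fourth δ Q hQ =>
    exact fun i j => mean_norm_linear_mix_le (entryLinear i j) hF hF' hF₁ hs.le hr.le hsr
      (h i j) (h' i j)

lemma linear_mix_mem (φ : Matrix (Fin T) (Fin T) ℂ →ₗ[ℝ] ℝ) {V U G G' : MatFn T} {s r q : ℝ}
    (hG : IsSpectralDensity G) (hG' : IsSpectralDensity G') (hs : 0 ≤ s) (hr : 0 ≤ r)
    (hsr : s + r = 1)
    (h : (∀ᵐ t ∂freq, φ (V t) ≤ φ (G t) ∧ φ (G t) ≤ φ (U t)) ∧ mean (fun t => φ (G t)) = q)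
    (h' : (∀ᵐ t ∂freq, φ (V t) ≤ φ (G' t) ∧ φ (G' t) ≤ φ (U t)) ∧
      mean (fun t => φ (G' t)) = q) :
    (∀ᵐ t ∂freq, φ (V t) ≤ φ ((s • G + r • G') t) ∧ φ ((s • G + r • G') t) ≤ φ (U t)) ∧
      mean (fun t => φ ((s • G + r • G') t)) = q := by
  constructor
  · filter_upwards [h.1, h'.1] with t h1 h2
    simp only [Pi.add_apply, Pi.smul_apply, map_add, map_smul]
    exact convex_Icc (φ (V t)) (φ (U t)) h1 h2 hs hr hsr
  · rw [mean_linear_mix φ hG hG', h.2, h'.2, ← add_smul, hsr, one_smul]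

/-- The real part of the trace. -/
noncomputable def traceReLinear : Matrix (Fin T) (Fin T) ℂ →ₗ[ℝ] ℝ := Complex.reLm ∘ₗ traceLinear

/-- The real part of an entry. -/
noncomputable def entryReLinear (i j : Fin T) : Matrix (Fin T) (Fin T) ℂ →ₗ[ℝ] ℝ :=
  Complex.reLm ∘ₗ entryLinear i j

lemma loewner_mix {V U G G' : Matrix (Fin T) (Fin T) ℂ} {s r : ℝ} (hs : 0 ≤ s) (hr : 0 ≤ r)
    (hsr : s + r = 1) (h₁ : V ≤ G) (h₂ : V ≤ G') (h₃ : G ≤ U) (h₄ : G' ≤ U) :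
    V ≤ s • G + r • G' ∧ s • G + r • G' ≤ U := by
  have key : ∀ {X Y : Matrix (Fin T) (Fin T) ℂ}, X.PosSemidef → Y.PosSemidef →
      (s • X + r • Y).PosSemidef := by
    intro X Y hX hY
    have e : s • X + r • Y = (s : ℂ) • X + (r : ℂ) • Y := by ext; simp
    rw [e]
    exact (hX.smul (by exact_mod_cast hs)).add (hY.smul (by exact_mod_cast hr))
  rw [Matrix.le_iff] at *
  rw [Matrix.le_iff]
  have e : ∀ X : Matrix (Fin T) (Fin T) ℂ, X = s • X + r • X := fun X => by
    rw [← add_smul, hsr, one_smul]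
  constructor
  · have h : s • G + r • G' - V = s • (G - V) + r • (G' - V) := by
      nth_rw 1 [e V]
      simp only [smul_sub]
      abel
    rw [h]
    exact key h₁ h₂
  · have h : U - (s • G + r • G') = s • (U - G) + r • (U - G') := by
      nth_rw 1 [e U]
      simp only [smul_sub]
      abel
    rw [h]
    exact key h₃ h₄

lemma ClassPair.convex_classG (P : ClassPair T) (V U : MatFn T) : Convex ℝ (P.classG V U) := by
  rw [convex_iff_forall_pos]
  rintro G ⟨hG, h⟩ G' ⟨hG', h'⟩ s r hs hr hsr
  refine ⟨(hG.const_smul hs.le).add (hG'.const_smul hr.le), ?_⟩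
  cases P with
  | first δ q => exact linear_mix_mem traceReLinear hG hG' hs.le hr.le hsr h h'
  | second δ q =>
    exact fun k => linear_mix_mem (entryReLinear k k) hG hG' hs.le hr.le hsr (h k) (h' k)
  | third B₁ B₂ hB₁ hB₂ δ q => exact linear_mix_mem (matPairLinear B₂) hG hG' hs.le hr.le hsr h h'
  | fourth δ Q hQ =>
    refine ⟨?_, fun i j => ?_⟩
    · filter_upwards [h.1, h'.1] with t h1 h2
      exact loewner_mix hs.le hr.le hsr h1.1 h2.1 h1.2 h2.2
    · have h1 := mean_linear_mix (entryLinear i j) hG hG' (s := s) (r := r)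
      refine h1.trans ?_
      have h2 : mean (fun t => entryLinear i j (G t)) = Q i j := h.2 i j
      have h3 : mean (fun t => entryLinear i j (G' t)) = Q i j := h'.2 i j
      rw [h2, h3, ← add_smul, hsr, one_smul]

end convex

/-! ### The relations imply that the pair is least favorable -/

section pointwise

variable {T : ℕ}

/-- Write `Y = B* B`; cyclicity turns the trace into that of `B X B*`. -/
lemma trace_mul_nonneg {X Y : Matrix (Fin T) (Fin T) ℂ} (hX : X.PosSemidef) (hY : Y.PosSemidef) :
    0 ≤ (X * Y).trace.re := by
  obtain ⟨B, rfl⟩ := CStarAlgebra.nonneg_iff_eq_star_mul_self.mp hY.nonneg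
  rw [star_eq_conjTranspose, ← Matrix.mul_assoc, Matrix.trace_mul_comm, ← Matrix.mul_assoc]
  exact (Complex.nonneg_iff.1 (hX.mul_mul_conjTranspose_same B).trace_nonneg).1

lemma quad_eq_trace (K : Matrix (Fin T) (Fin T) ℂ) (v : Fin T → ℂ) :
    quad K v = (K * rowGram v).trace.re := by
  rw [rowGram, Matrix.mul_vecMulVec, Matrix.trace_vecMulVec, dotProduct_comm, quad]

/-- The Gram matrix of `v M` is `M (v* v) M`, so the invertible factors `M` on both sides of a
relation cancel. -/
lemma rowGram_eq_of_vecMul {M L X : Matrix (Fin T) (Fin T) ℂ} (hM : M.IsHermitian)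
    (h : M * L = 1) {v : Fin T → ℂ} (e : rowGram (v ᵥ* M) = M * X * M) : rowGram v = X := by
  have h' : L * M = 1 := mul_eq_one_comm.1 h
  have h1 : rowGram (v ᵥ* M) = M * rowGram v * M := by
    rw [rowGram, rowGram, Matrix.mul_vecMulVec, Matrix.vecMulVec_mul, star_vecMul, hM.eq]
  rw [h1] at e
  have h2 := congrArg (fun Y => L * Y * L) e
  simpa only [Matrix.mul_assoc, h, Matrix.mul_one, ← Matrix.mul_assoc L M, h', Matrix.one_mul]
    using h2

lemma norm_sq_of_rowGram {v : Fin T → ℂ} {X : Matrix (Fin T) (Fin T) ℂ} (e : rowGram v = X)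
    (k : Fin T) : ‖v k‖ ^ 2 = ‖X k k‖ := by
  rw [← e, rowGram, vecMulVec_apply, norm_mul, Pi.star_apply, norm_star, sq]

lemma norm_trace_eq {X : Matrix (Fin T) (Fin T) ℂ} (hX : X.IsHermitian) :
    ‖X.trace‖ = |X.trace.re| := by
  refine (Complex.abs_re_eq_norm.2 (Complex.conj_eq_iff_im.1 ?_)).symm
  have := Matrix.trace_conjTranspose X
  rw [hX.eq] at this
  exact this.symm

lemma norm_diag_eq {X : Matrix (Fin T) (Fin T) ℂ} (hX : X.IsHermitian) (k : Fin T) :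
    ‖X k k‖ = |(X k k).re| :=
  (Complex.abs_re_eq_norm.2 (Complex.conj_eq_iff_im.1 (hX.apply k k))).symm

/-- The conditions on `γ` say that it is a subgradient of the absolute value at `y`. -/
lemma sign_mul_sub_le {x y γ : ℝ} (h1 : |γ| ≤ 1) (h2 : y ≠ 0 → γ = Real.sign y) :
    γ * (x - y) ≤ |x| - |y| := by
  have h3 : γ * x ≤ |x| := by
    calc γ * x ≤ |γ * x| := le_abs_self _
      _ = |γ| * |x| := abs_mul _ _
      _ ≤ 1 * |x| := by gcongr
      _ = |x| := one_mul _
  have h4 : γ * y = |y| := by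
    by_cases hy : y = 0
    · simp [hy]
    · rw [h2 hy]
      rcases lt_or_gt_of_ne hy with h | h
      · rw [Real.sign_of_neg h, abs_of_neg h]; ring
      · rw [Real.sign_of_pos h, abs_of_pos h]; ring
  linarith

lemma re_mul_star_sub_le {x y γ : ℂ} (h1 : ‖γ‖ ≤ 1) (h2 : y ≠ 0 → γ = y / (‖y‖ : ℂ)) :
    (γ * star (x - y)).re ≤ ‖x‖ - ‖y‖ := by
  have h3 : (γ * star x).re ≤ ‖x‖ := by
    calc (γ * star x).re ≤ ‖γ * star x‖ := Complex.re_le_norm _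
      _ = ‖γ‖ * ‖x‖ := by rw [norm_mul, norm_star]
      _ ≤ 1 * ‖x‖ := by gcongr
      _ = ‖x‖ := one_mul _
  have h4 : γ * star y = (‖y‖ : ℂ) := by
    by_cases hy : y = 0
    · simp [hy]
    · have hy' : (‖y‖ : ℂ) ≠ 0 := by exact_mod_cast norm_ne_zero_iff.2 hy
      rw [h2 hy, div_mul_eq_mul_div, div_eq_iff hy', Complex.star_def, Complex.mul_conj']
      ring
  rw [star_sub, mul_sub, Complex.sub_re, h4, Complex.ofReal_re]
  linarith

/-- Complementary slackness: `γ₁` can be nonzero only where `g₀ = v`, hence `g - g₀ ≥ 0`, and `γ₂`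
only where `g₀ = u`, hence `g - g₀ ≤ 0`. Both products are nonpositive. -/
lemma multiplier_mul_sub_le {b γ₁ γ₂ v u g g₀ : ℝ} (hv : v ≤ g) (hu : g ≤ u) (hv₀ : v ≤ g₀)
    (hu₀ : g₀ ≤ u) (h1 : γ₁ ≤ 0) (h1' : v < g₀ → γ₁ = 0) (h2 : 0 ≤ γ₂)
    (h2' : g₀ < u → γ₂ = 0) : (b + γ₁ + γ₂) * (g - g₀) ≤ b * (g - g₀) := by
  have e1 : γ₁ * (g - g₀) ≤ 0 := by
    rcases hv₀.lt_or_eq with h | h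
    · rw [h1' h, zero_mul]
    · exact mul_nonpos_of_nonpos_of_nonneg h1 (by linarith)
  have e2 : γ₂ * (g - g₀) ≤ 0 := by
    rcases hu₀.lt_or_eq with h | h
    · rw [h2' h, zero_mul]
    · exact mul_nonpos_of_nonneg_of_nonpos h2 (by linarith)
  linarith

/-- Complementary slackness in the Loewner order, with `trace_mul_nonneg` in place of the sign rule
for products. -/
lemma trace_multiplier_le {B Γ₁ Γ₂ V U G G₀ : Matrix (Fin T) (Fin T) ℂ} (hv : V ≤ G) (hu : G ≤ U)
    (hv₀ : V ≤ G₀) (hu₀ : G₀ ≤ U) (h1 : Γ₁ ≤ 0) (h1' : V < G₀ → Γ₁ = 0) (h2 : 0 ≤ Γ₂)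
    (h2' : G₀ < U → Γ₂ = 0) :
    ((G - G₀) * (B + Γ₁ + Γ₂)).trace.re ≤ ((G - G₀) * B).trace.re := by
  have e1 : ((G - G₀) * Γ₁).trace.re ≤ 0 := by
    rcases hv₀.lt_or_eq with h | h
    · simp [h1' h]
    · have h3 := trace_mul_nonneg (Matrix.le_iff.1 (h ▸ hv)) (Matrix.le_iff.1 h1)
      rw [zero_sub, Matrix.mul_neg, Matrix.trace_neg, Complex.neg_re] at h3
      linarith
  have e2 : ((G - G₀) * Γ₂).trace.re ≤ 0 := by
    rcases hu₀.lt_or_eq with h | h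
    · simp [h2' h]
    · have h3 := trace_mul_nonneg (Matrix.le_iff.1 (h ▸ hu)) (Matrix.le_iff.1 h2)
      rw [sub_zero, ← neg_sub G G₀, Matrix.neg_mul, Matrix.trace_neg, Complex.neg_re] at h3
      linarith
  rw [Matrix.mul_add, Matrix.mul_add, Matrix.trace_add, Matrix.trace_add, Complex.add_re,
    Complex.add_re]
  linarith

lemma trace_mul_real_smul_one (K : Matrix (Fin T) (Fin T) ℂ) (c : ℝ) :
    (K * ((c : ℂ) • (1 : Matrix (Fin T) (Fin T) ℂ))).trace.re = c * K.trace.re := by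
  rw [mul_smul_comm, mul_one, Matrix.trace_smul, smul_eq_mul, Complex.re_ofReal_mul]

lemma trace_mul_real_diagonal (K : Matrix (Fin T) (Fin T) ℂ) (c : Fin T → ℝ) :
    (K * Matrix.diagonal fun k => (c k : ℂ)).trace.re = ∑ k, c k * (K k k).re := by
  simp only [Matrix.trace, Matrix.diag_apply, Matrix.mul_diagonal, Complex.re_sum]
  exact Finset.sum_congr rfl fun k _ => by rw [mul_comm, Complex.re_ofReal_mul]

lemma trace_mul_real_smul_transpose (K B : Matrix (Fin T) (Fin T) ℂ) (c : ℝ) :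
    (K * ((c : ℂ) • Bᵀ)).trace.re = c * matPair B K := by
  rw [mul_smul_comm, Matrix.trace_smul, smul_eq_mul, Complex.re_ofReal_mul, matPair]
  congr 2
  simp only [Matrix.trace, Matrix.diag_apply, Matrix.mul_apply, Matrix.transpose_apply]
  exact Finset.sum_congr rfl fun k _ => Finset.sum_congr rfl fun l _ => mul_comm _ _

lemma trace_mul_of (K : Matrix (Fin T) (Fin T) ℂ) (hK : K.IsHermitian) (α : Fin T → Fin T → ℝ)
    (γ : Fin T → Fin T → ℂ) : (K * Matrix.of fun i j => (α i j : ℂ) * γ i j).trace.re =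
      ∑ p : Fin T × Fin T, α p.1 p.2 * (γ p.1 p.2 * star (K p.1 p.2)).re := by
  rw [Matrix.trace_mul_comm, Fintype.sum_prod_type]
  simp only [Matrix.trace, Matrix.diag_apply, Matrix.mul_apply, Matrix.of_apply, Complex.re_sum]
  refine Finset.sum_congr rfl fun i _ => Finset.sum_congr rfl fun j _ => ?_
  rw [mul_assoc, Complex.re_ofReal_mul, ← hK.apply j i]

end pointwise

/-! ### Linear functionals of densities with equal means -/

section linear

variable {T : ℕ}

lemma mean_linear_congr {E : Type*} [NormedAddCommGroup E] [NormedSpace ℝ E] [CompleteSpace E]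
    (φ : Matrix (Fin T) (Fin T) ℂ →ₗ[ℝ] E) {G G' : MatFn T} (hG : IsSpectralDensity G)
    (hG' : IsSpectralDensity G')
    (h : ∀ i j, mean (fun t => G t i j) = mean (fun t => G' t i j)) :
    mean (fun t => φ (G t)) = mean (fun t => φ (G' t)) := by
  let ψ : (Fin T → Fin T → ℂ) →ₗ[ℝ] E := φ
  have key : ∀ {G : MatFn T}, IsSpectralDensity G → mean (fun t => φ (G t)) =
      φ (Matrix.of fun i j => mean fun t => G t i j) := by
    intro G hG
    let g : ℝ → Fin T → Fin T → ℂ := G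
    have h1 : Integrable g freq :=
      Integrable.of_eval fun i => Integrable.of_eval fun j => hG.integrable i j
    have h2 : ∫ t, φ (G t) ∂freq = ψ (∫ t, g t ∂freq) :=
      (LinearMap.toContinuousLinearMap ψ).integral_comp_comm h1
    rw [mean, h2]
    refine (map_smul ψ _ _).symm.trans (congrArg ψ ?_)
    ext i j
    have h3 : (∫ t, g t ∂freq) i j = ∫ t, G t i j ∂freq := by
      rw [eval_integral fun i => Integrable.eval h1 i,
        eval_integral fun j => hG.integrable i j]
    rw [Matrix.of_apply, mean, ← h3]
    rfl
  rw [key hG, key hG']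
  congr 1
  ext i j
  exact h i j

/-- The functional `X ↦ Re Tr (X B)`. -/
noncomputable def traceMulReLinear (B : Matrix (Fin T) (Fin T) ℂ) :
    Matrix (Fin T) (Fin T) ℂ →ₗ[ℝ] ℝ := traceReLinear ∘ₗ LinearMap.mulRight ℝ B

end linear

/-! ### From the relations to the saddle point -/

section relations

variable {T : ℕ} {S : Set ℤ} {a : ℤ → Fin T → ℂ} {F₀ G₀ : MatFn T}
  (ha : Summable fun j : weightIndex S => ∑ k, ‖a j k‖)
  (hF₀ : IsSpectralDensity F₀) (hG₀ : IsSpectralDensity G₀)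
  {d : DualWeights (F₀ + G₀) fun t => (F₀ t + G₀ t)⁻¹}
  {h : WeightedL2 d.left} {C : WeightedL2 d.right} (o : IsOptimal d S a h C)

include o

/-- The two rows of the relations are `A - h` and `h` multiplied by `F₀ + G₀`, so each relation
determines a Gram matrix. -/
lemma IsOptimal.rowGram_eq {C' : VecFn T} (hC : C' =ᵐ[freq] C.fn) : ∀ᵐ t ∂freq,
    (∀ X, rowGram (rowG S a G₀ C' t) = (F₀ t + G₀ t) * X * (F₀ t + G₀ t) →
      rowGram (symbolA S a t - h.fn t) = X) ∧
    ∀ X, rowGram (rowF S a F₀ C' t) = (F₀ t + G₀ t) * X * (F₀ t + G₀ t) →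
      rowGram (h.fn t) = X := by
  filter_upwards [hC, o.eq, d.left.posSemidef, d.mul_eq_one] with t h1 h2 h3 h4
  have e1 : rowG S a G₀ C' t = (symbolA S a t - h.fn t) ᵥ* (F₀ t + G₀ t) := by
    rw [rowG, h1, h2, sub_vecMul, vecMul_add (F₀ t) (G₀ t) (symbolA S a t)]
    abel
  have e2 : rowF S a F₀ C' t = h.fn t ᵥ* (F₀ t + G₀ t) := by
    rw [rowF, h1, h2, sub_sub_cancel]
  exact ⟨fun X hX => rowGram_eq_of_vecMul h3.1 h4 (e1 ▸ hX),
    fun X hX => rowGram_eq_of_vecMul h3.1 h4 (e2 ▸ hX)⟩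

include ha hF₀ hG₀

/-- A saddle point property for the optimal estimate implies that the pair is least favorable, if
this estimate is bounded. -/
lemma IsOptimal.isLeastFavorable {DF DG : Set (MatFn T)} (hsF : ∀ F ∈ DF, IsSpectralDensity F)
    (hsG : ∀ G ∈ DG, IsSpectralDensity G) (hF₀D : F₀ ∈ DF) (hG₀D : G₀ ∈ DG) {b : ℝ}
    (hb : ∀ᵐ t ∂freq, ∀ k, ‖symbolA S a t k - h.fn t k‖ ^ 2 ≤ b)
    (hFle : ∀ F ∈ DF, (∀ K, IsSpectralDensity K → MemL2 K fun t => symbolA S a t - h.fn t) →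
      mean (fun t => quad (F t) (symbolA S a t - h.fn t)) ≤
        mean (fun t => quad (F₀ t) (symbolA S a t - h.fn t)))
    (hGle : ∀ G ∈ DG, (∀ K, IsSpectralDensity K → MemL2 K h.fn) →
      mean (fun t => quad (G t) (h.fn t)) ≤ mean (fun t => quad (G₀ t) (h.fn t))) :
    IsLeastFavorable S a DF DG F₀ G₀ := by
  have hm := h.memL2.1
  have hmA : AEStronglyMeasurable (symbolA S a) freq := (continuous_symbolA ha).aestronglyMeasurable
  have hb1 : ∀ᵐ t ∂freq, ∀ k, ‖symbolA S a t k - h.fn t k‖ ≤ Real.sqrt b :=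
    hb.mono fun t ht k => Real.le_sqrt_of_sq_le (ht k)
  -- Only `A - h` is bounded by hypothesis; the summable weights bound `A`, hence `h`.
  have hb2 : ∀ᵐ t ∂freq, ∀ k, ‖h.fn t k‖ ≤ (∑' j : weightIndex S, ‖a j‖) + Real.sqrt b := by
    filter_upwards [hb1] with t ht k
    have e : h.fn t k = symbolA S a t k - (symbolA S a t k - h.fn t k) := by ring
    rw [e]
    exact (norm_sub_le _ _).trans (add_le_add (norm_symbolA_apply_le ha t k) (ht k))
  refine ⟨hF₀D, hG₀D, fun F hF G hG => ?_⟩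
  have hFs := hsF F hF
  have hGs := hsG G hG
  rw [o.optimalError_eq ha hF₀ hG₀]
  refine (optimalError_le hFs hGs (memL2s_of_bound (hFs.add hGs) hm hb2
    fun n hn => o.vcoef_eq_zero hn)).trans ?_
  exact add_le_add (hFle F hF fun K hK => hK.memL2_of_bound (hmA.sub hm) hb1)
    (hGle G hG fun K hK => hK.memL2_of_bound hm hb2)

end relations

section relations

variable {T : ℕ} {S : Set ℤ} {a : ℤ → Fin T → ℂ} {F₁ V U F₀ G₀ : MatFn T}

lemma IsSpectralDensity.ae_isHermitian_sub {F G : MatFn T} (hF : IsSpectralDensity F)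
    (hG : IsSpectralDensity G) : ∀ᵐ t ∂freq, (F t - G t).IsHermitian := by
  filter_upwards [hF.posSemidef, hG.posSemidef] with t h1 h2
  exact h1.1.sub h2.1

/-- In each case the diagonal of the Gram matrix of `A - h` bounds `A - h`, because `|γ| ≤ 1`. The
increments of the error are traces of `F - F₀` and `G - G₀` against the Gram matrices. The first is
at most a nonnegative combination of differences of deviations from `F₁`, whose means are
nonpositive since `F₀` attains the radii; the second is at most a linear functional whose mean is
fixed by the class. -/
lemma IsOptimal.isLeastFavorable_of_relations
    (ha : Summable fun j : weightIndex S => ∑ k, ‖a j k‖)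
    {d : DualWeights (F₀ + G₀) fun t => (F₀ t + G₀ t)⁻¹}
    {h : WeightedL2 d.left} {C : WeightedL2 d.right} (o : IsOptimal d S a h C)
    (P : ClassPair T) (hF₁ : IsSpectralDensity F₁) (hF₀D : F₀ ∈ P.classF F₁)
    (hG₀D : G₀ ∈ P.classG V U) {C' : VecFn T} (hC : C' =ᵐ[freq] C.fn)
    (hrel : P.Relations S a F₁ V U F₀ G₀ C') :
    IsLeastFavorable S a (P.classF F₁) (P.classG V U) F₀ G₀ := by
  have hF₀ := hF₀D.1
  have hG₀ := hG₀D.1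
  have hgram := o.rowGram_eq hC
  have main := fun b => o.isLeastFavorable ha hF₀ hG₀ (DF := P.classF F₁) (DG := P.classG V U)
    (fun F hF => hF.1) (fun G hG => hG.1) hF₀D hG₀D (b := b)
  cases P with
  | first δ q =>
    obtain ⟨α, β, γ, γ₁, γ₂, hδ, hae⟩ := hrel
    have hgr : ∀ᵐ t ∂freq,
        rowGram (symbolA S a t - h.fn t) =
          ((α ^ 2 * γ t : ℝ) : ℂ) • (1 : Matrix (Fin T) (Fin T) ℂ) ∧
        rowGram (h.fn t) =
          ((β ^ 2 + γ₁ t + γ₂ t : ℝ) : ℂ) • (1 : Matrix (Fin T) (Fin T) ℂ) := by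
      filter_upwards [hgram, hae] with t h1 h2
      refine ⟨h1.1 _ ?_, h1.2 _ ?_⟩
      · rw [h2.1, mul_smul_comm, mul_one, smul_mul_assoc, sq (F₀ t + G₀ t)]
      · rw [h2.2.1, mul_smul_comm, mul_one, smul_mul_assoc, sq (F₀ t + G₀ t)]
    refine main (α ^ 2) ?_ (fun F hF hv => ?_) fun G hG hv => ?_
    · filter_upwards [hgr, hae] with t h1 h2 k
      rw [← Pi.sub_apply, norm_sq_of_rowGram h1.1, Matrix.smul_apply, Matrix.one_apply_eq,
        smul_eq_mul, mul_one, Complex.norm_real, Real.norm_eq_abs, abs_mul,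
        abs_of_nonneg (sq_nonneg α)]
      exact mul_le_of_le_one_right (sq_nonneg α) h2.2.2.1
    · refine mean_quad_le_of_norm (fun _ : Unit => traceLinear) (c := fun _ => α ^ 2)
        (fun _ => sq_nonneg α) hF.1 hF₀ hF₁ (fun _ => hF.2.trans_eq hδ.symm) (hv _ hF.1)
        (hv _ hF₀) ?_
      filter_upwards [hgr, hae, hF₀.ae_isHermitian_sub hF₁] with t h1 h2 h3
      rw [quad_eq_trace, h1.1, trace_mul_real_smul_one, Fintype.sum_unique, mul_assoc]
      refine mul_le_mul_of_nonneg_left ?_ (sq_nonneg α)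
      have h4 := sign_mul_sub_le (x := (F t - F₁ t).trace.re) h2.2.2.1 h2.2.2.2.1
      rw [← norm_trace_eq h3, ← Complex.sub_re, ← Matrix.trace_sub, sub_sub_sub_cancel_right] at h4
      -- For `F₀ - F₁`, which is Hermitian, modulus and real part must agree; for `F - F₁` the
      -- inequality between them is enough.
      exact h4.trans (sub_le_sub_right (Complex.abs_re_le_norm _) _)
    · refine mean_quad_le_of_eq (fun _ : Unit => traceReLinear) hG.1 hG₀
        (fun _ => hG.2.2.trans hG₀D.2.2.symm) (hv _ hG.1) (hv _ hG₀) (fun _ => β ^ 2) ?_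
      filter_upwards [hgr, hae, hG.2.1, hG₀D.2.1] with t h1 h2 h3 h4
      rw [quad_eq_trace, h1.2, trace_mul_real_smul_one, Fintype.sum_unique, map_sub]
      have h5 := h2.2.2.2.2
      rw [Matrix.trace_sub, Complex.sub_re]
      exact multiplier_mul_sub_le h3.1 h3.2 h4.1 h4.2 h5.1 h5.2.1 h5.2.2.1 h5.2.2.2
  | second δ q =>
    obtain ⟨α, β, γ, γ₁, γ₂, hδ, hae⟩ := hrel
    have hgr : ∀ᵐ t ∂freq,
        rowGram (symbolA S a t - h.fn t) =
          Matrix.diagonal (fun k => ((α k ^ 2 * γ k t : ℝ) : ℂ)) ∧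
        rowGram (h.fn t) =
          Matrix.diagonal (fun k => ((β k ^ 2 + γ₁ k t + γ₂ k t : ℝ) : ℂ)) := by
      filter_upwards [hgram, hae] with t h1 h2
      exact ⟨h1.1 _ h2.1, h1.2 _ h2.2.1⟩
    refine main (∑ j, α j ^ 2) ?_ (fun F hF hv => ?_) fun G hG hv => ?_
    · filter_upwards [hgr, hae] with t h1 h2 k
      rw [← Pi.sub_apply, norm_sq_of_rowGram h1.1, Matrix.diagonal_apply_eq, Complex.norm_real,
        Real.norm_eq_abs, abs_mul, abs_of_nonneg (sq_nonneg (α k))]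
      exact (mul_le_of_le_one_right (sq_nonneg (α k)) (h2.2.2 k).1).trans
        (Finset.single_le_sum (f := fun j => α j ^ 2) (fun j _ => sq_nonneg (α j))
          (Finset.mem_univ k))
    · refine mean_quad_le_of_norm (fun k : Fin T => entryLinear k k) (c := fun k => α k ^ 2)
        (fun k => sq_nonneg (α k)) hF.1 hF₀ hF₁ (fun k => (hF.2 k).trans_eq (hδ k).symm)
        (hv _ hF.1) (hv _ hF₀) ?_
      filter_upwards [hgr, hae, hF₀.ae_isHermitian_sub hF₁] with t h1 h2 h3
      rw [quad_eq_trace, h1.1, trace_mul_real_diagonal]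
      refine Finset.sum_le_sum fun k _ => ?_
      rw [mul_assoc]
      refine mul_le_mul_of_nonneg_left ?_ (sq_nonneg (α k))
      have h4 := sign_mul_sub_le (x := ((F t - F₁ t) k k).re) (h2.2.2 k).1 (h2.2.2 k).2.1
      rw [← Matrix.sub_apply, ← norm_diag_eq h3, ← Complex.sub_re, ← Matrix.sub_apply,
        sub_sub_sub_cancel_right] at h4
      exact h4.trans (sub_le_sub_right (Complex.abs_re_le_norm _) _)
    · refine mean_quad_le_of_eq (fun k : Fin T => entryReLinear k k) hG.1 hG₀
        (fun k => (hG.2 k).2.trans (hG₀D.2 k).2.symm) (hv _ hG.1) (hv _ hG₀)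
        (fun k => β k ^ 2) ?_
      filter_upwards [hgr, hae, ae_all_iff.2 fun k => (hG.2 k).1,
        ae_all_iff.2 fun k => (hG₀D.2 k).1] with t h1 h2 h3 h4
      rw [quad_eq_trace, h1.2, trace_mul_real_diagonal]
      refine Finset.sum_le_sum fun k _ => ?_
      have h5 := (h2.2.2 k).2.2
      rw [map_sub, Matrix.sub_apply, Complex.sub_re]
      exact multiplier_mul_sub_le (h3 k).1 (h3 k).2 (h4 k).1 (h4 k).2 h5.1 h5.2.1 h5.2.2.1
        h5.2.2.2
  | third B₁ B₂ hB₁ hB₂ δ q =>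
    obtain ⟨α, β, γ, γ₁, γ₂, hδ, hae⟩ := hrel
    have hgr : ∀ᵐ t ∂freq,
        rowGram (symbolA S a t - h.fn t) = ((α ^ 2 * γ t : ℝ) : ℂ) • B₁ᵀ ∧
        rowGram (h.fn t) = ((β ^ 2 + γ₁ t + γ₂ t : ℝ) : ℂ) • B₂ᵀ := by
      filter_upwards [hgram, hae] with t h1 h2
      refine ⟨h1.1 _ ?_, h1.2 _ ?_⟩
      · rw [h2.1, mul_smul_comm, smul_mul_assoc]
      · rw [h2.2.1, mul_smul_comm, smul_mul_assoc]
    refine main (α ^ 2 * ∑ j, ‖B₁ j j‖) ?_ (fun F hF hv => ?_) fun G hG hv => ?_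
    · filter_upwards [hgr, hae] with t h1 h2 k
      rw [← Pi.sub_apply, norm_sq_of_rowGram h1.1, Matrix.smul_apply, Matrix.transpose_apply,
        smul_eq_mul, norm_mul, Complex.norm_real, Real.norm_eq_abs, abs_mul,
        abs_of_nonneg (sq_nonneg α)]
      exact mul_le_mul (mul_le_of_le_one_right (sq_nonneg α) h2.2.2.1)
        (Finset.single_le_sum (f := fun j => ‖B₁ j j‖) (fun j _ => norm_nonneg _)
          (Finset.mem_univ k)) (norm_nonneg _) (sq_nonneg α)
    · refine mean_quad_le_of_norm (fun _ : Unit => matPairLinear B₁) (c := fun _ => α ^ 2)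
        (fun _ => sq_nonneg α) hF.1 hF₀ hF₁ (fun _ => hF.2.trans_eq hδ.symm) (hv _ hF.1)
        (hv _ hF₀) ?_
      filter_upwards [hgr, hae] with t h1 h2
      rw [quad_eq_trace, h1.1, trace_mul_real_smul_transpose, Fintype.sum_unique, mul_assoc]
      refine mul_le_mul_of_nonneg_left ?_ (sq_nonneg α)
      have h4 := sign_mul_sub_le (x := matPair B₁ (F t - F₁ t)) h2.2.2.1 h2.2.2.2.1
      have h5 : matPair B₁ (F t - F₀ t) =
          matPair B₁ (F t - F₁ t) - matPair B₁ (F₀ t - F₁ t) := by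
        have := map_sub (matPairLinear B₁) (F t - F₁ t) (F₀ t - F₁ t)
        rwa [sub_sub_sub_cancel_right] at this
      rw [h5]
      exact h4
    · refine mean_quad_le_of_eq (fun _ : Unit => matPairLinear B₂) hG.1 hG₀
        (fun _ => hG.2.2.trans hG₀D.2.2.symm) (hv _ hG.1) (hv _ hG₀) (fun _ => β ^ 2) ?_
      filter_upwards [hgr, hae, hG.2.1, hG₀D.2.1] with t h1 h2 h3 h4
      have h5 := h2.2.2.2.2
      have h6 : matPair B₂ (G t - G₀ t) = matPair B₂ (G t) - matPair B₂ (G₀ t) :=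
        map_sub (matPairLinear B₂) (G t) (G₀ t)
      rw [quad_eq_trace, h1.2, trace_mul_real_smul_transpose, Fintype.sum_unique, map_sub, h6]
      exact multiplier_mul_sub_le h3.1 h3.2 h4.1 h4.2 h5.1 h5.2.1 h5.2.2.1 h5.2.2.2
  | fourth δ Q hQ =>
    obtain ⟨α, β, γ, Γ₁, Γ₂, hα, hδ, hae⟩ := hrel
    have hgr : ∀ᵐ t ∂freq,
        rowGram (symbolA S a t - h.fn t) = Matrix.of (fun i j => (α i j : ℂ) * γ i j t) ∧
        rowGram (h.fn t) = vecMulVec β (star β) + Γ₁ t + Γ₂ t := by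
      filter_upwards [hgram, hae] with t h1 h2
      exact ⟨h1.1 _ h2.1, h1.2 _ h2.2.1⟩
    refine main (∑ j, α j j) ?_ (fun F hF hv => ?_) fun G hG hv => ?_
    · filter_upwards [hgr, hae] with t h1 h2 k
      rw [← Pi.sub_apply, norm_sq_of_rowGram h1.1, Matrix.of_apply, norm_mul, Complex.norm_real,
        Real.norm_of_nonneg (hα k k)]
      exact (mul_le_of_le_one_right (hα k k) (h2.2.2.1 k k).1).trans
        (Finset.single_le_sum (f := fun j => α j j) (fun j _ => hα j j) (Finset.mem_univ k))
    · refine mean_quad_le_of_norm (fun p : Fin T × Fin T => entryLinear p.1 p.2)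
        (c := fun p => α p.1 p.2) (fun p => hα p.1 p.2) hF.1 hF₀ hF₁
        (fun p => (hF.2 p.1 p.2).trans_eq (hδ p.1 p.2).symm) (hv _ hF.1) (hv _ hF₀) ?_
      filter_upwards [hgr, hae, hF.1.ae_isHermitian_sub hF₀] with t h1 h2 h3
      rw [quad_eq_trace, h1.1, trace_mul_of _ h3]
      refine Finset.sum_le_sum fun p _ => mul_le_mul_of_nonneg_left ?_ (hα p.1 p.2)
      have h4 := re_mul_star_sub_le (x := F t p.1 p.2 - F₁ t p.1 p.2) (h2.2.2.1 p.1 p.2).1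
        (h2.2.2.1 p.1 p.2).2
      rw [sub_sub_sub_cancel_right] at h4
      exact h4
    -- The constant matrix `β β*` contributes a linear functional of `G`, whose mean is determined
    -- by the prescribed mean `Q` of all entries.
    · refine mean_quad_le_of_eq (fun _ : Unit => traceMulReLinear (vecMulVec β (star β))) hG.1 hG₀
        (fun _ => mean_linear_congr _ hG.1 hG₀ fun i j => (hG.2.2 i j).trans (hG₀D.2.2 i j).symm)
        (hv _ hG.1) (hv _ hG₀) (fun _ => 1) ?_
      filter_upwards [hgr, hae, hG.2.1, hG₀D.2.1] with t h1 h2 h3 h4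
      have h5 := h2.2.2.2
      rw [quad_eq_trace, h1.2, Fintype.sum_unique, one_mul]
      exact trace_multiplier_le h3.1 h3.2 h4.1 h4.2 h5.1 h5.2.1 h5.2.2.1 h5.2.2.2

end relations

lemma finite_missing {s : ℕ} (M N : Fin s → ℕ) : (missing M N).Finite :=
  Set.finite_iUnion fun _ => Set.finite_Icc _ _

end MinimaxFiltering

open MinimaxFiltering
theorem theorem4 {T s : ℕ} (M N : Fin s → ℕ) (hM : ∀ l, 1 ≤ M l)
    (a : ℤ → Fin T → ℂ)
    (ha : Summable fun j : weightIndex (missing M N) => ∑ k, ‖a j k‖)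
    (F₁ V U : MatFn T) (hF₁ : IsSpectralDensity F₁) (hV : IsSpectralDensity V)
    (hU : IsSpectralDensity U)
    (P : ClassPair T) (F₀ G₀ : MatFn T)
    (hF₀ : F₀ ∈ P.classF F₁) (hG₀ : G₀ ∈ P.classG V U) (hmin : Minimality F₀ G₀) :
    (∃ c C, IsCoefficient (missing M N) a F₀ G₀ c ∧ IsFourierSum c C) ∧
    ∀ c C, IsCoefficient (missing M N) a F₀ G₀ c → IsFourierSum c C →
      (P.Relations (missing M N) a F₁ V U F₀ G₀ C →
        IsExtremal (missing M N) a (P.classF F₁) (P.classG V U) F₀ G₀) ∧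
      (IsExtremal (missing M N) a (P.classF F₁) (P.classG V U) F₀ G₀ ↔
        IsLeastFavorable (missing M N) a (P.classF F₁) (P.classG V U) F₀ G₀) ∧
      (IsLeastFavorable (missing M N) a (P.classF F₁) (P.classG V U) F₀ G₀ →
        ∀ h, IsMinimaxRobust (missing M N) a (P.classF F₁) (P.classG V U) h ↔
          IsGivenByFormula (missing M N) a F₀ G₀ C h) := by
  have hS := finite_missing M N
  obtain ⟨h, D, o⟩ := exists_isOptimal ha hF₀.1 hG₀.1
    (dualWeights_of_minimality hF₀.1 hG₀.1 hmin) hS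
  refine ⟨⟨vcoef D.fn, D.fn, (o.isCoefficient_iff ha hF₀.1 hG₀.1).2 rfl, o.isFourierSum⟩, ?_⟩
  intro c C hc hC
  rw [o.isCoefficient_iff ha hF₀.1 hG₀.1] at hc
  subst hc
  have hCD : C =ᵐ[freq] D.fn := hC.ae_eq o.isFourierSum
  have hext := o.isExtremal_iff ha (P.convex_classF hF₁) (P.convex_classG V U)
    (fun F hF => hF.1) (fun G hG => hG.1) hF₀ hG₀ hS
  refine ⟨fun hrel => hext.2 (o.isLeastFavorable_of_relations ha P hF₁ hF₀ hG₀ hCD hrel), hext,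
    fun hlf g => ?_⟩
  rw [o.isMinimaxRobust_iff ha (P.convex_classF hF₁) (P.convex_classG V U)
    (fun F hF => hF.1) (fun G hG => hG.1) hF₀ hG₀ hlf, ← o.isGivenByFormula_iff]
  constructor <;> intro H <;> filter_upwards [H, hCD] with t h1 h2
  · rw [h1, h2]
  · rw [h1, h2]
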